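/- Let $N\ge 1$, $l\in\frac12\mathbb Z_{>0}$ with $Nl\in\mathbb Z$, $\tau\in i\mathbb R_{>0}$, and $\eta=\frac{r'}{2lr}$ with $r\in\mathbb Z_{>0}$, $r'\in\mathbb Z\setminus\{0\}$ and $|\eta|<\frac1{2(2l+1)}$. Put $$\theta_{ab}(z)=\theta_{ab}(z,\tau)=\sum_{n\in\mathbb Z}\exp\Bigl(\pi i(\tfrac a2+n)^2\tau+2\pi i(\tfrac a2+n)(\tfrac b2+z)\Bigr),\qquad [z]=\theta_{11}(z,\tau),$$ $$[z]_k=\prod_{j=0}^{k-1}[z+2j\eta],\qquad [z;a]_k=[z+a]_k[-z+a]_k,\qquad h_\pm(u)=(2[u\mp2l\eta])^N .$$ Write $\theta^{(0)},\theta^{(1)},\theta^{(2)},\theta^{(3)}$ for $\theta_{11},\theta_{10},\theta_{00},\theta_{01}$. *The model.* Let $V=\Theta_{00}^{4l+}$ be the space of entire functions $f$ with $f(z+1)=f(-z)=f(z)$ and $f(z+\tau)=e^{-4l\pi i(2z+\tau)}f(z)$. The generators $S^a$ ($a=0,\dots,3$) of the Sklyanin algebra act on $V$ by $$(\rho(S^a)f)(z)=\frac{s_a(z-l\eta)f(z+\eta)-s_a(-z-l\eta)f(z-\eta)}{\theta_{11}(2z)},\qquad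 s_a(z)=\epsilon_a\,\theta^{(a)}(\eta)\,\theta^{(a)}(2z),\quad \epsilon_2=i,\ \epsilon_0=\epsilon_1=\epsilon_3=1.$$ Let $\mathcal H=V_N\otimes\dots\otimes V_1$ with $V_n=V$, let $\rho_n$ be $\rho$ acting on the factor $V_n$, and let $$T(u)=\operatorname{tr}_{\mathbb C^2}L_N(u)\cdots L_1(u),\qquad L_n(u)=\sum_{a=0}^3\frac{\theta^{(a)}(u)}{\theta^{(a)}(\eta)}\,\rho_n(S^a)\otimes\sigma^a,$$ where $\sigma^0=1$ and $\sigma^1,\sigma^2,\sigma^3$ are the Pauli matrices. Equip $V$ with the Sklyanin form $$\langle f,g\rangle=\int_0^1dx\int_0^{\tau/i}dy\;\overline{f(z)}\,g(z)\,\mu(z,\bar z),\quad z=x+iy,$$ $$\mu(z,w)=\frac{\theta_{11}(2z)\,\theta_{11}(2w)}{\prod_{j=0}^{2l+1}\theta_{00}(z+w+(2j-2l-1)\eta)\,\theta_{00}(z-w+(2j-2l-1)\eta)},$$ $\mathcal H$ with the induced form $\langle\otimes f_n,\otimes g_n\rangle=\prod_n\langle f_n,g_n\rangle$, and $(\mathbb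 C^{2l+1})^{\otimes N}$ with the standard Hermitian form. *The operators $Q_R$ and $Q_L$.* Let $f_\pm(\lambda,u)\in V$ be the function $z\mapsto\bigl[z;\frac{\pm\lambda+u}2+(-l+1)\eta\bigr]_{2l}$. For arbitrary complex parameters $\tau_{kj}$ ($1\le k\le 2l+1$, $1\le j\le r$) define linear maps $S^i_j(u):\mathbb C^{2l+1}\to V$ ($1\le i,j\le r$) by $$S^{j\pm1}_j(u)e_k=\tau_{kj}f_\pm(2(2j-1)l\eta,u),\quad S^1_1(u)e_k=\tau_{k1}f_-(2l\eta,u),\quad S^r_r(u)e_k=\tau_{kr}f_+(2(2r-1)l\eta,u),$$ and $S^i_j(u)=0$ otherwise (the hypotheses force $r\ge3$, so there is no conflict between these formulas), and put $$Q_R(u)=\sum_{i_1,\dots,i_N=1}^rS^{i_N}_{i_{N-1}}(u)\otimes\dots\otimes S^{i_2}_{i_1}(u)\otimes S^{i_1}_{i_N}(u):(\mathbb C^{2l+1})^{\otimes N}\to\mathcal H ,\qquad Q_L(u)=Q_R(-\bar u)^*:\mathcal H\to(\mathbb C^{2l+1})^{\otimes N}.$$ *Result.* For every $u\in\mathbb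 C$ the operator $T(u)$ has exactly one adjoint with respect to the Sklyanin form on $\mathcal H$, namely $$T(u)^*=(-1)^N\,T(-\bar u),$$ and $Q_L$ satisfies, for every $u\in\mathbb C$, the $QT$-relation $$Q_L(u)T(u)=h_-(u)\,Q_L(u-2\eta)+h_+(u)\,Q_L(u+2\eta).$$ -/

import Mathlib

open Complex
open scoped Real ComplexConjugate TensorProduct

namespace Sklyanin

/-- The theta function with characteristics
`θ_{ab}(z, τ) = ∑_{n ∈ ℤ} exp (π i (a/2 + n)² τ + 2 π i (a/2 + n) (b/2 + z))`. -/
noncomputable def theta (a b : ℕ) (z τ : ℂ) : ℂ :=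
  ∑' n : ℤ, cexp (π * I * ((a : ℂ) / 2 + n) ^ 2 * τ + 2 * π * I * ((a : ℂ) / 2 + n) * ((b : ℂ) / 2 + z))

theorem theta_eq (a b : ℕ) (z τ : ℂ) :
    theta a b z τ = cexp (π * I * (a : ℂ) ^ 2 / 4 * τ + π * I * a * ((b : ℂ) / 2 + z)) *
      jacobiTheta₂ (z + (b : ℂ) / 2 + (a : ℂ) / 2 * τ) τ := by
  rw [theta, jacobiTheta₂, ← tsum_mul_left]
  refine tsum_congr fun n => ?_
  rw [jacobiTheta₂_term, ← Complex.exp_add]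
  congr 1
  ring

theorem differentiable_theta (a b : ℕ) {τ : ℂ} (hτ : 0 < τ.im) :
    Differentiable ℂ (fun z => theta a b z τ) := by
  have h : Differentiable ℂ (fun z => jacobiTheta₂ z τ) :=
    fun z => differentiableAt_jacobiTheta₂_fst z hτ
  simp_rw [theta_eq]
  refine Differentiable.mul (by fun_prop) ?_
  exact h.comp (by fun_prop)

theorem theta_add_one (a b : ℕ) (z τ : ℂ) : theta a b (z + 1) τ = (-1) ^ a * theta a b z τ := by
  rw [theta_eq, theta_eq, show z + 1 + (b : ℂ) / 2 + (a : ℂ) / 2 * τ =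
    (z + (b : ℂ) / 2 + (a : ℂ) / 2 * τ) + 1 by ring, jacobiTheta₂_add_left, ← mul_assoc]
  congr 1
  rw [show (π * I * (a : ℂ) ^ 2 / 4 * τ + π * I * a * ((b : ℂ) / 2 + (z + 1))) =
    (a : ℂ) * (π * I) + (π * I * (a : ℂ) ^ 2 / 4 * τ + π * I * a * ((b : ℂ) / 2 + z)) by ring,
    Complex.exp_add, Complex.exp_nat_mul, Complex.exp_pi_mul_I]

theorem theta_add_tau (a b : ℕ) (z τ : ℂ) :
    theta a b (z + τ) τ = (-1) ^ b * cexp (-π * I * (τ + 2 * z)) * theta a b z τ := by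
  rw [theta_eq, theta_eq, show z + τ + (b : ℂ) / 2 + (a : ℂ) / 2 * τ =
    (z + (b : ℂ) / 2 + (a : ℂ) / 2 * τ) + τ by ring, jacobiTheta₂_add_left', ← mul_assoc, ← mul_assoc]
  congr 1
  have h : ((-1 : ℂ)) ^ b = cexp (-((b : ℂ) * (π * I))) := by
    rw [Complex.exp_neg, Complex.exp_nat_mul, Complex.exp_pi_mul_I, ← inv_pow]
    norm_num
  rw [h, ← Complex.exp_add, ← Complex.exp_add, ← Complex.exp_add]
  congr 1
  ring

theorem theta_neg (a b : ℕ) (z τ : ℂ) :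
    theta a b (-z) τ = (-1) ^ (a * b) * theta a b z τ := by
  have key : theta a b (-z) τ =
      ∑' n : ℤ, cexp (-((a : ℂ) * b * (π * I))) * cexp (-(b : ℂ) * n * (2 * π * I)) *
        cexp (π * I * ((a : ℂ) / 2 + n) ^ 2 * τ + 2 * π * I * ((a : ℂ) / 2 + n) * ((b : ℂ) / 2 + z)) := by
    rw [theta, ← Equiv.tsum_eq (Equiv.subLeft (-(a : ℤ)))]
    refine tsum_congr fun n => ?_
    rw [← Complex.exp_add, ← Complex.exp_add]
    congr 1
    simp only [Equiv.subLeft_apply]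
    push_cast
    ring
  rw [key, theta, ← tsum_mul_left]
  refine tsum_congr fun n => ?_
  congr 1
  have h1 : cexp (-(b : ℂ) * n * (2 * π * I)) = 1 := by
    rw [show -(b : ℂ) * n * (2 * π * I) = ((-(b : ℤ) * n : ℤ) : ℂ) * (2 * π * I) by push_cast; ring]
    exact Complex.exp_int_mul_two_pi_mul_I _
  have h2 : cexp (-((a : ℂ) * b * (π * I))) = (-1) ^ (a * b) := by
    rw [Complex.exp_neg, show (a : ℂ) * b * (π * I) = ((a * b : ℕ) : ℂ) * (π * I) by push_cast; ring,
      Complex.exp_nat_mul, Complex.exp_pi_mul_I, ← inv_pow]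
    norm_num
  rw [h1, h2, mul_one]

/-! ### Zeros of the theta functions -/

/-- The half product `∏_{n ≥ 0} (1 + q^{2n+1} e^{2πiz})`, `q = e^{πiτ}`. -/
noncomputable def halfProd (τ z : ℂ) : ℂ :=
  ∏' n : ℕ, (1 + cexp (2 * π * I * z) * cexp (π * I * τ) ^ (2 * n + 1))

theorem norm_q_lt_one {τ : ℂ} (hτ : 0 < τ.im) : ‖cexp (π * I * τ)‖ < 1 := by
  rw [Complex.norm_exp]
  simp only [mul_re, ofReal_re, I_re, mul_zero, ofReal_im, I_im, mul_one, sub_self, zero_mul, mul_im,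
    add_zero, zero_sub, Real.exp_lt_one_iff]
  have := Real.pi_pos
  nlinarith [mul_pos this hτ]

theorem summable_q {τ : ℂ} (hτ : 0 < τ.im) (C : ℝ) :
    Summable fun n : ℕ => C * ‖cexp (π * I * τ)‖ ^ (2 * n + 1) := by
  refine Summable.mul_left _ ?_
  have h := summable_geometric_of_lt_one (norm_nonneg _) (norm_q_lt_one hτ)
  exact h.comp_injective (i := fun n : ℕ => 2 * n + 1) (fun a b hab => by simpa using hab)

theorem differentiable_halfProd {τ : ℂ} (hτ : 0 < τ.im) : Differentiable ℂ (halfProd τ) := by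
  have hloc : HasProdLocallyUniformlyOn
      (fun (n : ℕ) (z : ℂ) => 1 + cexp (2 * π * I * z) * cexp (π * I * τ) ^ (2 * n + 1))
      (halfProd τ) Set.univ := by
    refine hasProdLocallyUniformlyOn_of_forall_compact isOpen_univ ?_
    intro K _ hK
    obtain ⟨C, hC⟩ := hK.exists_bound_of_continuousOn
      (f := fun z : ℂ => cexp (2 * π * I * z)) (by fun_prop)
    refine (summable_q hτ C).hasProdUniformlyOn_nat_one_add hK (.of_forall fun n x hx => ?_)
      (fun _ => by fun_prop)
    rw [norm_mul, norm_pow]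
    exact mul_le_mul_of_nonneg_right (hC x hx) (by positivity)
  have := hloc.differentiableOn (.of_forall fun _ => by
    simpa [Finset.prod_fn] using DifferentiableOn.finsetProd (fun _ _ => by fun_prop)) isOpen_univ
  exact differentiableOn_univ.mp this

theorem summable_halfProd {τ : ℂ} (hτ : 0 < τ.im) (z : ℂ) :
    Summable fun n : ℕ => ‖cexp (2 * π * I * z) * cexp (π * I * τ) ^ (2 * n + 1)‖ := by
  simpa [norm_mul, norm_pow] using summable_q hτ ‖cexp (2 * π * I * z)‖

theorem halfProd_ne_zero {τ : ℂ} (hτ : 0 < τ.im) {z : ℂ} (hz : -(τ.im / 2) < z.im) :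
    halfProd τ z ≠ 0 := by
  refine tprod_one_add_ne_zero_of_summable (fun n h => ?_) (summable_halfProd hτ z)
  have h1 : cexp (2 * π * I * z) * cexp (π * I * τ) ^ (2 * n + 1) = -1 := by
    linear_combination h
  have h2 := congrArg norm h1
  rw [norm_neg, norm_one, ← Complex.exp_nat_mul, ← Complex.exp_add, Complex.norm_exp,
    Real.exp_eq_one_iff] at h2
  have h3 : (2 * π * I * z + ((2 * n + 1 : ℕ) : ℂ) * (π * I * τ)).re =
      -(π * (2 * z.im + (2 * n + 1) * τ.im)) := by
    have : (2 * π * I * z + ((2 * n + 1 : ℕ) : ℂ) * (π * I * τ)) =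
      ((π : ℝ) : ℂ) * I * (2 * z + ((2 * n + 1 : ℝ) : ℂ) * τ) := by push_cast; ring
    rw [this]
    simp only [mul_re, mul_im, add_re, add_im, ofReal_re, ofReal_im, I_re, I_im]
    norm_num
  rw [h3] at h2
  have hn : (0 : ℝ) ≤ n := n.cast_nonneg
  have : 0 < π * (2 * z.im + (2 * n + 1) * τ.im) := by
    apply mul_pos Real.pi_pos
    nlinarith [mul_nonneg hn hτ.le]
  linarith

theorem halfProd_step {τ : ℂ} (hτ : 0 < τ.im) (z : ℂ) :
    halfProd τ z = (1 + cexp (2 * π * I * z) * cexp (π * I * τ)) * halfProd τ (z + τ) := by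
  have hs := summable_halfProd hτ z
  rw [halfProd, halfProd, tprod_eq_zero_mul' ?_]
  · congr 1
    · simp
    · refine tprod_congr fun n => ?_
      rw [← Complex.exp_nat_mul, ← Complex.exp_nat_mul, ← Complex.exp_add, ← Complex.exp_add]
      congr 2
      push_cast
      ring
  · exact multipliable_one_add_of_summable ((summable_nat_add_iff 1).mpr hs)

theorem halfProd_add_one (τ z : ℂ) : halfProd τ (z + 1) = halfProd τ z := by
  rw [halfProd, halfProd]
  refine tprod_congr fun n => ?_
  rw [show 2 * π * I * (z + 1) = 2 * π * I * z + 2 * π * I by ring, Complex.exp_add,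
    Complex.exp_two_pi_mul_I, mul_one]

/-- The product vanishing exactly at the zeros of `θ₀₀`. -/
noncomputable def thetaProd (τ z : ℂ) : ℂ := halfProd τ z * halfProd τ (-z)

theorem differentiable_thetaProd {τ : ℂ} (hτ : 0 < τ.im) : Differentiable ℂ (thetaProd τ) := by
  have := differentiable_halfProd hτ
  exact this.mul (this.comp differentiable_neg)

theorem thetaProd_add_one (τ z : ℂ) : thetaProd τ (z + 1) = thetaProd τ z := by
  rw [thetaProd, thetaProd, halfProd_add_one, ← halfProd_add_one τ (-(z + 1))]
  congr 2
  ring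

theorem thetaProd_add_tau {τ : ℂ} (hτ : 0 < τ.im) (z : ℂ) :
    thetaProd τ (z + τ) = cexp (-π * I * (τ + 2 * z)) * thetaProd τ z := by
  rw [thetaProd, thetaProd, halfProd_step hτ z, halfProd_step hτ (-(z + τ)),
    show -(z + τ) + τ = -z by ring]
  have : 1 + cexp (2 * π * I * -(z + τ)) * cexp (π * I * τ) =
      cexp (-π * I * (τ + 2 * z)) * (1 + cexp (2 * π * I * z) * cexp (π * I * τ)) := by
    rw [mul_add, ← Complex.exp_add, ← Complex.exp_add, ← Complex.exp_add, mul_one, add_comm]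
    congr 1
    · congr 1
      ring
    · rw [show -π * I * (τ + 2 * z) + (2 * π * I * z + π * I * τ) = 0 by ring, Complex.exp_zero]
  rw [this]
  ring

/-- Reduction of a quasi-periodic statement to the strip `0 ≤ Im z < Im τ`. -/
theorem strip_induction {τ : ℂ} (hτ : 0 < τ.im) {p : ℂ → Prop}
    (h0 : ∀ z : ℂ, 0 ≤ z.im → z.im < τ.im → p z) (h1 : ∀ z, p z ↔ p (z + τ)) (z : ℂ) : p z := by
  have hshift : ∀ (n : ℤ) (z : ℂ), p z ↔ p (z + n * τ) := by
    intro n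
    induction n using Int.induction_on with
    | zero => intro z; simp
    | succ n ih => intro z; rw [ih z, h1]; push_cast; ring_nf
    | pred n ih => intro z; rw [ih z, h1 (z + ((-(n : ℤ) - 1 : ℤ) : ℂ) * τ)]; push_cast; ring_nf
  rw [hshift (-⌊z.im / τ.im⌋) z]
  have him : (z + ((-⌊z.im / τ.im⌋ : ℤ) : ℂ) * τ).im = z.im - ⌊z.im / τ.im⌋ * τ.im := by
    simp; ring
  have hf1 := Int.floor_le (z.im / τ.im)
  have hf2 := Int.lt_floor_add_one (z.im / τ.im)
  rw [le_div_iff₀ hτ] at hf1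
  rw [div_lt_iff₀ hτ] at hf2
  apply h0
  · rw [him]; linarith
  · rw [him]; linarith

theorem thetaProd_strip {τ : ℂ} (hτ : 0 < τ.im) (z : ℂ) :
    thetaProd τ z = (1 + cexp (2 * π * I * -z) * cexp (π * I * τ)) *
      (halfProd τ z * halfProd τ (-z + τ)) := by
  rw [thetaProd, halfProd_step hτ (-z)]
  ring

theorem thetaProd_strip_ne {τ : ℂ} (hτ : 0 < τ.im) {z : ℂ} (h0 : 0 ≤ z.im) (h1 : z.im < τ.im) :
    halfProd τ z * halfProd τ (-z + τ) ≠ 0 := by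
  refine mul_ne_zero (halfProd_ne_zero hτ (by linarith)) (halfProd_ne_zero hτ ?_)
  simp only [add_im, neg_im]
  linarith

theorem thetaProd_zero {τ : ℂ} (hτ : 0 < τ.im) (z : ℂ) :
    thetaProd τ z = 0 → ∃ m n : ℤ, z = 1 / 2 + τ / 2 + m + n * τ := by
  refine strip_induction hτ (p := fun z => thetaProd τ z = 0 →
    ∃ m n : ℤ, z = 1 / 2 + τ / 2 + m + n * τ) ?_ ?_ z
  · intro z h0 h1 hz
    rw [thetaProd_strip hτ] at hz
    have h2 := (mul_eq_zero.mp hz).resolve_right (thetaProd_strip_ne hτ h0 h1)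
    rw [← Complex.exp_add] at h2
    have h3 : cexp (2 * π * I * -z + π * I * τ) = cexp (π * I) := by
      rw [Complex.exp_pi_mul_I]; linear_combination h2
    obtain ⟨k, hk⟩ := Complex.exp_eq_exp_iff_exists_int.mp h3
    have hpi : (2 * (π : ℂ) * I) ≠ 0 := Complex.two_pi_I_ne_zero
    refine ⟨-k - 1, 0, ?_⟩
    apply mul_left_cancel₀ hpi
    push_cast
    linear_combination -hk
  · intro z
    rw [thetaProd_add_tau hτ, mul_eq_zero, or_iff_right (Complex.exp_ne_zero _)]
    refine imp_congr_right fun _ => ⟨?_, ?_⟩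
    · rintro ⟨m, n, h⟩; exact ⟨m, n + 1, by rw [h]; push_cast; ring⟩
    · rintro ⟨m, n, h⟩; exact ⟨m, n - 1, by push_cast; linear_combination h⟩

theorem deriv_thetaProd_ne {τ : ℂ} (hτ : 0 < τ.im) (z : ℂ) :
    thetaProd τ z = 0 → deriv (thetaProd τ) z ≠ 0 := by
  refine strip_induction hτ (p := fun z => thetaProd τ z = 0 → deriv (thetaProd τ) z ≠ 0) ?_ ?_ z
  · intro z h0 h1 hz
    have hA := differentiable_halfProd hτ
    have hne := thetaProd_strip_ne hτ h0 h1
    have hz' := hz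
    rw [thetaProd_strip hτ] at hz
    have h2 := (mul_eq_zero.mp hz).resolve_right hne
    have hd1 : HasDerivAt (fun z => 1 + cexp (2 * π * I * -z) * cexp (π * I * τ))
        (cexp (2 * π * I * -z) * (2 * π * I * -1) * cexp (π * I * τ)) z := by
      have := ((((hasDerivAt_id z).neg.const_mul (2 * π * I)).cexp).mul_const
        (cexp (π * I * τ))).const_add 1
      simpa using! this
    have hd2 : DifferentiableAt ℂ (fun z => halfProd τ z * halfProd τ (-z + τ)) z :=
      (hA.mul (hA.comp (by fun_prop))) z
    have hd : HasDerivAt (thetaProd τ) _ z :=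
      (hd1.mul hd2.hasDerivAt).congr_of_eventuallyEq
        (Filter.Eventually.of_forall fun w => thetaProd_strip hτ w)
    rw [hd.deriv, h2, zero_mul, add_zero]
    refine mul_ne_zero ?_ hne
    refine mul_ne_zero (mul_ne_zero (Complex.exp_ne_zero _) ?_) (Complex.exp_ne_zero _)
    simp [Complex.I_ne_zero, Real.pi_ne_zero]
  · intro z
    have hP := differentiable_thetaProd hτ
    rw [thetaProd_add_tau hτ, mul_eq_zero, or_iff_right (Complex.exp_ne_zero _)]
    refine forall_congr' fun hz => not_congr ?_
    have e1 : HasDerivAt (fun z => thetaProd τ (z + τ)) (deriv (thetaProd τ) (z + τ)) z := by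
      have := (hP (z + τ)).hasDerivAt.comp_add_const z τ
      exact this
    have e2 : DifferentiableAt ℂ (fun z => cexp (-π * I * (τ + 2 * z))) z := by fun_prop
    have e3 := e2.hasDerivAt.mul (hP z).hasDerivAt
    have e4 : deriv (thetaProd τ) (z + τ) = _ := e1.unique
      (e3.congr_of_eventuallyEq (Filter.Eventually.of_forall fun w => thetaProd_add_tau hτ w))
    rw [e4, hz, mul_zero, zero_add, mul_eq_zero, or_iff_right (Complex.exp_ne_zero _)]

/-! ### Quotients of entire functions -/

/-- The quotient of two functions, continued to the zeros of the denominator by the ratio of the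
derivatives there (its value at a simple zero of the denominator which is a zero of the
numerator). -/
noncomputable def extQuot (g D : ℂ → ℂ) (z : ℂ) : ℂ :=
  open Classical in if D z = 0 then deriv g z / deriv D z else g z / D z

theorem differentiable_extQuot {g D : ℂ → ℂ} (hg : Differentiable ℂ g) (hD : Differentiable ℂ D)
    (hsimple : ∀ z, D z = 0 → deriv D z ≠ 0) (hvan : ∀ z, D z = 0 → g z = 0) :
    Differentiable ℂ (extQuot g D) := by
  intro z₀
  by_cases h0 : D z₀ = 0
  · have hdg : DifferentiableAt ℂ (dslope g z₀) z₀ :=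
      ((Complex.differentiableOn_dslope Filter.univ_mem).mpr hg.differentiableOn).differentiableAt
        Filter.univ_mem
    have hdD : DifferentiableAt ℂ (dslope D z₀) z₀ :=
      ((Complex.differentiableOn_dslope Filter.univ_mem).mpr hD.differentiableOn).differentiableAt
        Filter.univ_mem
    have hne : dslope D z₀ z₀ ≠ 0 := by rw [dslope_same]; exact hsimple z₀ h0
    refine (hdg.div hdD hne).congr_of_eventuallyEq ?_
    filter_upwards [hdD.continuousAt.eventually_ne hne] with z hz
    by_cases hzz : z = z₀
    · subst hzz
      simp [extQuot, h0]
    · have e1 := sub_smul_dslope g z₀ z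
      have e2 := sub_smul_dslope D z₀ z
      rw [h0, sub_zero, smul_eq_mul] at e2
      rw [hvan z₀ h0, sub_zero, smul_eq_mul] at e1
      have hs : z - z₀ ≠ 0 := sub_ne_zero.mpr hzz
      have hDz : D z ≠ 0 := by rw [← e2]; exact mul_ne_zero hs hz
      rw [extQuot, if_neg hDz, ← e1, ← e2, mul_div_mul_left _ _ hs, Pi.div_apply]
  · refine ((hg z₀).div (hD z₀) h0).congr_of_eventuallyEq ?_
    filter_upwards [(hD z₀).continuousAt.eventually_ne h0] with z hz
    rw [extQuot, if_neg hz, Pi.div_apply]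

theorem extQuot_mul {g D : ℂ → ℂ} (hvan : ∀ z, D z = 0 → g z = 0) (z : ℂ) :
    extQuot g D z * D z = g z := by
  by_cases h : D z = 0
  · rw [h, mul_zero, hvan z h]
  · rw [extQuot, if_neg h, div_mul_cancel₀ _ h]

theorem dense_ne_zero {D : ℂ → ℂ} (hsimple : ∀ z, D z = 0 → deriv D z ≠ 0) :
    Dense {z | D z ≠ 0} := by
  have hc : {z | D z ≠ 0} = {z | D z = 0}ᶜ := rfl
  rw [hc, ← interior_eq_empty_iff_dense_compl, Set.eq_empty_iff_forall_notMem]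
  intro z hz
  have h0 : z ∈ {z | D z = 0} := interior_subset hz
  refine hsimple z h0 ?_
  have : D =ᶠ[nhds z] fun _ => 0 := by
    filter_upwards [isOpen_interior.mem_nhds hz] with w hw
    have h1 : w ∈ {z | D z = 0} := interior_subset hw
    exact h1
  rw [this.deriv_eq, deriv_const]

theorem eq_of_mul_eq {f g D : ℂ → ℂ} (hf : Continuous f) (hg : Continuous g)
    (hsimple : ∀ z, D z = 0 → deriv D z ≠ 0) (h : ∀ z, f z * D z = g z * D z) : f = g :=
  hf.ext_on (dense_ne_zero hsimple) hg fun z hz => mul_right_cancel₀ hz (h z)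

/-! ### Theta function = constant times product -/

theorem jacobiTheta₂_half (τ : ℂ) : jacobiTheta₂ (1 / 2 + τ / 2) τ = 0 := by
  have h1 := jacobiTheta₂_add_left' (-(1 / 2) - τ / 2) τ
  have h2 : jacobiTheta₂ (-(1 / 2) - τ / 2) τ = jacobiTheta₂ (1 / 2 + τ / 2) τ := by
    rw [← jacobiTheta₂_neg_left]; ring_nf
  have h3 : jacobiTheta₂ (-(1 / 2) - τ / 2 + τ) τ = jacobiTheta₂ (1 / 2 + τ / 2) τ := by
    rw [← jacobiTheta₂_add_left]; ring_nf
  rw [h2, h3, show -π * I * (τ + 2 * (-(1 / 2) - τ / 2)) = π * I by ring,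
    Complex.exp_pi_mul_I] at h1
  linear_combination (1 / 2) * h1

theorem jacobiTheta₂_lattice (τ : ℂ) (m n : ℤ) :
    jacobiTheta₂ (1 / 2 + τ / 2 + m + n * τ) τ = 0 := by
  have hm : ∀ (m : ℤ) (z : ℂ), jacobiTheta₂ (z + m) τ = jacobiTheta₂ z τ := by
    intro m
    induction m using Int.induction_on with
    | zero => intro z; simp
    | succ k ih =>
      intro z; rw [← ih z, ← jacobiTheta₂_add_left (z + ((k : ℤ) : ℂ))]; push_cast; ring_nf
    | pred k ih => intro z; rw [← ih z, ← jacobiTheta₂_add_left]; push_cast; ring_nf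
  have hn : ∀ (n : ℤ) (z : ℂ), jacobiTheta₂ (z + n * τ) τ = 0 ↔ jacobiTheta₂ z τ = 0 := by
    have hs : ∀ z : ℂ, jacobiTheta₂ (z + τ) τ = 0 ↔ jacobiTheta₂ z τ = 0 := fun z => by
      rw [jacobiTheta₂_add_left', mul_eq_zero, or_iff_right (Complex.exp_ne_zero _)]
    intro n
    induction n using Int.induction_on with
    | zero => intro z; simp
    | succ k ih => intro z; rw [← ih z, ← hs (z + ((k : ℤ) : ℂ) * τ)]; push_cast; ring_nf
    | pred k ih =>
      intro z; rw [← ih z, ← hs (z + ((-(k : ℤ) - 1 : ℤ) : ℂ) * τ)]; push_cast; ring_nf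
  rw [hn, hm, jacobiTheta₂_half]

theorem jacobiTheta₂_ne_zero_at_zero {t : ℝ} (ht : 0 < t) : jacobiTheta₂ 0 (I * t) ≠ 0 := by
  have him : 0 < (I * (t : ℂ)).im := by simpa using ht
  have hs := hasSum_jacobiTheta₂_term 0 him
  have hterm : ∀ n : ℤ, jacobiTheta₂_term n 0 (I * t) = ((Real.exp (-π * n ^ 2 * t) : ℝ) : ℂ) := by
    intro n
    rw [jacobiTheta₂_term, Complex.ofReal_exp]
    congr 1
    push_cast
    linear_combination (π * (n : ℂ) ^ 2 * t) * I_mul_I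
  simp_rw [hterm] at hs
  have hs' : Summable fun n : ℤ => Real.exp (-π * n ^ 2 * t) := by
    exact_mod_cast hs.summable
  have hpos : 0 < ∑' n : ℤ, Real.exp (-π * n ^ 2 * t) :=
    hs'.tsum_pos (fun _ => (Real.exp_pos _).le) 0 (Real.exp_pos _)
  rw [← hs.tsum_eq, ← Complex.ofReal_tsum]
  exact_mod_cast hpos.ne'

theorem exists_const_thetaProd {t : ℝ} (ht : 0 < t) :
    ∃ c : ℂ, c ≠ 0 ∧ ∀ z, jacobiTheta₂ z (I * t) = c * thetaProd (I * t) z := by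
  set τ : ℂ := I * t with hτdef
  have hτ : 0 < τ.im := by simpa [hτdef] using ht
  have hJ : Differentiable ℂ (fun z => jacobiTheta₂ z τ) :=
    fun z => differentiableAt_jacobiTheta₂_fst z hτ
  have hP := differentiable_thetaProd hτ
  have hvan : ∀ z, thetaProd τ z = 0 → jacobiTheta₂ z τ = 0 := by
    intro z hz
    obtain ⟨m, n, rfl⟩ := thetaProd_zero hτ z hz
    exact jacobiTheta₂_lattice τ m n
  set h := extQuot (fun z => jacobiTheta₂ z τ) (thetaProd τ) with hh
  have hd : Differentiable ℂ h := differentiable_extQuot hJ hP (deriv_thetaProd_ne hτ) hvan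
  have hm : ∀ z, h z * thetaProd τ z = jacobiTheta₂ z τ := extQuot_mul hvan
  have hone : ∀ z, h (z + 1) = h z := by
    refine congrFun (eq_of_mul_eq (D := thetaProd τ) (hd.continuous.comp (by fun_prop))
      hd.continuous (deriv_thetaProd_ne hτ) fun z => ?_)
    rw [hm, ← thetaProd_add_one]
    exact (hm (z + 1)).trans (jacobiTheta₂_add_left z τ)
  have htau : ∀ z, h (z + τ) = h z := by
    refine congrFun (eq_of_mul_eq (D := thetaProd τ) (hd.continuous.comp (by fun_prop))
      hd.continuous (deriv_thetaProd_ne hτ) fun z => ?_)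
    have h1 := hm (z + τ)
    rw [thetaProd_add_tau hτ, jacobiTheta₂_add_left', ← hm z] at h1
    apply mul_left_cancel₀ (Complex.exp_ne_zero (-π * I * (τ + 2 * z)))
    linear_combination h1
  have honeZ : ∀ (k : ℤ) (z : ℂ), h (z + k) = h z := by
    intro k
    induction k using Int.induction_on with
    | zero => intro z; simp
    | succ k ih => intro z; rw [← ih z, ← hone (z + ((k : ℤ) : ℂ))]; push_cast; ring_nf
    | pred k ih => intro z; rw [← ih z, ← hone]; push_cast; ring_nf
  have hcompact : IsCompact (Set.Icc (0 : ℝ) 1 ×ℂ Set.Icc 0 τ.im) :=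
    isCompact_Icc.reProdIm isCompact_Icc
  obtain ⟨C, hC⟩ := hcompact.exists_bound_of_continuousOn hd.continuous.continuousOn
  have hbd : ∀ z, ‖h z‖ ≤ C := by
    refine strip_induction hτ ?_ (fun z => by rw [htau])
    intro z h0 h1
    rw [← honeZ (-⌊z.re⌋) z]
    refine hC _ ?_
    rw [Complex.mem_reProdIm]
    have e1 := Int.floor_le z.re
    have e2 := Int.lt_floor_add_one z.re
    have hre : (z + ((-⌊z.re⌋ : ℤ) : ℂ)).re = z.re - ⌊z.re⌋ := by
      rw [add_re, intCast_re]; push_cast; ring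
    have hi : (z + ((-⌊z.re⌋ : ℤ) : ℂ)).im = z.im := by
      rw [add_im, intCast_im, add_zero]
    rw [hre, hi]
    exact ⟨⟨by linarith, by linarith⟩, ⟨h0, h1.le⟩⟩
  have hconst : ∀ z, h z = h 0 := fun z =>
    hd.apply_eq_apply_of_bounded (isBounded_iff_forall_norm_le.mpr
      ⟨C, by rintro _ ⟨w, rfl⟩; exact hbd w⟩) z 0
  refine ⟨h 0, fun h0 => jacobiTheta₂_ne_zero_at_zero ht ?_, fun z => by rw [← hm z, hconst z]⟩
  rw [← hm 0, h0, zero_mul]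

theorem jacobiTheta₂_zero_iff {t : ℝ} (ht : 0 < t) (z : ℂ) :
    jacobiTheta₂ z (I * t) = 0 ↔ ∃ m n : ℤ, z = 1 / 2 + (I * t) / 2 + m + n * (I * t) := by
  constructor
  · obtain ⟨c, hc, h⟩ := exists_const_thetaProd ht
    rw [h, mul_eq_zero, or_iff_right hc]
    exact thetaProd_zero (by simpa using ht) z
  · rintro ⟨m, n, rfl⟩
    exact jacobiTheta₂_lattice _ m n

theorem deriv_jacobiTheta₂_ne {t : ℝ} (ht : 0 < t) (z : ℂ) (hz : jacobiTheta₂ z (I * t) = 0) :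
    deriv (fun z => jacobiTheta₂ z (I * t)) z ≠ 0 := by
  have hτ : 0 < (I * (t : ℂ)).im := by simpa using ht
  obtain ⟨c, hc, h⟩ := exists_const_thetaProd ht
  have hfun : (fun z => jacobiTheta₂ z (I * t)) = fun z => c * thetaProd (I * t) z := funext h
  rw [hfun, deriv_const_mul _ (differentiable_thetaProd hτ z)]
  rw [h, mul_eq_zero, or_iff_right hc] at hz
  exact mul_ne_zero hc (deriv_thetaProd_ne hτ z hz)

/-- `θ₁₁(2z)` has only the zeros `z ∈ ½(ℤ + ℤτ)`. -/
theorem theta_two_zero {t : ℝ} (ht : 0 < t) {z : ℂ} (hz : theta 1 1 (2 * z) (I * t) = 0) :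
    ∃ m n : ℤ, 2 * z = m + n * (I * t) := by
  rw [theta_eq, mul_eq_zero, or_iff_right (Complex.exp_ne_zero _), jacobiTheta₂_zero_iff ht] at hz
  obtain ⟨m, n, h⟩ := hz
  refine ⟨m, n, ?_⟩
  push_cast at h
  linear_combination h

/-- The zeros of `θ₁₁(2z)` are simple. -/
theorem deriv_theta_two_ne {t : ℝ} (ht : 0 < t) (z : ℂ) (hz : theta 1 1 (2 * z) (I * t) = 0) :
    deriv (fun z => theta 1 1 (2 * z) (I * t)) z ≠ 0 := by
  have hτ : 0 < (I * (t : ℂ)).im := by simpa using ht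
  simp_rw [theta_eq] at hz ⊢
  rw [mul_eq_zero, or_iff_right (Complex.exp_ne_zero _)] at hz
  have h1 : HasDerivAt (fun z : ℂ => 2 * z + ((1 : ℕ) : ℂ) / 2 + ((1 : ℕ) : ℂ) / 2 * (I * t)) 2 z := by
    simpa using! (((hasDerivAt_id z).const_mul 2).add_const (((1 : ℕ) : ℂ) / 2)).add_const
      (((1 : ℕ) : ℂ) / 2 * (I * t))
  have h2 := HasDerivAt.comp z (h₂ := fun z => jacobiTheta₂ z (I * t))
    (differentiableAt_jacobiTheta₂_fst _ hτ).hasDerivAt h1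
  have h3 : DifferentiableAt ℂ (fun z : ℂ => cexp (π * I * ((1 : ℕ) : ℂ) ^ 2 / 4 * (I * t) +
      π * I * ((1 : ℕ) : ℂ) * (((1 : ℕ) : ℂ) / 2 + 2 * z))) z := by fun_prop
  have h4 := h3.hasDerivAt.mul h2
  have h5 : deriv (fun z : ℂ => cexp (π * I * ((1 : ℕ) : ℂ) ^ 2 / 4 * (I * t) +
      π * I * ((1 : ℕ) : ℂ) * (((1 : ℕ) : ℂ) / 2 + 2 * z)) *
      jacobiTheta₂ (2 * z + ((1 : ℕ) : ℂ) / 2 + ((1 : ℕ) : ℂ) / 2 * (I * t)) (I * t)) z = _ := h4.deriv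
  rw [h5, Function.comp_apply, hz, mul_zero, zero_add]
  exact mul_ne_zero (Complex.exp_ne_zero _)
    (mul_ne_zero (deriv_jacobiTheta₂_ne ht _ hz) two_ne_zero)

theorem theta_zero_zero {t : ℝ} (ht : 0 < t) {z : ℂ} (hz : theta 0 0 z (I * t) = 0) :
    ∃ m n : ℤ, z = 1 / 2 + (I * t) / 2 + m + n * (I * t) := by
  rw [theta_eq, mul_eq_zero, or_iff_right (Complex.exp_ne_zero _), jacobiTheta₂_zero_iff ht] at hz
  simpa using hz

/-! ### Hermitian forms and adjoints -/

section Forms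

variable {V W : Type*} [AddCommMonoid V] [Module ℂ V] [AddCommMonoid W] [Module ℂ W]

/-- `g` is an adjoint of `f` for sesquilinear forms (conjugate-linear in the first argument):
`⟨f x, y⟩ = ⟨x, g y⟩`. -/
def IsAdjoint (B : V →ₗ⋆[ℂ] V →ₗ[ℂ] ℂ) (C : W →ₗ⋆[ℂ] W →ₗ[ℂ] ℂ) (f : V →ₗ[ℂ] W) (g : W →ₗ[ℂ] V) :
    Prop :=
  ∀ x y, C (f x) y = B x (g y)

/-- The linear form `x ↦ conj ⟨x, y⟩`. -/
noncomputable def conjFlip (B : V →ₗ⋆[ℂ] V →ₗ[ℂ] ℂ) (y : V) : V →ₗ[ℂ] ℂ where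
  toFun x := conj (B x y)
  map_add' x x' := by simp
  map_smul' c x := by simp

variable {ι : Type*}

theorem semilinear_ext {f g : (⨂[ℂ] _ : ι, V) →ₗ⋆[ℂ] ℂ}
    (h : ∀ x : ι → V, f (PiTensorProduct.tprod ℂ x) = g (PiTensorProduct.tprod ℂ x)) : f = g := by
  ext x
  induction x using PiTensorProduct.induction_on with
  | smul_tprod c x => rw [LinearMap.map_smulₛₗ, LinearMap.map_smulₛₗ, h]
  | add x y hx hy => rw [map_add, map_add, hx, hy]

variable [Fintype ι]

/-- For a pure tensor `⨂ y i`, the conjugate-linear form `x ↦ ⟨x, ⨂ y i⟩` with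
`⨂ x i ↦ ∏ i, ⟨x i, y i⟩`. -/
noncomputable def tensorFormAux (B : V →ₗ⋆[ℂ] V →ₗ[ℂ] ℂ) (y : ι → V) :
    (⨂[ℂ] _ : ι, V) →ₗ⋆[ℂ] ℂ where
  toFun x := conj (PiTensorProduct.lift
    ((MultilinearMap.mkPiAlgebra ℂ ι ℂ).compLinearMap fun i => conjFlip B (y i)) x)
  map_add' x x' := by simp
  map_smul' c x := by simp

theorem tensorFormAux_tprod (B : V →ₗ⋆[ℂ] V →ₗ[ℂ] ℂ) (y x : ι → V) :
    tensorFormAux B y (PiTensorProduct.tprod ℂ x) = ∏ i, B (x i) (y i) := by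
  simp [tensorFormAux, conjFlip]

/-- The sesquilinear form on `⨂ V` induced by a sesquilinear form on `V`:
`⟨⨂ x i, ⨂ y i⟩ = ∏ i, ⟨x i, y i⟩`. -/
noncomputable def tensorForm (B : V →ₗ⋆[ℂ] V →ₗ[ℂ] ℂ) :
    (⨂[ℂ] _ : ι, V) →ₗ⋆[ℂ] (⨂[ℂ] _ : ι, V) →ₗ[ℂ] ℂ :=
  LinearMap.flip <| PiTensorProduct.lift
    { toFun := tensorFormAux B
      map_update_add' := fun m i x y => semilinear_ext fun v => by
        classical
        simp only [LinearMap.add_apply, tensorFormAux_tprod]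
        rw [← Finset.mul_prod_erase _ _ (Finset.mem_univ i),
          ← Finset.mul_prod_erase _ _ (Finset.mem_univ i),
          ← Finset.mul_prod_erase _ _ (Finset.mem_univ i)]
        simp only [Function.update_self, map_add, add_mul]
        congr 2 <;>
        exact Finset.prod_congr rfl fun j hj => by
          rw [Function.update_of_ne (Finset.ne_of_mem_erase hj),
            Function.update_of_ne (Finset.ne_of_mem_erase hj)]
      map_update_smul' := fun m i c x => semilinear_ext fun v => by
        classical
        simp only [LinearMap.smul_apply, tensorFormAux_tprod]
        rw [← Finset.mul_prod_erase _ _ (Finset.mem_univ i),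
          ← Finset.mul_prod_erase _ _ (Finset.mem_univ i)]
        simp only [Function.update_self, map_smul, smul_eq_mul, mul_assoc]
        congr 2
        exact Finset.prod_congr rfl fun j hj => by
          rw [Function.update_of_ne (Finset.ne_of_mem_erase hj),
            Function.update_of_ne (Finset.ne_of_mem_erase hj)] }

theorem tensorForm_tprod (B : V →ₗ⋆[ℂ] V →ₗ[ℂ] ℂ) (x y : ι → V) :
    tensorForm B (PiTensorProduct.tprod ℂ x) (PiTensorProduct.tprod ℂ y) =
      ∏ i, B (x i) (y i) := by
  simp only [tensorForm, LinearMap.flip_apply, PiTensorProduct.lift.tprod]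
  exact tensorFormAux_tprod B y x

/-- The standard Hermitian form of `ℂ^κ`, for which the standard basis is orthonormal. -/
noncomputable def stdForm (κ : Type*) [Fintype κ] : (κ → ℂ) →ₗ⋆[ℂ] (κ → ℂ) →ₗ[ℂ] ℂ :=
  LinearMap.mk₂'ₛₗ (starRingEnd ℂ) (RingHom.id ℂ) (fun x y => ∑ k, conj (x k) * y k)
    (fun x x' y => by simp [add_mul, Finset.sum_add_distrib])
    (fun c x y => by simp [Finset.mul_sum, mul_assoc])
    (fun x y y' => by simp [mul_add, Finset.sum_add_distrib])
    (fun c x y => by simp [Finset.mul_sum, mul_left_comm])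

variable {κ : Type*} [Fintype κ] [DecidableEq κ]

/-- The basis `e_{k_1} ⊗ ⋯ ⊗ e_{k_N}` of `(ℂ^κ)^{⊗N}`. -/
noncomputable def tensorBasis (ι κ : Type*) [Fintype ι] [Fintype κ] :
    Module.Basis (ι → κ) ℂ (⨂[ℂ] _ : ι, (κ → ℂ)) :=
  Basis.piTensorProduct fun _ => Pi.basisFun ℂ κ

theorem tensorForm_basis [DecidableEq ι] (k k' : ι → κ) :
    tensorForm (stdForm κ) (tensorBasis ι κ k) (tensorBasis ι κ k') = if k = k' then 1 else 0 := by
  rw [tensorBasis, Basis.piTensorProduct_apply, Basis.piTensorProduct_apply, tensorForm_tprod]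
  have : ∀ i, stdForm κ ((Pi.basisFun ℂ κ) (k i)) ((Pi.basisFun ℂ κ) (k' i)) =
      if k i = k' i then 1 else 0 := by
    intro i
    simp [stdForm, Pi.single_apply, eq_comm]
  simp_rw [this, Fintype.prod_ite_zero, ← funext_iff, Finset.prod_const_one]

/-- The adjoint `W → (ℂ^κ)^{⊗N}` of a linear map `A : (ℂ^κ)^{⊗N} → W`, with respect to the standard
Hermitian form on `(ℂ^κ)^{⊗N}` and a sesquilinear form on `W`. -/
noncomputable def adjoint (C : W →ₗ⋆[ℂ] W →ₗ[ℂ] ℂ) (A : (⨂[ℂ] _ : ι, (κ → ℂ)) →ₗ[ℂ] W) :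
    W →ₗ[ℂ] (⨂[ℂ] _ : ι, (κ → ℂ)) :=
  open Classical in
  ∑ k : ι → κ, (C (A (tensorBasis ι κ k))).smulRight (tensorBasis ι κ k)

/-- The map `adjoint C A` is the unique adjoint of `A`. -/
theorem isAdjoint_iff (C : W →ₗ⋆[ℂ] W →ₗ[ℂ] ℂ) (A : (⨂[ℂ] _ : ι, (κ → ℂ)) →ₗ[ℂ] W)
    (G : W →ₗ[ℂ] (⨂[ℂ] _ : ι, (κ → ℂ))) :
    IsAdjoint (tensorForm (stdForm κ)) C A G ↔ G = adjoint C A := by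
  classical
  have hco : ∀ (k : ι → κ) (y : ⨂[ℂ] _ : ι, (κ → ℂ)),
      tensorForm (stdForm κ) (tensorBasis ι κ k) y = (tensorBasis ι κ).repr y k := by
    intro k y
    rw [congrArg (tensorForm (stdForm κ) (tensorBasis ι κ k)) ((tensorBasis ι κ).sum_repr y).symm,
      map_sum]
    simp only [map_smul, tensorForm_basis, smul_eq_mul, mul_ite, mul_one, mul_zero]
    simp
  have hadj : ∀ k w, (tensorBasis ι κ).repr (adjoint C A w) k = C (A (tensorBasis ι κ k)) w := by
    intro k w
    simp [adjoint, Finsupp.single_apply, LinearMap.sum_apply]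
  constructor
  · intro h
    ext1 w
    apply (tensorBasis ι κ).ext_elem
    intro k
    rw [hadj, ← hco, h]
  · rintro rfl x y
    have hx := (tensorBasis ι κ).sum_repr x
    rw [← hx]
    simp only [map_sum, LinearMap.sum_apply, map_smul, LinearMap.map_smulₛₗ, LinearMap.smul_apply,
      hco, hadj]

end Forms

/-! ### The model -/

/-- The parameters of the model: `N` sites of spin `l = twoL / 2`, elliptic modulus `τ = i t`,
anisotropy `η = r' / (2 l r)` (with `r' = rnum`). -/
structure SpinModel where
  /-- the number of sites -/
  N : ℕ
  /-- twice the spin -/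
  twoL : ℕ
  /-- the imaginary part of the elliptic modulus -/
  t : ℝ
  /-- the integer `r` in `η = r' / (2 l r)` -/
  r : ℕ
  /-- the integer `r'` in `η = r' / (2 l r)` -/
  rnum : ℤ
  N_pos : 0 < N
  twoL_pos : 0 < twoL
  t_pos : 0 < t
  r_pos : 0 < r
  /-- `N l` is an integer -/
  even_N_twoL : Even (N * twoL)
  /-- `η ≠ 0` -/
  rnum_ne_zero : rnum ≠ 0
  /-- `|η| < 1 / (2 (2 l + 1))` -/
  abs_eta_lt : |(rnum : ℝ) / (twoL * r)| < 1 / (2 * (twoL + 1))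

namespace SpinModel

variable (M : SpinModel)

/-- The spin `l`. -/
noncomputable def l : ℝ := (M.twoL : ℝ) / 2

/-- The elliptic modulus `τ = i t`. -/
noncomputable def τ : ℂ := I * M.t

/-- The anisotropy parameter `η = r' / (2 l r)`. -/
noncomputable def η : ℝ := (M.rnum : ℝ) / (2 * M.l * M.r)

theorem two_l : 2 * M.l = M.twoL := by
  rw [l]; ring

theorem two_l_complex : 2 * (M.l : ℂ) = M.twoL := by
  exact_mod_cast congrArg (fun x : ℝ => (x : ℂ)) M.two_l

theorem τ_im_pos : 0 < M.τ.im := by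
  simpa [τ] using M.t_pos

theorem abs_η_lt : |M.η| < 1 / (2 * (2 * M.l + 1)) := by
  rw [η, M.two_l]; exact M.abs_eta_lt

theorem η_ne_zero : M.η ≠ 0 := by
  rw [η, M.two_l]
  have h1 : (M.twoL : ℝ) ≠ 0 := by exact_mod_cast M.twoL_pos.ne'
  have h2 : (M.r : ℝ) ≠ 0 := by exact_mod_cast M.r_pos.ne'
  have h3 : (M.rnum : ℝ) ≠ 0 := by exact_mod_cast M.rnum_ne_zero
  exact div_ne_zero h3 (mul_ne_zero h1 h2)

/-- The abbreviation `[z] = θ₁₁(z, τ)`. -/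
noncomputable def br (z : ℂ) : ℂ := theta 1 1 z M.τ

/-- `[z]_k = ∏_{j=0}^{k-1} [z + 2jη]`. -/
noncomputable def brk (z : ℂ) (k : ℕ) : ℂ := ∏ j ∈ Finset.range k, M.br (z + 2 * j * M.η)

/-- `[z; a]_k = [z + a]_k [-z + a]_k`. -/
noncomputable def brk2 (z a : ℂ) (k : ℕ) : ℂ := M.brk (z + a) k * M.brk (-z + a) k

/-- The characteristics of the theta functions attached to `a = 0, 1, 2, 3`:
`θ₁₁, θ₁₀, θ₀₀, θ₀₁`. -/
def char : Fin 4 → ℕ × ℕ := ![(1, 1), (1, 0), (0, 0), (0, 1)]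

/-- The theta functions `θ₁₁, θ₁₀, θ₀₀, θ₀₁` at `(z, τ)`. -/
noncomputable def th (a : Fin 4) (z : ℂ) : ℂ := theta (char a).1 (char a).2 z M.τ

/-- The coefficients `W_a^L(u)`. -/
noncomputable def W (a : Fin 4) (u : ℂ) : ℂ := M.th a u / M.th a M.η

/-- The functions `s_a(z)`. -/
noncomputable def s (a : Fin 4) (z : ℂ) : ℂ :=
  (![1, 1, I, 1] : Fin 4 → ℂ) a * M.th a M.η * M.th a (2 * z)

/-- The spin `l` representation space `Θ_{00}^{4l+}`: entire functions with
`f(z+1) = f(-z) = f(z)` and `f(z+τ) = exp(-4lπi(2z+τ)) f(z)`. -/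
noncomputable def V : Submodule ℂ (ℂ → ℂ) where
  carrier := {f | Differentiable ℂ f ∧ (∀ z, f (z + 1) = f z) ∧ (∀ z, f (-z) = f z) ∧
    ∀ z, f (z + M.τ) = cexp (-4 * M.l * π * I * (2 * z + M.τ)) * f z}
  zero_mem' := ⟨differentiable_const 0, by simp, by simp, by simp⟩
  add_mem' := fun {f g} ⟨h1, h2, h3, h4⟩ ⟨k1, k2, k3, k4⟩ => ⟨h1.add k1,
    fun z => by simp [h2, k2], fun z => by simp [h3, k3], fun z => by simp [h4, k4, mul_add]⟩
  smul_mem' := fun c f ⟨h1, h2, h3, h4⟩ => ⟨h1.const_smul c,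
    fun z => by simp [h2], fun z => by simp [h3], fun z => by simp [h4, mul_left_comm]⟩

/-- The numerator `s_a(z-lη) f(z+η) - s_a(-z-lη) f(z-η)` of the difference operator. -/
noncomputable def num (a : Fin 4) (f : ℂ → ℂ) (z : ℂ) : ℂ :=
  M.s a (z - M.l * M.η) * f (z + M.η) - M.s a (-z - M.l * M.η) * f (z - M.η)

/-- The denominator `θ₁₁(2z, τ)` of the difference operator. -/
noncomputable def den (z : ℂ) : ℂ := theta 1 1 (2 * z) M.τ

theorem differentiable_th (a : Fin 4) : Differentiable ℂ (M.th a) :=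
  differentiable_theta _ _ M.τ_im_pos

theorem differentiable_s (a : Fin 4) : Differentiable ℂ (M.s a) :=
  ((M.differentiable_th a).comp (by fun_prop : Differentiable ℂ fun z : ℂ => 2 * z)).const_mul _

theorem differentiable_num (a : Fin 4) (f : M.V) : Differentiable ℂ (M.num a f) := by
  have h1 := M.differentiable_s a
  have h2 := f.2.1
  exact ((h1.comp (by fun_prop)).mul (h2.comp (by fun_prop))).sub
    ((h1.comp (by fun_prop)).mul (h2.comp (by fun_prop)))

theorem differentiable_den : Differentiable ℂ M.den :=
  (differentiable_theta 1 1 M.τ_im_pos).comp (by fun_prop : Differentiable ℂ fun z : ℂ => 2 * z)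

theorem deriv_den_ne (z : ℂ) (h : M.den z = 0) : deriv M.den z ≠ 0 :=
  deriv_theta_two_ne M.t_pos z h

theorem th_two_add_one (a : Fin 4) (z : ℂ) : M.th a (2 * z + 2) = M.th a (2 * z) := by
  rw [th, th, show 2 * z + 2 = 2 * z + 1 + 1 by ring, theta_add_one, theta_add_one, ← mul_assoc,
    ← mul_pow]
  norm_num

theorem th_two_add_tau (a : Fin 4) (z : ℂ) :
    M.th a (2 * z + 2 * M.τ) = cexp (-4 * π * I * (2 * z + M.τ)) * M.th a (2 * z) := by
  rw [th, th, show 2 * z + 2 * M.τ = 2 * z + M.τ + M.τ by ring, theta_add_tau, theta_add_tau]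
  have h1 : ((-1 : ℂ) ^ (char a).2) * (-1) ^ (char a).2 = 1 := by rw [← mul_pow]; norm_num
  have h2 : cexp (-π * I * (M.τ + 2 * (2 * z + M.τ))) * cexp (-π * I * (M.τ + 2 * (2 * z))) =
      cexp (-4 * π * I * (2 * z + M.τ)) := by
    rw [← Complex.exp_add]; congr 1; ring
  rw [← h2]
  linear_combination (cexp (-π * I * (M.τ + 2 * (2 * z + M.τ))) *
    cexp (-π * I * (M.τ + 2 * (2 * z))) * theta (char a).1 (char a).2 (2 * z) M.τ) * h1

theorem s_add_one (a : Fin 4) (z : ℂ) : M.s a (z + 1) = M.s a z := by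
  rw [s, s, show 2 * (z + 1) = 2 * z + 2 by ring, th_two_add_one]

theorem s_add_tau (a : Fin 4) (z : ℂ) :
    M.s a (z + M.τ) = cexp (-4 * π * I * (2 * z + M.τ)) * M.s a z := by
  rw [s, s, show 2 * (z + M.τ) = 2 * z + 2 * M.τ by ring, th_two_add_tau]
  ring

theorem s_sub_one (a : Fin 4) (z : ℂ) : M.s a (z - 1) = M.s a z := by
  rw [← s_add_one, sub_add_cancel]

theorem s_sub_tau (a : Fin 4) (z : ℂ) :
    M.s a (z - M.τ) = cexp (4 * π * I * (2 * z - M.τ)) * M.s a z := by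
  have h := M.s_add_tau a (z - M.τ)
  rw [sub_add_cancel] at h
  rw [h, ← mul_assoc, ← Complex.exp_add,
    show 4 * π * I * (2 * z - M.τ) + -4 * π * I * (2 * (z - M.τ) + M.τ) = 0 by ring,
    Complex.exp_zero, one_mul]

theorem num_neg (a : Fin 4) (f : M.V) (z : ℂ) : M.num a f (-z) = -M.num a f z := by
  have h := f.2.2.2.1
  have h1 : f.1 (-z + M.η) = f.1 (z - M.η) := by rw [← h]; ring_nf
  have h2 : f.1 (-z - M.η) = f.1 (z + M.η) := by rw [← h]; ring_nf
  rw [num, num, h1, h2, neg_neg]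
  ring

theorem num_add_one (a : Fin 4) (f : M.V) (z : ℂ) : M.num a f (z + 1) = M.num a f z := by
  have h := f.2.2.1
  rw [num, num, show z + 1 - M.l * M.η = z - M.l * M.η + 1 by ring,
    show z + 1 + M.η = z + M.η + 1 by ring, show z + 1 - M.η = z - M.η + 1 by ring,
    show -(z + 1) - M.l * M.η = -z - M.l * M.η - 1 by ring, s_add_one, s_sub_one, h, h]

theorem num_add_tau (a : Fin 4) (f : M.V) (z : ℂ) :
    M.num a f (z + M.τ) = cexp (-4 * (M.l + 1) * π * I * (2 * z + M.τ)) * M.num a f z := by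
  have h := f.2.2.2.2
  rw [num, num, show z + M.τ - M.l * M.η = z - M.l * M.η + M.τ by ring,
    show z + M.τ + M.η = z + M.η + M.τ by ring, show z + M.τ - M.η = z - M.η + M.τ by ring,
    show -(z + M.τ) - M.l * M.η = -z - M.l * M.η - M.τ by ring, s_add_tau, s_sub_tau, h, h]
  have e1 : cexp (-4 * π * I * (2 * (z - M.l * M.η) + M.τ)) *
      cexp (-4 * M.l * π * I * (2 * (z + M.η) + M.τ)) =
      cexp (-4 * (M.l + 1) * π * I * (2 * z + M.τ)) := by
    rw [← Complex.exp_add]; congr 1; ring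
  have e2 : cexp (4 * π * I * (2 * (-z - M.l * M.η) - M.τ)) *
      cexp (-4 * M.l * π * I * (2 * (z - M.η) + M.τ)) =
      cexp (-4 * (M.l + 1) * π * I * (2 * z + M.τ)) := by
    rw [← Complex.exp_add]; congr 1; ring
  linear_combination (M.s a (z - M.l * M.η) * f.1 (z + M.η)) * e1 -
    (M.s a (-z - M.l * M.η) * f.1 (z - M.η)) * e2

theorem num_add_int (a : Fin 4) (f : M.V) (m : ℤ) (z : ℂ) : M.num a f (z + m) = M.num a f z := by
  induction m using Int.induction_on generalizing z with
  | zero => simp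
  | succ k ih => rw [← ih z, ← num_add_one _ _ _ (z + ((k : ℤ) : ℂ))]; push_cast; ring_nf
  | pred k ih => rw [← ih z, ← num_add_one]; push_cast; ring_nf

theorem num_add_int_tau (a : Fin 4) (f : M.V) (n : ℤ) (z : ℂ) :
    M.num a f (z + n * M.τ) =
      cexp (-4 * (M.l + 1) * π * I * (2 * n * z + n ^ 2 * M.τ)) * M.num a f z := by
  induction n using Int.induction_on generalizing z with
  | zero => simp
  | succ k ih =>
    rw [show z + ((k + 1 : ℤ) : ℂ) * M.τ = (z + ((k : ℤ) : ℂ) * M.τ) + M.τ by push_cast; ring,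
      num_add_tau, ih, ← mul_assoc, ← Complex.exp_add]
    congr 2
    push_cast
    ring
  | pred k ih =>
    have h := M.num_add_tau a f (z + ((-(k : ℤ) - 1 : ℤ) : ℂ) * M.τ)
    rw [show z + ((-(k : ℤ) - 1 : ℤ) : ℂ) * M.τ + M.τ = z + ((-(k : ℤ) : ℤ) : ℂ) * M.τ by
      push_cast; ring, ih] at h
    apply mul_left_cancel₀ (Complex.exp_ne_zero
      (-4 * (M.l + 1) * π * I * (2 * (z + ((-(k : ℤ) - 1 : ℤ) : ℂ) * M.τ) + M.τ)))
    rw [← h, ← mul_assoc, ← Complex.exp_add]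
    congr 2
    push_cast
    ring

theorem num_eq_zero (a : Fin 4) (f : M.V) (z : ℂ) (hz : M.den z = 0) : M.num a f z = 0 := by
  obtain ⟨m, n, h⟩ := theta_two_zero M.t_pos hz
  have hz2 : z = -z + m + n * M.τ := by rw [τ]; linear_combination h
  have h1 : M.num a f z = cexp (-4 * (M.l + 1) * π * I * (2 * n * (-z + m) + n ^ 2 * M.τ)) *
      M.num a f (-z) := by
    conv_lhs => rw [hz2]
    rw [num_add_int_tau, num_add_int]
  have h2 : cexp (-4 * (M.l + 1) * π * I * (2 * n * (-z + m) + n ^ 2 * M.τ)) = 1 := by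
    have : -4 * (M.l + 1) * π * I * (2 * n * (-z + m) + n ^ 2 * M.τ) =
        ((-((M.twoL : ℤ) + 2) * n * m : ℤ) : ℂ) * (2 * π * I) := by
      push_cast
      rw [← two_l_complex, τ]
      linear_combination (4 * (M.l + 1) * π * I * n) * h
    rw [this, Complex.exp_int_mul_two_pi_mul_I]
  rw [h2, one_mul, num_neg] at h1
  linear_combination (1 / 2) * h1

theorem den_neg (z : ℂ) : M.den (-z) = -M.den z := by
  rw [den, den, show 2 * -z = -(2 * z) by ring, theta_neg]; norm_num

theorem den_add_one (z : ℂ) : M.den (z + 1) = M.den z := by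
  rw [den, show 2 * (z + 1) = 2 * z + 2 by ring]
  exact M.th_two_add_one 0 z

theorem den_add_tau (z : ℂ) : M.den (z + M.τ) = cexp (-4 * π * I * (2 * z + M.τ)) * M.den z := by
  rw [den, show 2 * (z + M.τ) = 2 * z + 2 * M.τ by ring]
  exact M.th_two_add_tau 0 z

/-- The function `(ρ^l(S^a) f)(z) = (s_a(z-lη) f(z+η) - s_a(-z-lη) f(z-η)) / θ₁₁(2z, τ)`, continued
analytically to the (simple) zeros of the denominator. -/
noncomputable def rhoFun (a : Fin 4) (f : ℂ → ℂ) : ℂ → ℂ := extQuot (M.num a f) M.den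

theorem rhoFun_mul_den (a : Fin 4) (f : M.V) (z : ℂ) :
    M.rhoFun a f z * M.den z = M.num a f z :=
  extQuot_mul (M.num_eq_zero a f) z

theorem differentiable_rhoFun (a : Fin 4) (f : M.V) : Differentiable ℂ (M.rhoFun a f) :=
  differentiable_extQuot (M.differentiable_num a f) M.differentiable_den M.deriv_den_ne
    (M.num_eq_zero a f)

theorem rhoFun_mem (a : Fin 4) (f : M.V) : M.rhoFun a f ∈ M.V := by
  have hd := M.differentiable_rhoFun a f
  have hm := M.rhoFun_mul_den a f
  refine ⟨hd, ?_, ?_, ?_⟩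
  · refine congrFun (eq_of_mul_eq (f := fun z => M.rhoFun a f (z + 1)) (D := M.den)
      (hd.continuous.comp (by fun_prop)) hd.continuous M.deriv_den_ne fun z => ?_)
    rw [hm z, ← num_add_one, ← hm, den_add_one]
  · refine congrFun (eq_of_mul_eq (f := fun z => M.rhoFun a f (-z)) (D := M.den)
      (hd.continuous.comp (by fun_prop)) hd.continuous M.deriv_den_ne fun z => ?_)
    have h := hm (-z)
    rw [den_neg, num_neg, ← hm z] at h
    linear_combination -h
  · refine congrFun (eq_of_mul_eq (f := fun z => M.rhoFun a f (z + M.τ))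
      (g := fun z => cexp (-4 * M.l * π * I * (2 * z + M.τ)) * M.rhoFun a f z) (D := M.den)
      (hd.continuous.comp (by fun_prop)) (Continuous.mul (by fun_prop) hd.continuous)
      M.deriv_den_ne fun z => ?_)
    have h := hm (z + M.τ)
    have e : cexp (-4 * (M.l + 1) * π * I * (2 * z + M.τ)) = cexp (-4 * π * I * (2 * z + M.τ)) *
        cexp (-4 * M.l * π * I * (2 * z + M.τ)) := by
      rw [← Complex.exp_add]; congr 1; ring
    rw [den_add_tau, num_add_tau, ← hm z, e] at h
    apply mul_left_cancel₀ (Complex.exp_ne_zero (-4 * π * I * (2 * z + M.τ)))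
    linear_combination h

/-- The spin `l` representation of the generators `S^a` of the Sklyanin algebra. -/
noncomputable def rho (a : Fin 4) : Module.End ℂ M.V where
  toFun f := ⟨M.rhoFun a f, M.rhoFun_mem a f⟩
  map_add' f g := by
    refine Subtype.ext (eq_of_mul_eq (M.differentiable_rhoFun a (f + g)).continuous
      ((M.differentiable_rhoFun a f).continuous.add (M.differentiable_rhoFun a g).continuous)
      M.deriv_den_ne fun z => ?_)
    change _ = (M.rhoFun a f z + M.rhoFun a g z) * M.den z
    rw [rhoFun_mul_den, add_mul, rhoFun_mul_den, rhoFun_mul_den]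
    simp only [num, Submodule.coe_add, Pi.add_apply]
    ring
  map_smul' c f := by
    refine Subtype.ext (eq_of_mul_eq (M.differentiable_rhoFun a (c • f)).continuous
      ((M.differentiable_rhoFun a f).continuous.const_smul c) M.deriv_den_ne fun z => ?_)
    change _ = (c * M.rhoFun a f z) * M.den z
    rw [rhoFun_mul_den, mul_assoc, rhoFun_mul_den]
    simp only [num, Submodule.coe_smul, Pi.smul_apply, smul_eq_mul]
    ring

/-! ### The transfer matrix -/

/-- The total Hilbert space, the tensor product of the local spaces over the `N` sites. -/
abbrev H : Type := ⨂[ℂ] _ : Fin M.N, M.V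

/-- The operator `1 ⊗ ⋯ ⊗ A ⊗ ⋯ ⊗ 1` with `A` at site `n`. -/
noncomputable def site (n : Fin M.N) (A : Module.End ℂ M.V) : Module.End ℂ M.H :=
  PiTensorProduct.map (Function.update (fun _ => LinearMap.id) n A)

/-- The Pauli matrices `σ⁰, σ¹, σ², σ³`. -/
def pauli : Fin 4 → Matrix (Fin 2) (Fin 2) ℂ :=
  ![!![1, 0; 0, 1], !![0, 1; 1, 0], !![0, -I; I, 0], !![1, 0; 0, -1]]

/-- The `L`-operator `L_n(u) = ∑_a W_a^L(u) ρ_n(S^a) ⊗ σ^a`, as a matrix over the auxiliary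
space `ℂ²` with entries in `End(H)`. -/
noncomputable def L (n : Fin M.N) (u : ℂ) : Matrix (Fin 2) (Fin 2) (Module.End ℂ M.H) :=
  Matrix.of fun i j => ∑ a, (M.W a u * pauli a i j) • M.site n (M.rho a)

/-- The transfer matrix `T(u) = tr L_N(u) ⋯ L_1(u)`. -/
noncomputable def T (u : ℂ) : Module.End ℂ M.H :=
  Matrix.trace (List.ofFn fun n => M.L n u).reverse.prod

/-! ### The Sklyanin form -/

/-- The kernel `μ(z, w)` of the Sklyanin form. -/
noncomputable def μ (z w : ℂ) : ℂ :=
  theta 1 1 (2 * z) M.τ * theta 1 1 (2 * w) M.τ /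
    ∏ j ∈ Finset.range (M.twoL + 2),
      (theta 0 0 (z + w + (2 * j - 2 * M.l - 1) * M.η) M.τ *
        theta 0 0 (z - w + (2 * j - 2 * M.l - 1) * M.η) M.τ)

theorem abs_coeff_lt {j : ℕ} (hj : j ∈ Finset.range (M.twoL + 2)) :
    |(2 * (j : ℝ) - 2 * M.l - 1) * M.η| < 1 / 2 := by
  have h1 := M.abs_η_lt
  have h2 : (j : ℝ) ≤ M.twoL + 1 := by
    have := Finset.mem_range.mp hj
    exact_mod_cast (by omega : j ≤ M.twoL + 1)
  have h3 : (0 : ℝ) ≤ j := j.cast_nonneg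
  have h4 := M.two_l
  have h5 : (0 : ℝ) < 2 * M.l + 1 := by rw [h4]; positivity
  have h6 : |2 * (j : ℝ) - 2 * M.l - 1| ≤ 2 * M.l + 1 := by
    rw [abs_le]; constructor <;> linarith
  rw [abs_mul]
  calc _ ≤ (2 * M.l + 1) * |M.η| := mul_le_mul_of_nonneg_right h6 (abs_nonneg _)
    _ < (2 * M.l + 1) * (1 / (2 * (2 * M.l + 1))) := mul_lt_mul_of_pos_left h1 h5
    _ = 1 / 2 := by field_simp

theorem theta_real_ne (x : ℝ) : theta 0 0 x M.τ ≠ 0 := by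
  intro h
  obtain ⟨m, n, h⟩ := theta_zero_zero M.t_pos h
  have h1 := congrArg Complex.im h
  have h2 : (1 / 2 + I * (M.t : ℂ) / 2 + m + n * (I * M.t)).im = M.t * (1 / 2 + n) := by
    rw [show (1 / 2 + I * (M.t : ℂ) / 2 + m + n * (I * M.t)) =
      ((1 / 2 + m : ℝ) : ℂ) + ((M.t * (1 / 2 + n) : ℝ) : ℂ) * I by push_cast; ring]
    simp
  rw [h2, ofReal_im] at h1
  have h3 := (mul_eq_zero.mp h1.symm).resolve_left M.t_pos.ne'
  have h4 : (1 + 2 * n : ℝ) = 0 := by linarith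
  have h5 : (1 + 2 * n : ℤ) = 0 := by exact_mod_cast h4
  omega

theorem theta_strip_ne (y c : ℝ) (hc : |c| < 1 / 2) : theta 0 0 (2 * (y * I) + c) M.τ ≠ 0 := by
  intro h
  obtain ⟨m, n, h⟩ := theta_zero_zero M.t_pos h
  have h1 := congrArg Complex.re h
  have h2 : (1 / 2 + I * (M.t : ℂ) / 2 + m + n * (I * M.t)).re = 1 / 2 + m := by
    rw [show (1 / 2 + I * (M.t : ℂ) / 2 + m + n * (I * M.t)) =
      ((1 / 2 + m : ℝ) : ℂ) + ((M.t * (1 / 2 + n) : ℝ) : ℂ) * I by push_cast; ring]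
    simp
  rw [h2] at h1
  have h3 : c = 1 / 2 + m := by simpa using h1
  rw [h3, abs_lt] at hc
  have h4 : (-1 : ℝ) < m := by linarith [hc.1]
  have h5 : (m : ℝ) < 0 := by linarith [hc.2]
  have h6 : (-1 : ℤ) < m := by exact_mod_cast h4
  have h7 : m < 0 := by exact_mod_cast h5
  omega

theorem continuous_μ : Continuous fun z : ℂ => M.μ z (conj z) := by
  have hth : ∀ a b : ℕ, Continuous fun z => theta a b z M.τ :=
    fun a b => (differentiable_theta a b M.τ_im_pos).continuous
  refine Continuous.div ?_ ?_ ?_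
  · exact ((hth 1 1).comp (by fun_prop)).mul
      ((hth 1 1).comp (continuous_const.mul Complex.continuous_conj))
  · refine continuous_finsetProd _ fun j _ => ?_
    exact ((hth 0 0).comp ((continuous_id.add Complex.continuous_conj).add continuous_const)).mul
      ((hth 0 0).comp ((continuous_id.sub Complex.continuous_conj).add continuous_const))
  · intro z
    refine Finset.prod_ne_zero_iff.mpr fun j hj => mul_ne_zero ?_ ?_
    · have : z + conj z + (2 * j - 2 * M.l - 1) * M.η =
          ((2 * z.re + (2 * j - 2 * M.l - 1) * M.η : ℝ) : ℂ) := by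
        rw [Complex.add_conj]; push_cast; ring
      rw [this]
      exact M.theta_real_ne _
    · have : z - conj z + (2 * j - 2 * M.l - 1) * M.η =
          2 * ((z.im : ℂ) * I) + (((2 * (j : ℝ) - 2 * M.l - 1) * M.η : ℝ) : ℂ) := by
        rw [Complex.sub_conj]; push_cast; ring
      rw [this]
      exact M.theta_strip_ne _ _ (M.abs_coeff_lt hj)

/-- The Sklyanin form
`⟨f, g⟩ = ∫_0^1 dx ∫_0^{τ/i} dy conj(f(z)) g(z) μ(z, conj z)`, `z = x + iy`, as a number. -/
noncomputable def sklyaninInt (f g : ℂ → ℂ) : ℂ :=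
  ∫ x : ℝ in 0..1, ∫ y : ℝ in 0..M.t,
    conj (f (x + y * I)) * g (x + y * I) * M.μ (x + y * I) (conj (x + y * I : ℂ))

theorem sklyaninInt_add {F₁ F₂ : ℂ → ℂ} (h₁ : Continuous F₁) (h₂ : Continuous F₂) :
    (∫ x : ℝ in 0..1, ∫ y : ℝ in 0..M.t, (F₁ (x + y * I) + F₂ (x + y * I))) =
      (∫ x : ℝ in 0..1, ∫ y : ℝ in 0..M.t, F₁ (x + y * I)) +
        ∫ x : ℝ in 0..1, ∫ y : ℝ in 0..M.t, F₂ (x + y * I) := by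
  have hc : ∀ {F : ℂ → ℂ}, Continuous F →
      Continuous (fun p : ℝ × ℝ => F (p.1 + p.2 * I)) := fun hF => hF.comp (by fun_prop)
  have hc1 : ∀ {F : ℂ → ℂ}, Continuous F → ∀ x : ℝ,
      Continuous (fun y : ℝ => F (x + y * I)) := fun hF x => hF.comp (by fun_prop)
  rw [← intervalIntegral.integral_add]
  · refine intervalIntegral.integral_congr fun x _ => ?_
    exact intervalIntegral.integral_add ((hc1 h₁ x).intervalIntegrable _ _)
      ((hc1 h₂ x).intervalIntegrable _ _)
  · exact (intervalIntegral.continuous_parametric_intervalIntegral_of_continuous'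
      (hc h₁) 0 M.t).intervalIntegrable _ _
  · exact (intervalIntegral.continuous_parametric_intervalIntegral_of_continuous'
      (hc h₂) 0 M.t).intervalIntegrable _ _

theorem continuous_integrand (f g : M.V) :
    Continuous fun z : ℂ => conj (f.1 z) * g.1 z * M.μ z (conj z) :=
  ((Complex.continuous_conj.comp f.2.1.continuous).mul g.2.1.continuous).mul M.continuous_μ

/-- The Sklyanin form on the local space. -/
noncomputable def sklyaninForm : M.V →ₗ⋆[ℂ] M.V →ₗ[ℂ] ℂ :=
  LinearMap.mk₂'ₛₗ (starRingEnd ℂ) (RingHom.id ℂ) (fun f g => M.sklyaninInt f g)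
    (fun f f' g => by
      rw [sklyaninInt, sklyaninInt, sklyaninInt,
        ← sklyaninInt_add M (M.continuous_integrand f g) (M.continuous_integrand f' g)]
      simp only [Submodule.coe_add, Pi.add_apply, map_add, add_mul])
    (fun c f g => by
      simp only [sklyaninInt, Submodule.coe_smul, Pi.smul_apply, smul_eq_mul, map_mul, mul_assoc,
        intervalIntegral.integral_const_mul])
    (fun f g g' => by
      rw [sklyaninInt, sklyaninInt, sklyaninInt,
        ← sklyaninInt_add M (M.continuous_integrand f g) (M.continuous_integrand f g')]
      simp only [Submodule.coe_add, Pi.add_apply, mul_add, add_mul])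
    (fun c f g => by
      simp only [sklyaninInt, Submodule.coe_smul, Pi.smul_apply, smul_eq_mul, mul_assoc,
        mul_left_comm _ c, intervalIntegral.integral_const_mul, RingHom.id_apply])

/-- The Sklyanin form on the total Hilbert space. -/
noncomputable def form : M.H →ₗ⋆[ℂ] M.H →ₗ[ℂ] ℂ := tensorForm M.sklyaninForm

/-! ### The operators `Q_R` and `Q_L` -/

/-- The functions `f_ε(λ, u, z) = [z; (ελ+u)/2 + (-l+1)η]_{2l}`, `ε = ±1`. -/
noncomputable def fvecFun (ε : ℤ) (lam u z : ℂ) : ℂ :=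
  M.brk2 z ((ε * lam + u) / 2 + (-M.l + 1) * M.η) M.twoL

theorem fvecFun_eq (ε : ℤ) (lam u z : ℂ) : M.fvecFun ε lam u z =
    ∏ j ∈ Finset.range M.twoL,
      (M.br (z + ((ε * lam + u) / 2 + (-M.l + 1) * M.η + 2 * j * M.η)) *
        M.br (-z + ((ε * lam + u) / 2 + (-M.l + 1) * M.η + 2 * j * M.η))) := by
  rw [fvecFun, brk2, brk, brk, ← Finset.prod_mul_distrib]
  simp only [add_assoc]

theorem fvecFun_mem (ε : ℤ) (lam u : ℂ) : M.fvecFun ε lam u ∈ M.V := by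
  have hbr : Differentiable ℂ M.br := differentiable_theta 1 1 M.τ_im_pos
  have h1 : ∀ z, M.br (z + 1) = -M.br z := fun z => by
    rw [br, theta_add_one]; simp [br]
  have h2 : ∀ z, M.br (z + M.τ) = -cexp (-π * I * (M.τ + 2 * z)) * M.br z := fun z => by
    rw [br, theta_add_tau]; simp [br]
  have h1' : ∀ z, M.br (z - 1) = -M.br z := fun z => by
    have := h1 (z - 1)
    rw [sub_add_cancel] at this
    rw [this, neg_neg]
  have h2' : ∀ z, M.br (z - M.τ) = -cexp (π * I * (2 * z - M.τ)) * M.br z := fun z => by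
    have := h2 (z - M.τ)
    rw [sub_add_cancel] at this
    rw [this, ← mul_assoc, neg_mul_neg, ← Complex.exp_add,
      show π * I * (2 * z - M.τ) + -π * I * (M.τ + 2 * (z - M.τ)) = 0 by ring,
      Complex.exp_zero, one_mul]
  have hfun : M.fvecFun ε lam u = fun z => _ := funext (M.fvecFun_eq ε lam u)
  refine ⟨?_, fun z => ?_, fun z => ?_, fun z => ?_⟩
  · rw [hfun]
    refine Differentiable.fun_finsetProd fun j _ => ?_
    exact (hbr.comp (by fun_prop)).mul (hbr.comp (by fun_prop))
  · rw [fvecFun_eq, fvecFun_eq]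
    refine Finset.prod_congr rfl fun j _ => ?_
    rw [add_right_comm, h1, neg_add, ← sub_eq_add_neg, sub_add_eq_add_sub, h1', neg_mul_neg]
  · rw [fvecFun_eq, fvecFun_eq]
    refine Finset.prod_congr rfl fun j _ => ?_
    rw [neg_neg, mul_comm]
  · rw [fvecFun_eq, fvecFun_eq]
    have key : ∀ b : ℂ, M.br (z + M.τ + b) * M.br (-(z + M.τ) + b) =
        cexp (-2 * π * I * (2 * z + M.τ)) * (M.br (z + b) * M.br (-z + b)) := by
      intro b
      rw [add_right_comm, h2, neg_add, ← sub_eq_add_neg, sub_add_eq_add_sub, h2',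
        show -2 * π * I * (2 * z + M.τ) =
          -π * I * (M.τ + 2 * (z + b)) + π * I * (2 * (-z + b) - M.τ) by ring, Complex.exp_add]
      ring
    simp_rw [key]
    rw [Finset.prod_mul_distrib, Finset.prod_const, Finset.card_range, ← Complex.exp_nat_mul]
    congr 2
    rw [← two_l_complex]
    ring

/-- The vectors `f_ε(λ, u) ∈ Θ_{00}^{4l+}`. -/
noncomputable def fvec (ε : ℤ) (lam u : ℂ) : M.V := ⟨M.fvecFun ε lam u, M.fvecFun_mem ε lam u⟩

/-- The vector in the image of `S^i_j(u)`. The indices run over `0, …, r-1` here, so that the value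
`λ = 2(2j''-1)lη` for `j'' = j + 1` is `2(2j+1)lη`. -/
noncomputable def Svec (i j : Fin M.r) (u : ℂ) : M.V :=
  if i.val = j.val + 1 ∨ (i = j ∧ j.val + 1 = M.r) then
    M.fvec 1 (2 * (2 * j.val + 1) * M.l * M.η) u
  else if i.val + 1 = j.val ∨ (i = j ∧ j.val = 0) then
    M.fvec (-1) (2 * (2 * j.val + 1) * M.l * M.η) u
  else 0

/-- The parameters `τ_{kj}`, `k = 1, …, 2l+1`, `j = 1, …, r`. -/
abbrev Coeffs : Type := Fin (M.twoL + 1) → Fin M.r → ℂ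

variable (c : M.Coeffs)

/-- The operators `S^i_j(u) : ℂ^{2l+1} → Θ_{00}^{4l+}`, sending the `k`-th vector of the standard
basis to `τ_{kj}` times `Svec i j u`. -/
noncomputable def S (i j : Fin M.r) (u : ℂ) : (Fin (M.twoL + 1) → ℂ) →ₗ[ℂ] M.V :=
  Fintype.linearCombination ℂ fun k => c k j • M.Svec i j u

/-- The tensor product `(ℂ^{2l+1})^{⊗N}`. -/
abbrev E : Type := ⨂[ℂ] _ : Fin M.N, (Fin (M.twoL + 1) → ℂ)

/-- The operator `Q_R(u) = tr S_N(u) ⋯ S_1(u)`, i.e. the sum over `i_1, …, i_N ∈ {1, …, r}` of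
`S^{i_N}_{i_{N-1}}(u) ⊗ ⋯ ⊗ S^{i_2}_{i_1}(u) ⊗ S^{i_1}_{i_N}(u)`. -/
noncomputable def QR (u : ℂ) : M.E →ₗ[ℂ] M.H :=
  ∑ i : Fin M.N → Fin M.r,
    PiTensorProduct.map fun n => M.S c (i n) (i ((finRotate M.N).symm n)) u

/-- The operator `Q_L(u) = Q_R(-conj u)^*`. -/
noncomputable def QL (u : ℂ) : M.H →ₗ[ℂ] M.E := adjoint M.form (M.QR c (-conj u))

/-- `h_+(u) = (2[u - 2lη])^N`. -/
noncomputable def hPlus (u : ℂ) : ℂ := (2 * M.br (u - 2 * M.l * M.η)) ^ M.N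

/-- `h_-(u) = (2[u + 2lη])^N`. -/
noncomputable def hMinus (u : ℂ) : ℂ := (2 * M.br (u + 2 * M.l * M.η)) ^ M.N

end SpinModel

end Sklyanin

/-!
The theorem has two halves: the adjoint of the transfer matrix, and the relation between `Q_L` and
`T`, which is the adjoint of a relation between `T` and `Q_R`. All theta function identities come
from a single source, the duplication of the modulus: sums and differences of two of the products
`θ_a(u) θ_a(y)` of modulus `τ` are products of values of the functions `A = θ₀₁` and `B = θ₀₀` of
modulus `τ/2` at `(u ± y)/2` (`theta_half_modulus`). Hence `2[x+y][x-y] = A(x)B(y) - B(x)A(y)` is a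
determinant, and Weierstrass' three-term relation `br_weierstrass` is a Plücker relation; shifting
its arguments by half periods gives the relations `th_three_term` between the four theta functions.

*The generators are self-adjoint* (`isAdjoint_rho`). Put `z = x + iy`, and let `F(z)` be the
conjugate of `f(conj z)`, which again lies in `V`. Each of the two sides of the relation
`⟨ρ(S^a) f, g⟩ = ⟨f, ρ(S^a) g⟩` is an integral of two terms, in which the argument of `F` or of `g`
is shifted by `±η`. After the substitution `x ↦ x ± η/2`, allowed by periodicity, the four terms contain only the
products `F(x - v) g(x + v)` with `v = iy ± η/2`. The three-term relation combines them in pairs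
into `c(x) H_x(iy - η/2)` and `c(x) H_x(iy + η/2)` with the same function `H_x` (`terms_sub`,
`terms_add`). The function `H_x` has the period `τ`, and by the bound on `η` it is holomorphic in
the strip `|Re v| ≤ |η|/2`, so that the integrals over the two lines agree by Cauchy's theorem
(`integral_transferFun`).

*The adjoint of `T(u)`.* Adjunction transposes the Pauli matrices and conjugates the coefficients;
conjugation with `σ²` undoes this at the cost of a sign at each site, whence `isAdjoint_T`. The
density of the Sklyanin form on the period cell is real, continuous and nonnegative, and it vanishes
only at the zeros of `θ₁₁(2z)`, so that the form is positive definite on `V`. A tensor power of a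
positive definite form is separating (`tensorForm_separating`), so adjoints are unique.

*The relation between `T` and `Q_R`* (`T_comp_QR`). The theta functions in the local `L`-operator
form a matrix of rank one (`sum_th_pauli`). Applied to `f_±(λ, u)`, the operator therefore sends the
column vector `(B, -A)` at `±λ/2` to the column vector at `±λ/2 + 2lη` and shifts `u` by `-2η`;
dually it acts on the row vectors `(A, B)` and shifts `u` by `2η` (`ell_fvec_col`, `ell_fvec_row`).
A gauge transformation with these vectors, taken at the points `(2j+1)lη`, makes all local factors
upper triangular, and the trace reduces to the products of the two diagonal entries. At the two ends
of the chain `1 ≤ j ≤ r` the gauge vectors match because they are even and have the period `1`, and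
because `2rlη` is an integer (`Svec_cases`).
-/

namespace Sklyanin

/-! ### Addition theorems for theta functions -/

theorem hasSum_theta (a b : ℕ) (z : ℂ) {τ : ℂ} (hτ : 0 < τ.im) :
    HasSum (fun n : ℤ => cexp (π * I * ((a : ℂ) / 2 + n) ^ 2 * τ +
      2 * π * I * ((a : ℂ) / 2 + n) * ((b : ℂ) / 2 + z))) (theta a b z τ) := by
  rw [theta_eq]
  refine ((hasSum_jacobiTheta₂_term (z + (b : ℂ) / 2 + (a : ℂ) / 2 * τ) hτ).mul_left _).congr_fun
    fun n => ?_
  rw [jacobiTheta₂_term, ← Complex.exp_add]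
  congr 1
  ring

/-- The bijection splitting `ℤ²` according to the parity of the sum of the coordinates. -/
noncomputable def paritySplit : (ℤ × ℤ) ⊕ (ℤ × ℤ) ≃ ℤ × ℤ :=
  Equiv.ofBijective
    (Sum.elim (fun p => (p.1 + p.2, p.1 - p.2)) (fun p => (p.1 + p.2 + 1, p.1 - p.2))) <| by
    constructor
    · rintro (⟨a, b⟩ | ⟨a, b⟩) (⟨c, d⟩ | ⟨c, d⟩) h <;>
        simp only [Sum.elim_inl, Sum.elim_inr, Prod.mk.injEq] at h <;>
        first
        | (exfalso; omega)
        | (obtain ⟨h1, h2⟩ := h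
           obtain rfl : a = c := by omega
           obtain rfl : b = d := by omega
           rfl)
    · rintro ⟨m, n⟩
      rcases Int.even_or_odd' (m + n) with ⟨k, hk | hk⟩
      · refine ⟨Sum.inl (k, m - k), ?_⟩
        simp only [Sum.elim_inl, Prod.mk.injEq]
        omega
      · refine ⟨Sum.inr (k, m - k - 1), ?_⟩
        simp only [Sum.elim_inr, Prod.mk.injEq]
        omega

theorem paritySplit_inl (p : ℤ × ℤ) : paritySplit (Sum.inl p) = (p.1 + p.2, p.1 - p.2) := rfl

theorem paritySplit_inr (p : ℤ × ℤ) : paritySplit (Sum.inr p) = (p.1 + p.2 + 1, p.1 - p.2) := rfl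

/-- The duplication of the modulus. The double series on the right is split according to the parity
of the sum of the two summation indices. -/
theorem theta_half_modulus (u y : ℂ) {τ : ℂ} (hτ : 0 < τ.im) :
    theta 0 0 u τ * theta 0 0 y τ + theta 1 0 u τ * theta 1 0 y τ =
      theta 0 0 ((u + y) / 2) (τ / 2) * theta 0 0 ((u - y) / 2) (τ / 2) := by
  have hτ2 : 0 < (τ / 2).im := by simpa using hτ
  have prod : ∀ {f g : ℤ → ℂ} {x y : ℂ}, HasSum f x → HasSum g y →
      HasSum (fun p : ℤ × ℤ => f p.1 * g p.2) (x * y) := fun hf hg =>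
    hf.mul hg (summable_mul_of_summable_norm hf.summable.norm hg.summable.norm)
  have h1 := prod (hasSum_theta 0 0 u hτ) (hasSum_theta 0 0 y hτ)
  have h2 := prod (hasSum_theta 1 0 u hτ) (hasSum_theta 1 0 y hτ)
  have h3 := prod (hasSum_theta 0 0 ((u + y) / 2) hτ2) (hasSum_theta 0 0 ((u - y) / 2) hτ2)
  rw [← paritySplit.hasSum_iff] at h3
  refine HasSum.unique (HasSum.sum ?_ ?_) h3
  · refine h1.congr_fun fun p => ?_
    simp only [Function.comp_apply, paritySplit_inl]
    rw [← Complex.exp_add, ← Complex.exp_add]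
    congr 1
    push_cast
    ring
  · refine h2.congr_fun fun p => ?_
    simp only [Function.comp_apply, paritySplit_inr]
    rw [← Complex.exp_add, ← Complex.exp_add]
    congr 1
    push_cast
    ring

theorem theta_add_half (a b : ℕ) (z τ : ℂ) : theta a b (z + 1 / 2) τ = theta a (b + 1) z τ := by
  rw [theta, theta]
  refine tsum_congr fun n => ?_
  congr 3
  push_cast
  ring

theorem theta_sub_half (a b : ℕ) (z τ : ℂ) :
    theta a b (z - 1 / 2) τ = (-1) ^ a * theta a (b + 1) z τ := by
  have h := theta_add_one a b (z - 1 / 2) τ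
  rw [show z - 1 / 2 + 1 = z + 1 / 2 by ring, theta_add_half] at h
  rw [h, ← mul_assoc, ← mul_pow]
  norm_num

theorem conj_theta (a b : ℕ) (z : ℂ) (t : ℝ) :
    conj (theta a b z (I * t)) = theta a b (conj z) (I * t) := by
  have h : conj (theta a b z (I * t)) = (-1) ^ (a * b) * theta a b (-conj z) (I * t) := by
    rw [theta, theta, Complex.conj_tsum, ← tsum_mul_left]
    refine tsum_congr fun n => ?_
    rw [← Complex.exp_conj]
    have h1 : ((-1 : ℂ)) ^ (a * b) = cexp (-((a : ℂ) * b * (π * I))) := by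
      rw [Complex.exp_neg, show (a : ℂ) * b * (π * I) = ((a * b : ℕ) : ℂ) * (π * I) by
        push_cast; ring, Complex.exp_nat_mul, Complex.exp_pi_mul_I, ← inv_pow]
      norm_num
    have h2 : cexp ((n * b : ℤ) * (2 * π * I)) = 1 := Complex.exp_int_mul_two_pi_mul_I _
    rw [h1, ← Complex.exp_add, ← mul_one (cexp _), ← h2, ← Complex.exp_add]
    congr 1
    simp only [map_add, map_mul, map_pow, map_div₀, conj_I, conj_ofReal, map_natCast, map_ofNat,
      map_intCast]
    push_cast
    ring
  rw [h, theta_neg, ← mul_assoc, ← mul_pow]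
  norm_num

namespace SpinModel

variable (M : SpinModel)

/-- The function `θ₀₁(z, τ/2)`. -/
noncomputable def thA (z : ℂ) : ℂ := theta 0 1 z (M.τ / 2)

/-- The function `θ₀₀(z, τ/2)`. -/
noncomputable def thB (z : ℂ) : ℂ := theta 0 0 z (M.τ / 2)

theorem th_zero (z : ℂ) : M.th 0 z = theta 1 1 z M.τ := rfl
theorem th_one (z : ℂ) : M.th 1 z = theta 1 0 z M.τ := rfl
theorem th_two (z : ℂ) : M.th 2 z = theta 0 0 z M.τ := rfl
theorem th_three (z : ℂ) : M.th 3 z = theta 0 1 z M.τ := rfl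

theorem thA_neg (z : ℂ) : M.thA (-z) = M.thA z := by rw [thA, theta_neg]; simp [thA]

theorem thB_neg (z : ℂ) : M.thB (-z) = M.thB z := by rw [thB, theta_neg]; simp [thB]

theorem thA_add_one (z : ℂ) : M.thA (z + 1) = M.thA z := by rw [thA, theta_add_one]; simp [thA]

theorem thB_add_one (z : ℂ) : M.thB (z + 1) = M.thB z := by rw [thB, theta_add_one]; simp [thB]

theorem thB_add_half (z : ℂ) : M.thB (z + 1 / 2) = M.thA z := theta_add_half 0 0 z _

/-- The first of the four relations which express the products `θ_a(u) θ_a(y)` by theta functions of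
modulus `τ/2`; the other three follow by shifting the arguments by half periods. -/
theorem th_two_add_th_one (u y : ℂ) :
    M.th 2 u * M.th 2 y + M.th 1 u * M.th 1 y = M.thB ((u + y) / 2) * M.thB ((u - y) / 2) :=
  theta_half_modulus u y M.τ_im_pos

theorem th_two_sub_th_one (u y : ℂ) :
    M.th 2 u * M.th 2 y - M.th 1 u * M.th 1 y = M.thA ((u + y) / 2) * M.thA ((u - y) / 2) := by
  have h := M.th_two_add_th_one (u + 1) y
  rw [th_two, th_one, theta_add_one, theta_add_one, ← th_one, ← th_two,
    show (u + 1 + y) / 2 = (u + y) / 2 + 1 / 2 by ring,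
    show (u + 1 - y) / 2 = (u - y) / 2 + 1 / 2 by ring, thB_add_half, thB_add_half] at h
  linear_combination h

theorem th_three_add_th_zero (u y : ℂ) :
    M.th 3 u * M.th 3 y + M.th 0 u * M.th 0 y = M.thA ((u + y) / 2) * M.thB ((u - y) / 2) := by
  have h := M.th_two_add_th_one (u + 1 / 2) (y + 1 / 2)
  rw [th_two, th_two, th_one, th_one, theta_add_half, theta_add_half, theta_add_half,
    theta_add_half, show (u + 1 / 2 + (y + 1 / 2)) / 2 = (u + y) / 2 + 1 / 2 by ring,
    show (u + 1 / 2 - (y + 1 / 2)) / 2 = (u - y) / 2 by ring, thB_add_half] at h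
  exact h

theorem th_three_sub_th_zero (u y : ℂ) :
    M.th 3 u * M.th 3 y - M.th 0 u * M.th 0 y = M.thB ((u + y) / 2) * M.thA ((u - y) / 2) := by
  have h := M.th_two_add_th_one (u + 1 / 2) (y - 1 / 2)
  rw [th_two, th_two, th_one, th_one, theta_add_half, theta_add_half, theta_sub_half,
    theta_sub_half, show (u + 1 / 2 + (y - 1 / 2)) / 2 = (u + y) / 2 by ring,
    show (u + 1 / 2 - (y - 1 / 2)) / 2 = (u - y) / 2 + 1 / 2 by ring, thB_add_half] at h
  rw [th_three, th_three, th_zero, th_zero]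
  linear_combination h

/-- The product `[x+y][x-y]` is a determinant of two vectors `(θ₀₁, θ₀₀)` of modulus `τ/2`. -/
theorem br_add_mul_br_sub (x y : ℂ) :
    M.br (x + y) * M.br (x - y) = (M.thA x * M.thB y - M.thB x * M.thA y) / 2 := by
  have h1 := M.th_three_add_th_zero (x + y) (x - y)
  have h2 := M.th_three_sub_th_zero (x + y) (x - y)
  rw [show (x + y + (x - y)) / 2 = x by ring, show (x + y - (x - y)) / 2 = y by ring] at h1 h2
  rw [br, br, ← th_zero, ← th_zero]
  linear_combination (h1 - h2) / 2

theorem br_neg (z : ℂ) : M.br (-z) = -M.br z := by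
  rw [br, theta_neg]; simp [br]

/-- Weierstrass' three-term relation: the Plücker relation for four vectors `(θ₀₁, θ₀₀)` of modulus
`τ/2`. -/
theorem br_weierstrass (x y u v : ℂ) :
    M.br (x + y) * M.br (x - y) * (M.br (u + v) * M.br (u - v)) -
      M.br (x + u) * M.br (x - u) * (M.br (y + v) * M.br (y - v)) +
      M.br (x + v) * M.br (x - v) * (M.br (y + u) * M.br (y - u)) = 0 := by
  simp only [br_add_mul_br_sub]
  ring

theorem conj_br (z : ℂ) : conj (M.br z) = M.br (conj z) := conj_theta 1 1 z M.t

theorem conj_th (a : Fin 4) (z : ℂ) : conj (M.th a z) = M.th a (conj z) := conj_theta _ _ z M.t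

/-! ### Half-period shifts -/

theorem br_add_half (z : ℂ) : M.br (z + 1 / 2) = -M.th 1 z := by
  have h := theta_add_one 1 0 z M.τ
  rw [show z + 1 = z + 1 / 2 + 1 / 2 by ring, theta_add_half] at h
  rw [br, h, th_one]
  ring

theorem br_sub_half (z : ℂ) : M.br (z - 1 / 2) = M.th 1 z := by
  rw [br, ← theta_add_half, sub_add_cancel, th_one]

theorem br_add_half_tau (z : ℂ) :
    M.br (z + M.τ / 2) = -I * cexp (-π * I * M.τ / 4) * cexp (-π * I * z) * M.th 3 z := by
  have hI : (-I : ℂ) = cexp (-(π / 2 * I)) := by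
    rw [Complex.exp_neg, Complex.exp_pi_div_two_mul_I, Complex.inv_I]
  rw [br, th_three, theta_eq, theta_eq, hI, ← mul_assoc, ← Complex.exp_add, ← Complex.exp_add,
    ← Complex.exp_add,
    show z + M.τ / 2 + ((1 : ℕ) : ℂ) / 2 + ((1 : ℕ) : ℂ) / 2 * M.τ =
      z + ((1 : ℕ) : ℂ) / 2 + ((0 : ℕ) : ℂ) / 2 * M.τ + M.τ by push_cast; ring,
    jacobiTheta₂_add_left', ← mul_assoc, ← Complex.exp_add]
  congr 1
  push_cast
  ring_nf

theorem br_sub_half_tau (z : ℂ) :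
    M.br (z - M.τ / 2) = I * cexp (-π * I * M.τ / 4) * cexp (π * I * z) * M.th 3 z := by
  have h := M.br_add_half_tau (-z)
  rw [th_three, theta_neg, show -z + M.τ / 2 = -(z - M.τ / 2) by ring, br_neg,
    show -π * I * -z = π * I * z by ring] at h
  rw [th_three]
  linear_combination -h

theorem br_add_half_period (z : ℂ) :
    M.br (z - 1 / 2 + M.τ / 2) = cexp (-π * I * M.τ / 4) * cexp (-π * I * z) * M.th 2 z := by
  have h : cexp (-π * I * (z - 1 / 2)) = I * cexp (-π * I * z) := by
    rw [show -π * I * (z - 1 / 2) = π / 2 * I + -π * I * z by ring, Complex.exp_add,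
      Complex.exp_pi_div_two_mul_I]
  rw [br_add_half_tau, h, th_three, ← theta_add_half, sub_add_cancel, th_two]
  linear_combination -(cexp (-π * I * M.τ / 4) * cexp (-π * I * z) * theta 0 0 z M.τ) * I_mul_I

theorem br_sub_half_period (z : ℂ) :
    M.br (z + 1 / 2 - M.τ / 2) = -(cexp (-π * I * M.τ / 4) * cexp (π * I * z) * M.th 2 z) := by
  have h := M.br_add_half_period (-z)
  rw [th_two, theta_neg, show -z - 1 / 2 + M.τ / 2 = -(z + 1 / 2 - M.τ / 2) by ring, br_neg,
    show -π * I * -z = π * I * z by ring] at h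
  rw [th_two]
  linear_combination -h

/-! ### The theta function identity behind the self-adjointness of the generators -/

/-- The sign by which complex conjugation of the coefficients changes `s_a`; it is `-1` for `a = 2`
because of the factor `ε₂ = i`. -/
def conjSign : Fin 4 → ℂ := ![1, 1, -1, 1]

/-- Weierstrass' relation, in variables chosen so that the shifts `a`, `b`, `c` of its arguments can
be half periods adding up to zero. -/
theorem br_weierstrass_shift (p m k a b c : ℂ) (h : a + b + c = 0) :
    M.br (p + m) * M.br (p - m - k + a) * M.br (p + k + b) * M.br (p + c) +
      M.br (p - c) * M.br (p - k - b) * M.br (p + m + k - a) * M.br (m - p) =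
      M.br (2 * p) * M.br (-k + a) * M.br (m + k + b) * M.br (m + c) := by
  obtain rfl : c = -a - b := by linear_combination h
  have := M.br_weierstrass (p - k / 2 + a / 2) (m + k / 2 - a / 2) (p + k / 2 - a / 2)
    (k / 2 + (b + a / 2))
  ring_nf at this ⊢
  linear_combination this

theorem th_neg (a : Fin 4) (z : ℂ) :
    M.th a (-z) = (![-1, 1, 1, 1] : Fin 4 → ℂ) a * M.th a z := by
  rw [th, theta_neg]
  fin_cases a <;> simp [char, th]

/-- The three-term relation for the products of the four theta functions. Note that `a ↦ a + 2`
exchanges the indices `0, 2` and `1, 3`. With each theta function written as `[·]` at an argument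
shifted by a half period, this is `br_weierstrass_shift`. -/
theorem th_three_term (a : Fin 4) (p m k : ℂ) :
    M.br (p + m) * M.th a (p - m - k) * M.th 2 (p + k) * M.th (a + 2) p +
      conjSign a * (M.br (p - m) * M.th a (-p - m - k) * M.th 2 (p - k) * M.th (a + 2) p) =
      M.br (2 * p) * M.th a (-k) * M.th 2 (m + k) * M.th (a + 2) m := by
  have hmp : M.br (m - p) = -M.br (p - m) := by rw [← br_neg, neg_sub]
  have hpk : M.th a (-p - m - k) = (![-1, 1, 1, 1] : Fin 4 → ℂ) a * M.th a (p + m + k) := by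
    rw [← th_neg]; congr 1; ring
  have h0 : ∀ z, M.th 0 z = M.br z := fun _ => rfl
  have en : ∀ x : ℂ, cexp (-π * I * x) = (cexp (π * I * x))⁻¹ := fun x => by
    rw [← Complex.exp_neg]; congr 1; ring
  have em : ∀ x : ℂ, cexp (π * I * -x) = (cexp (π * I * x))⁻¹ := fun x => by
    rw [← Complex.exp_neg]; congr 1; ring
  have ea : ∀ x y : ℂ, cexp (π * I * (x + y)) = cexp (π * I * x) * cexp (π * I * y) :=
    fun x y => by rw [← Complex.exp_add]; congr 1; ring
  have es : ∀ x y : ℂ, cexp (π * I * (x - y)) = cexp (π * I * x) / cexp (π * I * y) :=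
    fun x y => by rw [← Complex.exp_sub]; congr 1; ring
  have hb : ∀ x : ℂ, x + (-1 / 2 + M.τ / 2) = x - 1 / 2 + M.τ / 2 := fun x => by ring
  have hc : ∀ x : ℂ, x + (1 / 2 - M.τ / 2) = x + 1 / 2 - M.τ / 2 := fun x => by ring
  have hb' : ∀ x : ℂ, x - (-1 / 2 + M.τ / 2) = x + 1 / 2 - M.τ / 2 := fun x => by ring
  have hc' : ∀ x : ℂ, x - (1 / 2 - M.τ / 2) = x - 1 / 2 + M.τ / 2 := fun x => by ring
  rw [hpk]
  fin_cases a
  · have h := M.br_weierstrass_shift p m k 0 (-1 / 2 + M.τ / 2) (1 / 2 - M.τ / 2) (by ring)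
    simp only [hb, hc, hb', hc', br_add_half_period, br_sub_half_period, add_zero, sub_zero, en,
      ea, es, hmp] at h
    generalize M.br (2 * p) = b2 at h ⊢
    field_simp at h
    simp [conjSign, h0]
    linear_combination -h
  · have h := M.br_weierstrass_shift p m k (1 / 2) (-1 / 2 + M.τ / 2) (-(M.τ / 2)) (by ring)
    simp only [hb, hb', br_add_half_period, br_sub_half_period] at h
    simp only [← sub_eq_add_neg, sub_neg_eq_add, br_add_half_tau, br_sub_half_tau, br_add_half,
      br_sub_half, en, ea, es, hmp] at h
    generalize M.br (2 * p) = b2 at h ⊢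
    field_simp at h
    simp [conjSign]
    linear_combination -h
  · have h := M.br_weierstrass_shift p m k (1 / 2 - M.τ / 2) (-1 / 2 + M.τ / 2) 0 (by ring)
    simp only [hb, hc, hb', hc', br_add_half_period, br_sub_half_period, add_zero, sub_zero, en,
      em, ea, es, hmp] at h
    generalize M.br (2 * p) = b2 at h ⊢
    field_simp at h
    simp [conjSign, h0]
    linear_combination -h
  · have h := M.br_weierstrass_shift p m k (-(M.τ / 2)) (-1 / 2 + M.τ / 2) (1 / 2) (by ring)
    simp only [hb, hb', br_add_half_period, br_sub_half_period] at h
    simp only [← sub_eq_add_neg, sub_neg_eq_add, br_add_half_tau, br_sub_half_tau, br_add_half,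
      br_sub_half, en, em, ea, es, hmp] at h
    generalize M.br (2 * p) = b2 at h ⊢
    field_simp at h
    simp [conjSign]
    linear_combination -h

/-! ### Self-adjointness of the generators -/

theorem θ_add_one (z : ℂ) : theta 0 0 (z + 1) M.τ = theta 0 0 z M.τ := by
  rw [theta_add_one]; simp

theorem conjV_mem (f : M.V) : (fun z => conj (f.1 (conj z))) ∈ M.V := by
  refine ⟨fun z => differentiableAt_conj_conj_iff.mpr (f.2.1 (conj z)), fun z => ?_, fun z => ?_,
    fun z => ?_⟩
  · beta_reduce
    rw [map_add, map_one, f.2.2.1]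
  · beta_reduce
    rw [map_neg, f.2.2.2.1]
  · beta_reduce
    have h := f.2.2.2.2 (conj z - M.τ)
    have hτ : conj M.τ = -M.τ := by simp [τ]
    rw [sub_add_cancel] at h
    rw [map_add, hτ, ← sub_eq_add_neg, h, map_mul, ← Complex.exp_conj]
    simp only [map_mul, map_neg, map_add, map_sub, map_ofNat, conj_ofReal, conj_I, hτ, conj_conj]
    rw [← mul_assoc, ← Complex.exp_add]
    conv_lhs => rw [← one_mul (conj _), ← Complex.exp_zero]
    congr 2
    ring

/-- The entire function `z ↦ conj (f (conj z))` attached to `f`. -/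
noncomputable def conjV (f : M.V) : M.V := ⟨fun z => conj (f.1 (conj z)), M.conjV_mem f⟩

theorem conjV_apply (f : M.V) (z : ℂ) : (M.conjV f).1 z = conj (f.1 (conj z)) := rfl

theorem conj_s (a : Fin 4) (z : ℂ) : conj (M.s a z) = conjSign a * M.s a (conj z) := by
  rw [s, s, map_mul, map_mul, conj_th, conj_th, map_mul, map_ofNat, conj_ofReal]
  fin_cases a <;> simp [conjSign]

theorem conjV_rho (a : Fin 4) (f : M.V) :
    M.conjV (M.rho a f) = conjSign a • M.rho a (M.conjV f) := by
  refine Subtype.ext (eq_of_mul_eq (M.conjV (M.rho a f)).2.1.continuous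
    (conjSign a • M.rho a (M.conjV f)).2.1.continuous M.deriv_den_ne fun z => ?_)
  have h := congrArg conj (M.rhoFun_mul_den a f (conj z))
  have hd : conj (M.den (conj z)) = M.den z := by
    have := M.conj_br (2 * conj z)
    rwa [map_mul, conj_conj, map_ofNat] at this
  rw [map_mul, hd] at h
  change conj (M.rhoFun a f (conj z)) * M.den z =
    conjSign a * M.rhoFun a (M.conjV f) z * M.den z
  rw [h, mul_assoc, rhoFun_mul_den]
  simp only [num, map_sub, map_mul, conj_s, conjV_apply, map_neg, map_add, conj_conj, conj_ofReal]
  ring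

/-- An integral over a period along a vertical line does not change when the line is moved through a
strip of holomorphy. -/
theorem integral_vertical_eq {H : ℂ → ℂ} {a b t : ℝ}
    (hd : ∀ v : ℂ, v.re ∈ Set.uIcc a b → DifferentiableAt ℂ H v)
    (hp : ∀ v : ℂ, H (v + I * t) = H v) :
    ∫ y : ℝ in 0..t, H (a + y * I) = ∫ y : ℝ in 0..t, H (b + y * I) := by
  have h := Complex.integral_boundary_rect_eq_zero_of_differentiableOn H a (b + t * I)
    (fun v hv => (hd v (by simpa using hv.1)).differentiableWithinAt)
  have e : ∀ x : ℝ, H (x + t * I) = H x := fun x => by rw [← hp x, mul_comm]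
  simp only [ofReal_re, ofReal_im, add_re, add_im, mul_re, mul_im, I_re, I_im, mul_zero, mul_one,
    add_zero, zero_add, zero_mul, ofReal_zero, e, sub_self] at h
  rw [← smul_sub, smul_eq_mul, mul_eq_zero, or_iff_right I_ne_zero, sub_eq_zero] at h
  exact h.symm

/-- The denominator of the kernel `μ(z, conj z)` at `z = x + v`, `conj z = x - v`. -/
noncomputable def muDen (x v : ℂ) : ℂ :=
  ∏ j ∈ Finset.range (M.twoL + 2), (theta 0 0 (2 * x + (2 * j - 2 * M.l - 1) * M.η) M.τ *
    theta 0 0 (2 * v + (2 * j - 2 * M.l - 1) * M.η) M.τ)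

/-- The product of the factors common to `∏_j θ₀₀(2x ± η + (2j-2l-1)η)` for both signs. -/
noncomputable def coreProd (x : ℂ) : ℂ :=
  ∏ j ∈ Finset.range (M.twoL + 1), theta 0 0 (2 * x + (2 * j - 2 * M.l) * M.η) M.τ

/-- Shifting by `η/2` moves the arguments by one step: all but the last are those of `coreProd`. -/
theorem prod_theta_add (x : ℂ) :
    ∏ j ∈ Finset.range (M.twoL + 2),
      theta 0 0 (2 * (x + M.η / 2) + (2 * j - 2 * M.l - 1) * M.η) M.τ =
      M.coreProd x * M.th 2 (2 * x + (2 * M.l + 2) * M.η) := by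
  rw [Finset.prod_range_succ, coreProd, th_two]
  congr 1
  · refine Finset.prod_congr rfl fun j _ => ?_
    congr 1; ring
  · congr 1
    push_cast
    rw [← two_l_complex]
    ring

/-- The analogue of `prod_theta_add` for the shift by `-η/2`, which leaves out the first factor. -/
theorem prod_theta_sub (x : ℂ) :
    ∏ j ∈ Finset.range (M.twoL + 2),
      theta 0 0 (2 * (x - M.η / 2) + (2 * j - 2 * M.l - 1) * M.η) M.τ =
      M.coreProd x * M.th 2 (2 * x - (2 * M.l + 2) * M.η) := by
  rw [Finset.prod_range_succ', coreProd, th_two]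
  congr 1
  · refine Finset.prod_congr rfl fun j _ => ?_
    congr 1; push_cast; ring
  · congr 1
    push_cast
    ring

theorem muDen_ne (x y : ℝ) : M.muDen x (y * I) ≠ 0 := by
  refine Finset.prod_ne_zero_iff.mpr fun j hj => mul_ne_zero ?_ ?_
  · have := M.theta_real_ne (2 * x + (2 * j - 2 * M.l - 1) * M.η)
    push_cast at this
    exact this
  · have := M.theta_strip_ne y _ (M.abs_coeff_lt hj)
    push_cast at this
    exact this

theorem muDen_add_one (x v : ℂ) : M.muDen (x + 1) v = M.muDen x v := by
  refine Finset.prod_congr rfl fun j _ => ?_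
  rw [show 2 * (x + 1) + (2 * j - 2 * M.l - 1) * M.η =
    2 * x + (2 * j - 2 * M.l - 1) * M.η + 1 + 1 by ring, θ_add_one, θ_add_one]

theorem continuous_muDen : Continuous fun p : ℝ × ℝ => M.muDen p.1 (p.2 * I) := by
  have h0 : Continuous fun z => theta 0 0 z M.τ := (differentiable_theta 0 0 M.τ_im_pos).continuous
  exact continuous_finsetProd _ fun j _ =>
    (h0.comp (by fun_prop)).mul (h0.comp (by fun_prop))

theorem μ_eq (x y : ℝ) : M.μ (x + y * I) (conj (x + y * I : ℂ)) =
    M.den (x + y * I) * M.den (x - y * I) / M.muDen x (y * I) := by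
  have : conj (x + y * I : ℂ) = x - y * I := by
    simp [sub_eq_add_neg]
  rw [this, μ, muDen, den, den]
  congr 1
  refine Finset.prod_congr rfl fun j _ => ?_
  congr 2 <;> ring

/-- The function whose integrals along two vertical lines are the two sides of the self-adjointness
relation of the generators, up to the integration over the real part. -/
noncomputable def transferFun (a : Fin 4) (F G : M.V) (x v : ℂ) : ℂ :=
  F.1 (x - v) * G.1 (x + v) * M.th (a + 2) (2 * v) / M.coreProd v

/-- The zeros of `θ₀₀` have real part in `1/2 + ℤ`, and for `|Re v| ≤ |η|/2` the real parts of the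
arguments in `coreProd v` are at most `(2l+1)|η| < 1/2`. -/
theorem coreProd_ne {v : ℂ} (hv : |v.re| ≤ |M.η| / 2) : M.coreProd v ≠ 0 := by
  refine Finset.prod_ne_zero_iff.mpr fun j hj => ?_
  have h1 := M.abs_η_lt
  have h2 : (j : ℝ) ≤ M.twoL := by
    have := Finset.mem_range.mp hj
    exact_mod_cast (by omega : j ≤ M.twoL)
  have h3 : (0 : ℝ) ≤ j := j.cast_nonneg
  have h4 := M.two_l
  have h5 : (0 : ℝ) < 2 * M.l + 1 := by rw [h4]; positivity
  have h6 : |2 * (j : ℝ) - 2 * M.l| ≤ 2 * M.l := by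
    rw [abs_le]; constructor <;> linarith
  have h7 : |2 * v.re + (2 * j - 2 * M.l) * M.η| < 1 / 2 := by
    calc _ ≤ |2 * v.re| + |(2 * j - 2 * M.l) * M.η| := abs_add_le _ _
      _ = 2 * |v.re| + |2 * (j : ℝ) - 2 * M.l| * |M.η| := by
        rw [abs_mul, abs_mul, abs_of_pos (zero_lt_two' ℝ)]
      _ ≤ |M.η| + 2 * M.l * |M.η| := by
        have := mul_le_mul_of_nonneg_right h6 (abs_nonneg M.η)
        linarith
      _ = (2 * M.l + 1) * |M.η| := by ring
      _ < (2 * M.l + 1) * (1 / (2 * (2 * M.l + 1))) := mul_lt_mul_of_pos_left h1 h5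
      _ = 1 / 2 := by field_simp
  have := M.theta_strip_ne v.im _ h7
  convert this using 2
  conv_lhs => rw [← Complex.re_add_im v]
  push_cast
  ring

theorem coreProd_add_tau (v : ℂ) : M.coreProd (v + M.τ) =
    cexp (-4 * (2 * M.l + 1) * π * I * (2 * v + M.τ)) * M.coreProd v := by
  have h : ∀ j ∈ Finset.range (M.twoL + 1),
      theta 0 0 (2 * (v + M.τ) + (2 * j - 2 * M.l) * M.η) M.τ =
      cexp (-4 * π * I * (2 * v + M.τ + (2 * j - 2 * M.l) * M.η)) *
        theta 0 0 (2 * v + (2 * j - 2 * M.l) * M.η) M.τ := by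
    intro j _
    rw [show 2 * (v + M.τ) + (2 * j - 2 * M.l) * M.η =
      2 * v + (2 * j - 2 * M.l) * M.η + M.τ + M.τ by ring, theta_add_tau, theta_add_tau,
      ← mul_assoc, pow_zero, one_mul, one_mul, ← Complex.exp_add]
    congr 2
    ring
  -- the shifts `(2j - 2l)η` add up to zero
  have hs : ∑ j ∈ Finset.range (M.twoL + 1), (j : ℂ) = (2 * M.l + 1) * M.l := by
    have := Finset.sum_range_id_mul_two (M.twoL + 1)
    have h2 : ((∑ j ∈ Finset.range (M.twoL + 1), j : ℕ) : ℂ) * 2 = (M.twoL + 1) * M.twoL := by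
      exact_mod_cast this
    push_cast at h2
    rw [← two_l_complex] at h2
    linear_combination h2 / 2
  rw [coreProd, Finset.prod_congr rfl h, Finset.prod_mul_distrib, ← Complex.exp_sum, coreProd]
  congr 2
  rw [← Finset.mul_sum, Finset.sum_add_distrib, ← Finset.sum_mul, Finset.sum_sub_distrib,
    ← Finset.mul_sum, hs]
  simp only [Finset.sum_const, Finset.card_range, nsmul_eq_mul]
  push_cast
  rw [← two_l_complex]
  ring

/-- The multipliers of `F`, `G` and `θ_{a+2}` under `v ↦ v + τ` cancel that of `coreProd`. -/
theorem transferFun_add_tau (a : Fin 4) (F G : M.V) (x v : ℂ) :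
    M.transferFun a F G x (v + M.τ) = M.transferFun a F G x v := by
  have hF := F.2.2.2.2 (x - (v + M.τ))
  have hG := G.2.2.2.2 (x + v)
  rw [show x - (v + M.τ) + M.τ = x - v by ring] at hF
  rw [transferFun, transferFun, coreProd_add_tau, mul_add 2 v, th_two_add_tau, ← add_assoc x, hG,
    hF]
  have e : cexp (-4 * M.l * π * I * (2 * (x + v) + M.τ)) *
      (cexp (-4 * π * I * (2 * v + M.τ)) / cexp (-4 * (2 * M.l + 1) * π * I * (2 * v + M.τ))) =
      cexp (-4 * M.l * π * I * (2 * (x - (v + M.τ)) + M.τ)) := by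
    rw [← Complex.exp_sub, ← Complex.exp_add]
    congr 1
    ring
  rw [← e]
  ring

theorem differentiableAt_transferFun (a : Fin 4) (F G : M.V) (x : ℂ) {v : ℂ}
    (hv : |v.re| ≤ |M.η| / 2) : DifferentiableAt ℂ (M.transferFun a F G x) v := by
  have h0 := differentiable_theta 0 0 M.τ_im_pos
  have h1 : Differentiable ℂ M.coreProd :=
    Differentiable.fun_finsetProd fun j _ => h0.comp (by fun_prop)
  refine DifferentiableAt.div ?_ (h1 v) (M.coreProd_ne hv)
  exact (((F.2.1.comp (by fun_prop)).mul (G.2.1.comp (by fun_prop))).mul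
    ((M.differentiable_th _).comp (by fun_prop))) v

/-- Cauchy's theorem in the strip `|Re v| ≤ |η|/2`. -/
theorem integral_transferFun (a : Fin 4) (F G : M.V) (x : ℂ) :
    ∫ y : ℝ in 0..M.t, M.transferFun a F G x (y * I - M.η / 2) =
      ∫ y : ℝ in 0..M.t, M.transferFun a F G x (y * I + M.η / 2) := by
  have h := integral_vertical_eq (H := M.transferFun a F G x) (a := -(M.η / 2)) (b := M.η / 2)
    (t := M.t) (fun v hv => M.differentiableAt_transferFun a F G x ?_)
    (M.transferFun_add_tau a F G x)
  · convert h using 3 <;> push_cast <;> ring_nf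
  · rcases le_total 0 M.η with h0 | h0
    · rw [Set.uIcc_of_le (by linarith), Set.mem_Icc] at hv
      rw [abs_of_nonneg h0, abs_le]
      exact ⟨by linarith [hv.1], hv.2⟩
    · rw [Set.uIcc_of_ge (by linarith), Set.mem_Icc] at hv
      rw [abs_of_nonpos h0, abs_le]
      exact ⟨by linarith [hv.1], by linarith [hv.2]⟩

/-- One half of the numerator of `ρ(S^a) F` at `w`, times the remaining factors of the integrand of
the Sklyanin form at `(z, w) = (x + i y, x - i y)`. -/
noncomputable def leftTerm (a : Fin 4) (F G : M.V) (e x y : ℝ) : ℂ :=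
  M.s a (e * (x - y * I) - M.l * M.η) * F.1 (x - y * I + e * M.η) * G.1 (x + y * I) *
    M.den (x + y * I) / M.muDen x (y * I)

/-- The analogue of `leftTerm` for the operator `ρ(S^a)` acting on the function `G` of `z`. -/
noncomputable def rightTerm (a : Fin 4) (F G : M.V) (e x y : ℝ) : ℂ :=
  M.s a (e * (x + y * I) - M.l * M.η) * G.1 (x + y * I + e * M.η) * F.1 (x - y * I) *
    M.den (x - y * I) / M.muDen x (y * I)

theorem continuous_leftTerm (a : Fin 4) (F G : M.V) (e : ℝ) :
    Continuous fun p : ℝ × ℝ => M.leftTerm a F G e p.1 p.2 := by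
  refine Continuous.div ?_ M.continuous_muDen fun p => M.muDen_ne _ _
  exact ((((M.differentiable_s a).continuous.comp (by fun_prop)).mul
    (F.2.1.continuous.comp (by fun_prop))).mul (G.2.1.continuous.comp (by fun_prop))).mul
    (M.differentiable_den.continuous.comp (by fun_prop))

theorem continuous_rightTerm (a : Fin 4) (F G : M.V) (e : ℝ) :
    Continuous fun p : ℝ × ℝ => M.rightTerm a F G e p.1 p.2 := by
  refine Continuous.div ?_ M.continuous_muDen fun p => M.muDen_ne _ _
  exact ((((M.differentiable_s a).continuous.comp (by fun_prop)).mul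
    (G.2.1.continuous.comp (by fun_prop))).mul (F.2.1.continuous.comp (by fun_prop))).mul
    (M.differentiable_den.continuous.comp (by fun_prop))

theorem s_add_sign (a : Fin 4) (e : ℝ) (he : e = 1 ∨ e = -1) (z c : ℂ) :
    M.s a (e * (z + 1) - c) = M.s a (e * z - c) := by
  rcases he with rfl | rfl
  · rw [← s_add_one _ _ (((1 : ℝ) : ℂ) * z - c)]; congr 1; push_cast; ring
  · rw [← s_sub_one _ _ (((-1 : ℝ) : ℂ) * z - c)]; congr 1; push_cast; ring

theorem leftTerm_add_one (a : Fin 4) (F G : M.V) (e : ℝ) (he : e = 1 ∨ e = -1) (x y : ℝ) :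
    M.leftTerm a F G e (x + 1) y = M.leftTerm a F G e x y := by
  rw [leftTerm, leftTerm, ofReal_add, ofReal_one, muDen_add_one, add_right_comm, G.2.2.1,
    den_add_one, add_sub_right_comm, s_add_sign _ _ _ he, add_right_comm _ (1 : ℂ), F.2.2.1]

theorem rightTerm_add_one (a : Fin 4) (F G : M.V) (e : ℝ) (he : e = 1 ∨ e = -1) (x y : ℝ) :
    M.rightTerm a F G e (x + 1) y = M.rightTerm a F G e x y := by
  rw [rightTerm, rightTerm, ofReal_add, ofReal_one, muDen_add_one, add_right_comm,
    add_sub_right_comm, s_add_sign _ _ _ he, add_right_comm _ (1 : ℂ), F.2.2.1, G.2.2.1,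
    den_add_one]

theorem muDen_shift_sub (x y : ℂ) :
    M.muDen (x - M.η / 2) y = M.coreProd x * M.th 2 (2 * x - (2 * M.l + 2) * M.η) *
      ∏ j ∈ Finset.range (M.twoL + 2), theta 0 0 (2 * y + (2 * j - 2 * M.l - 1) * M.η) M.τ := by
  rw [muDen, Finset.prod_mul_distrib, prod_theta_sub]

theorem muDen_shift_add (x y : ℂ) :
    M.muDen (x + M.η / 2) y = M.coreProd x * M.th 2 (2 * x + (2 * M.l + 2) * M.η) *
      ∏ j ∈ Finset.range (M.twoL + 2), theta 0 0 (2 * y + (2 * j - 2 * M.l - 1) * M.η) M.τ := by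
  rw [muDen, Finset.prod_mul_distrib, prod_theta_add]

/-- The coefficient, depending only on the real part `x`, of `transferFun` in the integrands. -/
noncomputable def transferCoeff (a : Fin 4) (x : ℂ) : ℂ :=
  (![1, 1, I, 1] : Fin 4 → ℂ) a * M.th a M.η * M.br (2 * (2 * x)) *
    M.th a (-((2 * M.l + 2) * M.η)) / (M.th (a + 2) (2 * x) *
      (M.coreProd x * M.th 2 (2 * x - (2 * M.l + 2) * M.η) *
        M.th 2 (2 * x + (2 * M.l + 2) * M.η)))

/-- The terms with shifts `x ↦ x - η/2` on the left and `x ↦ x + η/2` on the right contain the same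
product `F(x - v) G(x + v)`, `v = iy - η/2`, and the same factors of the denominator except for one
each; they are added by the three-term relation. -/
theorem terms_sub (a : Fin 4) (F G : M.V) (x y : ℝ) (hx : M.th (a + 2) (2 * x) ≠ 0) :
    M.leftTerm a F G 1 (x - M.η / 2) y + conjSign a * M.rightTerm a F G (-1) (x + M.η / 2) y =
      M.transferCoeff a x * M.transferFun a F G x (y * I - M.η / 2) := by
  have h1 := M.muDen_ne (x - M.η / 2) y
  have h2 := M.muDen_ne (x + M.η / 2) y
  have h3 := M.prod_theta_add (y * I - M.η / 2)
  rw [sub_add_cancel] at h3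
  push_cast at h1 h2
  rw [muDen_shift_sub, h3] at h1
  rw [muDen_shift_add, h3] at h2
  simp only [mul_ne_zero_iff] at h1 h2
  obtain ⟨⟨hc, hm⟩, hv, hk⟩ := h1
  obtain ⟨⟨-, hp⟩, -, -⟩ := h2
  have key := M.th_three_term a (2 * x) (2 * (y * I - M.η / 2)) ((2 * M.l + 2) * M.η)
  rw [leftTerm, rightTerm]
  push_cast
  rw [muDen_shift_sub, muDen_shift_add, h3, transferCoeff, transferFun, s, s,
    show 2 * (1 * (x - M.η / 2 - y * I) - M.l * M.η) =
      2 * x - 2 * (y * I - M.η / 2) - (2 * M.l + 2) * M.η by ring,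
    show x - M.η / 2 - y * I + 1 * M.η = x - (y * I - M.η / 2) by ring,
    show x - M.η / 2 + y * I = x + (y * I - M.η / 2) by ring,
    show 2 * (-1 * (x + M.η / 2 + y * I) - M.l * M.η) =
      -(2 * x) - 2 * (y * I - M.η / 2) - (2 * M.l + 2) * M.η by ring,
    show x + M.η / 2 + y * I + -1 * M.η = x + (y * I - M.η / 2) by ring,
    show x + M.η / 2 - y * I = x - (y * I - M.η / 2) by ring,
    show M.den (x + (y * I - M.η / 2)) = M.br (2 * x + 2 * (y * I - M.η / 2)) by
      rw [den, br]; ring_nf,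
    show M.den (x - (y * I - M.η / 2)) = M.br (2 * x - 2 * (y * I - M.η / 2)) by
      rw [den, br]; ring_nf]
  generalize M.th 2 (2 * x - (2 * M.l + 2) * M.η) = u1 at *
  generalize M.th 2 (2 * x + (2 * M.l + 2) * M.η) = u2 at *
  generalize M.th 2 (2 * (y * I - M.η / 2) + (2 * M.l + 2) * M.η) = u3 at *
  generalize M.th (a + 2) (2 * x) = u4 at *
  generalize M.coreProd x = u5 at *
  generalize M.coreProd (y * I - M.η / 2) = u6 at *
  generalize (![1, 1, I, 1] : Fin 4 → ℂ) a * M.th a M.η = u7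
  generalize F.1 (x - (y * I - M.η / 2)) = u8
  generalize G.1 (x + (y * I - M.η / 2)) = u9
  generalize M.br (2 * x + 2 * (y * I - M.η / 2)) = b1 at *
  generalize M.br (2 * x - 2 * (y * I - M.η / 2)) = b2 at *
  generalize M.br (2 * (2 * x)) = b3 at *
  generalize M.th a (2 * x - 2 * (y * I - M.η / 2) - (2 * M.l + 2) * M.η) = t1 at *
  generalize M.th a (-(2 * x) - 2 * (y * I - M.η / 2) - (2 * M.l + 2) * M.η) = t2 at *
  generalize M.th a (-((2 * M.l + 2) * M.η)) = t3 at *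
  generalize M.th (a + 2) (2 * (y * I - M.η / 2)) = t4 at *
  field_simp
  linear_combination (u7 * u8 * u9) * key

/-- The analogue of `terms_sub` for the other two terms, with `v = iy + η/2`. -/
theorem terms_add (a : Fin 4) (F G : M.V) (x y : ℝ) (hx : M.th (a + 2) (2 * x) ≠ 0) :
    M.leftTerm a F G (-1) (x + M.η / 2) y + conjSign a * M.rightTerm a F G 1 (x - M.η / 2) y =
      M.transferCoeff a x * M.transferFun a F G x (y * I + M.η / 2) := by
  have h1 := M.muDen_ne (x - M.η / 2) y
  have h2 := M.muDen_ne (x + M.η / 2) y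
  have h3 := M.prod_theta_sub (y * I + M.η / 2)
  rw [add_sub_cancel_right] at h3
  push_cast at h1 h2
  rw [muDen_shift_sub, h3] at h1
  rw [muDen_shift_add, h3] at h2
  simp only [mul_ne_zero_iff] at h1 h2
  obtain ⟨⟨hc, hm⟩, hv, hk⟩ := h1
  obtain ⟨⟨-, hp⟩, -, -⟩ := h2
  have key := M.th_three_term a (2 * x) (2 * (y * I + M.η / 2)) (-((2 * M.l + 2) * M.η))
  have hpar : ((![-1, 1, 1, 1] : Fin 4 → ℂ) a) * (![-1, 1, 1, 1] : Fin 4 → ℂ) a = 1 := by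
    fin_cases a <;> simp
  rw [neg_neg, ← sub_eq_add_neg, ← sub_eq_add_neg, sub_neg_eq_add, sub_neg_eq_add, sub_neg_eq_add,
    show 2 * (x : ℂ) - 2 * (y * I + M.η / 2) + (2 * M.l + 2) * M.η =
      -(-(2 * x) + 2 * (y * I + M.η / 2) - (2 * M.l + 2) * M.η) by ring,
    show -(2 * (x : ℂ)) - 2 * (y * I + M.η / 2) + (2 * M.l + 2) * M.η =
      -(2 * x + 2 * (y * I + M.η / 2) - (2 * M.l + 2) * M.η) by ring, th_neg, th_neg,
    ← neg_neg ((2 * M.l + 2) * (M.η : ℂ)), th_neg _ _ (-((2 * M.l + 2) * (M.η : ℂ))),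
    neg_neg] at key
  rw [leftTerm, rightTerm]
  push_cast
  rw [muDen_shift_sub, muDen_shift_add, h3, transferCoeff, transferFun, s, s,
    show 2 * (-1 * (x + M.η / 2 - y * I) - M.l * M.η) =
      -(2 * x) + 2 * (y * I + M.η / 2) - (2 * M.l + 2) * M.η by ring,
    show x + M.η / 2 - y * I + -1 * M.η = x - (y * I + M.η / 2) by ring,
    show x + M.η / 2 + y * I = x + (y * I + M.η / 2) by ring,
    show 2 * (1 * (x - M.η / 2 + y * I) - M.l * M.η) =
      2 * x + 2 * (y * I + M.η / 2) - (2 * M.l + 2) * M.η by ring,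
    show x - M.η / 2 + y * I + 1 * M.η = x + (y * I + M.η / 2) by ring,
    show x - M.η / 2 - y * I = x - (y * I + M.η / 2) by ring,
    show M.den (x + (y * I + M.η / 2)) = M.br (2 * x + 2 * (y * I + M.η / 2)) by
      rw [den, br]; ring_nf,
    show M.den (x - (y * I + M.η / 2)) = M.br (2 * x - 2 * (y * I + M.η / 2)) by
      rw [den, br]; ring_nf]
  generalize M.th 2 (2 * x - (2 * M.l + 2) * M.η) = u1 at *
  generalize M.th 2 (2 * x + (2 * M.l + 2) * M.η) = u2 at *
  generalize M.th 2 (2 * (y * I + M.η / 2) - (2 * M.l + 2) * M.η) = u3 at *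
  generalize M.th (a + 2) (2 * x) = u4 at *
  generalize M.coreProd x = u5 at *
  generalize M.coreProd (y * I + M.η / 2) = u6 at *
  generalize (![1, 1, I, 1] : Fin 4 → ℂ) a * M.th a M.η = u7
  generalize F.1 (x - (y * I + M.η / 2)) = u8
  generalize G.1 (x + (y * I + M.η / 2)) = u9
  generalize (![-1, 1, 1, 1] : Fin 4 → ℂ) a = u10 at *
  generalize M.br (2 * x + 2 * (y * I + M.η / 2)) = b1 at *
  generalize M.br (2 * x - 2 * (y * I + M.η / 2)) = b2 at *
  generalize M.br (2 * (2 * x)) = b3 at *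
  generalize M.th a (-(2 * x) + 2 * (y * I + M.η / 2) - (2 * M.l + 2) * M.η) = t1 at *
  generalize M.th a (2 * x + 2 * (y * I + M.η / 2) - (2 * M.l + 2) * M.η) = t2 at *
  generalize M.th a (-((2 * M.l + 2) * M.η)) = t3 at *
  generalize M.th (a + 2) (2 * (y * I + M.η / 2)) = t4 at *
  -- multiply by the parity of `θ_a` to remove it from the relation
  have key' : b1 * t1 * u1 * u4 + conjSign a * (b2 * t2 * u2 * u4) = b3 * t3 * u3 * t4 := by
    linear_combination u10 * key - (b1 * t1 * u1 * u4 + conjSign a * (b2 * t2 * u2 * u4) -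
      b3 * t3 * u3 * t4) * hpar
  field_simp
  linear_combination (u7 * u8 * u9) * key'

/-- The integral over a period cell. -/
noncomputable def cellInt (k : ℝ → ℝ → ℂ) : ℂ := ∫ x : ℝ in 0..1, ∫ y : ℝ in 0..M.t, k x y

theorem continuous_inner {k : ℝ → ℝ → ℂ} (hk : Continuous fun p : ℝ × ℝ => k p.1 p.2) :
    Continuous fun x : ℝ => ∫ y : ℝ in 0..M.t, k x y :=
  intervalIntegral.continuous_parametric_intervalIntegral_of_continuous' hk 0 M.t

theorem cellInt_add_mul {k₁ k₂ : ℝ → ℝ → ℂ} (c : ℂ) (h₁ : Continuous fun p : ℝ × ℝ => k₁ p.1 p.2)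
    (h₂ : Continuous fun p : ℝ × ℝ => k₂ p.1 p.2) :
    M.cellInt (fun x y => k₁ x y + c * k₂ x y) = M.cellInt k₁ + c * M.cellInt k₂ := by
  have hc : ∀ {k : ℝ → ℝ → ℂ}, (Continuous fun p : ℝ × ℝ => k p.1 p.2) → ∀ x,
      IntervalIntegrable (k x) MeasureTheory.volume 0 M.t := fun h x =>
    (h.comp (Continuous.prodMk continuous_const continuous_id)).intervalIntegrable _ _
  rw [cellInt, cellInt, cellInt, ← intervalIntegral.integral_const_mul,
    ← intervalIntegral.integral_add ((M.continuous_inner h₁).intervalIntegrable _ _)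
      (((M.continuous_inner h₂).const_mul c).intervalIntegrable _ _)]
  refine intervalIntegral.integral_congr fun x _ => ?_
  rw [intervalIntegral.integral_add (hc h₁ x) ((hc h₂ x).const_mul c),
    intervalIntegral.integral_const_mul]

theorem cellInt_shift {k : ℝ → ℝ → ℂ} (hp : ∀ x y, k (x + 1) y = k x y) (h : ℝ) :
    M.cellInt (fun x y => k (x + h) y) = M.cellInt k := by
  have hper : Function.Periodic (fun x => ∫ y : ℝ in 0..M.t, k x y) 1 := fun x => by
    simp only [hp]
  have := hper.intervalIntegral_add_eq h 0
  rw [cellInt, cellInt, intervalIntegral.integral_comp_add_right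
    (fun x => ∫ y : ℝ in 0..M.t, k x y) h, zero_add, add_comm 1 h, this, zero_add]

theorem th_eq_zero (a : Fin 4) {z : ℂ} (h : M.th a z = 0) :
    ∃ m n : ℤ, z = (1 - ((char a).2 : ℂ)) / 2 + (1 - ((char a).1 : ℂ)) / 2 * M.τ + m + n * M.τ := by
  rw [th, theta_eq, mul_eq_zero, or_iff_right (Complex.exp_ne_zero _), τ,
    jacobiTheta₂_zero_iff M.t_pos] at h
  obtain ⟨m, n, h⟩ := h
  exact ⟨m, n, by rw [τ]; linear_combination h⟩

theorem countable_th_zero (a : Fin 4) : {x : ℝ | M.th a (2 * x) = 0}.Countable := by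
  refine (Set.countable_range fun p : ℤ × ℤ => ((1 - ((char a).2 : ℂ)) / 2 +
    (1 - ((char a).1 : ℂ)) / 2 * M.τ + p.1 + p.2 * M.τ).re / 2).mono fun x hx => ?_
  obtain ⟨m, n, h⟩ := M.th_eq_zero a hx
  refine ⟨(m, n), ?_⟩
  beta_reduce
  rw [← h]
  simp

theorem conjSign_mul_self (a : Fin 4) : conjSign a * conjSign a = 1 := by
  fin_cases a <;> simp [conjSign]

/-- The self-adjointness relation of the generators, with the terms in which `F` is shifted by `η`
and `-η` on different sides. -/
theorem cellInt_terms (a : Fin 4) (F G : M.V) :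
    M.cellInt (M.leftTerm a F G 1) + conjSign a * M.cellInt (M.rightTerm a F G (-1)) =
      M.cellInt (M.leftTerm a F G (-1)) + conjSign a * M.cellInt (M.rightTerm a F G 1) := by
  have hL := M.continuous_leftTerm a F G
  have hR := M.continuous_rightTerm a F G
  have sh : ∀ {k : ℝ → ℝ → ℂ} (h : ℝ), (Continuous fun p : ℝ × ℝ => k p.1 p.2) →
      Continuous fun p : ℝ × ℝ => k (p.1 + h) p.2 := fun h hk =>
    hk.comp (by fun_prop : Continuous fun p : ℝ × ℝ => (p.1 + h, p.2))
  rw [← M.cellInt_shift (M.leftTerm_add_one a F G 1 (Or.inl rfl)) (-(M.η / 2)),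
    ← M.cellInt_shift (M.rightTerm_add_one a F G (-1) (Or.inr rfl)) (M.η / 2),
    ← M.cellInt_shift (M.leftTerm_add_one a F G (-1) (Or.inr rfl)) (M.η / 2),
    ← M.cellInt_shift (M.rightTerm_add_one a F G 1 (Or.inl rfl)) (-(M.η / 2)),
    ← M.cellInt_add_mul _ (sh _ (hL 1)) (sh _ (hR (-1))),
    ← M.cellInt_add_mul _ (sh _ (hL (-1))) (sh _ (hR 1))]
  refine intervalIntegral.integral_congr_ae ?_
  -- the coefficient of `transferFun` is defined for all `x` but countably many
  have hae := (M.countable_th_zero (a + 2)).ae_notMem MeasureTheory.volume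
  filter_upwards [hae] with x hx _
  simp only [← sub_eq_add_neg, M.terms_sub a F G x _ hx, M.terms_add a F G x _ hx,
    intervalIntegral.integral_const_mul, integral_transferFun]

/-- The generators act by self-adjoint operators on the local space. -/
theorem isAdjoint_rho (a : Fin 4) :
    IsAdjoint M.sklyaninForm M.sklyaninForm (M.rho a) (M.rho a) := by
  intro f g
  have hL := M.continuous_leftTerm a (M.conjV f) g
  have hR := M.continuous_rightTerm a (M.conjV f) g
  have hconj : ∀ x y : ℝ, conj (x + y * I : ℂ) = x - y * I := fun x y => by
    simp [sub_eq_add_neg]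
  have h1 : M.sklyaninForm (M.rho a f) g = conjSign a *
      (M.cellInt (M.leftTerm a (M.conjV f) g 1) +
        (-1) * M.cellInt (M.leftTerm a (M.conjV f) g (-1))) := by
    rw [← M.cellInt_add_mul _ (hL 1) (hL (-1)), cellInt]
    simp only [← intervalIntegral.integral_const_mul]
    refine intervalIntegral.integral_congr fun x _ => intervalIntegral.integral_congr fun y _ => ?_
    have hr : conj ((M.rho a f).1 (x + y * I)) =
        conjSign a * (M.rho a (M.conjV f)).1 (x - y * I) := by
      have := congrArg (fun F : M.V => F.1 (x - y * I)) (M.conjV_rho a f)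
      simp only [conjV_apply] at this
      rw [← hconj, conj_conj] at this
      rw [this, hconj]
      rfl
    have hn := M.rhoFun_mul_den a (M.conjV f) (x - y * I)
    rw [num] at hn
    rw [μ_eq, hr, leftTerm, leftTerm]
    change conjSign a * M.rhoFun a (M.conjV f) (x - y * I) * _ * _ = _
    simp only [ofReal_one, ofReal_neg, one_mul, neg_mul, ← sub_eq_add_neg]
    linear_combination conjSign a * g.1 (x + y * I) * M.den (x + y * I) / M.muDen x (y * I) * hn
  have h2 : M.sklyaninForm f (M.rho a g) =
      M.cellInt (M.rightTerm a (M.conjV f) g 1) +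
        (-1) * M.cellInt (M.rightTerm a (M.conjV f) g (-1)) := by
    rw [← M.cellInt_add_mul _ (hR 1) (hR (-1)), cellInt]
    refine intervalIntegral.integral_congr fun x _ => intervalIntegral.integral_congr fun y _ => ?_
    have hn := M.rhoFun_mul_den a g (x + y * I)
    rw [num] at hn
    rw [μ_eq, rightTerm, rightTerm, conjV_apply, ← hconj, conj_conj]
    change _ * M.rhoFun a g (x + y * I) * _ = _
    simp only [ofReal_one, ofReal_neg, one_mul, neg_mul, ← sub_eq_add_neg]
    linear_combination conj (f.1 (x + y * I)) * M.den (conj (x + y * I : ℂ)) /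
      M.muDen x (y * I) * hn
  rw [h1, h2]
  linear_combination conjSign a * M.cellInt_terms a (M.conjV f) g +
    (M.cellInt (M.rightTerm a (M.conjV f) g 1) -
      M.cellInt (M.rightTerm a (M.conjV f) g (-1))) * conjSign_mul_self a

end SpinModel

/-! ### Tensor powers of positive definite forms -/

section Positive

variable {V : Type*} [AddCommGroup V] [Module ℂ V]

theorem exists_orthonormal_basis (B : V →ₗ⋆[ℂ] V →ₗ[ℂ] ℂ) (hsymm : ∀ x y, conj (B y x) = B x y)
    (hpos : ∀ x, 0 ≤ (B x x).re) (hdef : ∀ x, B x x = 0 → x = 0) [FiniteDimensional ℂ V] :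
    ∃ (n : ℕ) (b : Module.Basis (Fin n) ℂ V), ∀ i j, B (b i) (b j) = if i = j then 1 else 0 := by
  let core : InnerProductSpace.Core ℂ V :=
    { inner := fun x y => B x y
      conj_inner_symm := hsymm
      re_inner_nonneg := hpos
      add_left := fun x y z => by simp
      smul_left := fun x y r => by simp
      definite := hdef }
  let _ : NormedAddCommGroup V := core.toNormedAddCommGroup
  let _ : InnerProductSpace ℂ V := InnerProductSpace.ofCore core.toCore
  refine ⟨_, (stdOrthonormalBasis ℂ V).toBasis, fun i j => ?_⟩
  have h := (orthonormal_iff_ite.mp (stdOrthonormalBasis ℂ V).orthonormal) i j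
  rw [OrthonormalBasis.coe_toBasis]
  exact h

/-- Every tensor lies in the image of a tensor power of a finite-dimensional subspace. -/
theorem exists_finiteDimensional_tensor {ι : Type*} [Finite ι] (y : ⨂[ℂ] _ : ι, V) :
    ∃ (W : Submodule ℂ V) (_ : FiniteDimensional ℂ W) (y' : ⨂[ℂ] _ : ι, W),
      PiTensorProduct.map (fun _ => W.subtype) y' = y := by
  induction y using PiTensorProduct.induction_on with
  | smul_tprod c x =>
    refine ⟨Submodule.span ℂ (Set.range x), FiniteDimensional.span_of_finite ℂ (Set.finite_range x),
      c • PiTensorProduct.tprod ℂ fun i => ⟨x i, Submodule.subset_span ⟨i, rfl⟩⟩, ?_⟩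
    rw [map_smul, PiTensorProduct.map_tprod]
    rfl
  | add y₁ y₂ h₁ h₂ =>
    obtain ⟨W₁, _, z₁, rfl⟩ := h₁
    obtain ⟨W₂, _, z₂, rfl⟩ := h₂
    refine ⟨W₁ ⊔ W₂, inferInstance,
      PiTensorProduct.map (fun _ => Submodule.inclusion le_sup_left) z₁ +
        PiTensorProduct.map (fun _ => Submodule.inclusion le_sup_right) z₂, ?_⟩
    rw [map_add, ← LinearMap.comp_apply, ← LinearMap.comp_apply, ← PiTensorProduct.map_comp,
      ← PiTensorProduct.map_comp]
    rfl

/-- A tensor power of a positive definite form has trivial right kernel. A given tensor lies in the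
tensor power of a finite-dimensional subspace, where the form has an orthonormal basis. -/
theorem tensorForm_separating {ι : Type*} [Fintype ι] (B : V →ₗ⋆[ℂ] V →ₗ[ℂ] ℂ)
    (hsymm : ∀ x y, conj (B y x) = B x y) (hpos : ∀ x, 0 ≤ (B x x).re)
    (hdef : ∀ x, B x x = 0 → x = 0) (y : ⨂[ℂ] _ : ι, V) (hy : ∀ x, tensorForm B x y = 0) :
    y = 0 := by
  classical
  obtain ⟨W, _, y', rfl⟩ := exists_finiteDimensional_tensor y
  obtain ⟨n, b, hb⟩ := exists_orthonormal_basis (V := W)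
    ((B.domRestrict W).flip.domRestrict W).flip (fun x y => hsymm x y) (fun x => hpos x)
    (fun x hx => Subtype.ext (hdef x hx))
  let e := Basis.piTensorProduct fun _ : ι => b
  have he : ∀ k k' : ι → Fin n, tensorForm B (PiTensorProduct.map (fun _ => W.subtype) (e k))
      (PiTensorProduct.map (fun _ => W.subtype) (e k')) = if k = k' then 1 else 0 := by
    intro k k'
    simp only [e]
    rw [Basis.piTensorProduct_apply, Basis.piTensorProduct_apply, PiTensorProduct.map_tprod,
      PiTensorProduct.map_tprod, tensorForm_tprod]
    have : ∀ i, B (W.subtype (b (k i))) (W.subtype (b (k' i))) = if k i = k' i then 1 else 0 :=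
      fun i => hb _ _
    simp_rw [this, Fintype.prod_ite_zero, ← funext_iff, Finset.prod_const_one]
  have hy' : y' = 0 := by
    apply e.ext_elem
    intro k
    rw [map_zero, Finsupp.zero_apply, ← hy (PiTensorProduct.map (fun _ => W.subtype) (e k))]
    conv_rhs => rw [← e.sum_repr y']
    simp only [map_sum, map_smul, he, smul_eq_mul, mul_ite, mul_one, mul_zero]
    simp
  rw [hy', map_zero]

end Positive

namespace SpinModel

variable (M : SpinModel)

/-! ### Positivity of the Sklyanin form -/

theorem conj_muDen (x y : ℝ) : conj (M.muDen x (y * I)) = M.muDen x (y * I) := by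
  have h0 : ∀ z, conj (theta 0 0 z M.τ) = theta 0 0 (conj z) M.τ := fun z => M.conj_th 2 z
  have h1 : ∀ z, theta 0 0 (-z) M.τ = theta 0 0 z M.τ := fun z => by rw [theta_neg]; simp
  rw [muDen, map_prod, Finset.prod_congr rfl fun j _ => map_mul _ _ _, Finset.prod_mul_distrib,
    Finset.prod_mul_distrib]
  congr 1
  · refine Finset.prod_congr rfl fun j _ => ?_
    rw [h0]
    simp only [map_add, map_mul, map_sub, map_ofNat, conj_ofReal, map_natCast, map_one]
  -- conjugation permutes the factors depending on `y` by `j ↦ 2l + 1 - j`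
  · rw [← Finset.prod_range_reflect]
    refine Finset.prod_congr rfl fun j hj => ?_
    rw [h0, ← h1]
    have hj' : ((M.twoL + 2 - 1 - j : ℕ) : ℂ) = 2 * M.l + 1 - j := by
      rw [two_l_complex, Nat.cast_sub (by have := Finset.mem_range.mp hj; omega)]
      push_cast
      ring
    rw [hj']
    congr 1
    simp only [map_add, map_mul, map_sub, map_ofNat, conj_ofReal, conj_I, map_natCast, map_one]
    ring

/-- The denominator is real and has no zeros, and it is nonnegative at the origin, so it is positive
by connectedness of the plane. -/
theorem muDen_re_pos (x y : ℝ) : 0 < (M.muDen x (y * I)).re := by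
  have hre : ∀ x y : ℝ, ((M.muDen x (y * I)).re : ℂ) = M.muDen x (y * I) := fun x y =>
    Complex.conj_eq_iff_re.mp (M.conj_muDen x y)
  by_contra hneg
  have hc : Continuous fun p : ℝ × ℝ => (M.muDen p.1 (p.2 * I)).re :=
    Complex.continuous_re.comp M.continuous_muDen
  -- at the origin the denominator is the square of a real number
  have h0 : 0 ≤ (M.muDen (0 : ℝ) ((0 : ℝ) * I)).re := by
    have hr : ∀ r : ℝ, ((theta 0 0 r M.τ).re : ℂ) = theta 0 0 r M.τ := fun r =>
      Complex.conj_eq_iff_re.mp (by have := M.conj_th 2 r; rwa [conj_ofReal] at this)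
    have : M.muDen (0 : ℝ) ((0 : ℝ) * I) = ((∏ j ∈ Finset.range (M.twoL + 2),
        ((theta 0 0 (((2 * (j : ℝ) - 2 * M.l - 1) * M.η : ℝ) : ℂ) M.τ).re *
        (theta 0 0 (((2 * (j : ℝ) - 2 * M.l - 1) * M.η : ℝ) : ℂ) M.τ).re) : ℝ) : ℂ) := by
      rw [muDen]
      push_cast
      refine Finset.prod_congr rfl fun j _ => ?_
      have h := hr ((2 * (j : ℝ) - 2 * M.l - 1) * M.η)
      push_cast at h
      rw [h]
      simp
    rw [this, ofReal_re]
    exact Finset.prod_nonneg fun j _ => mul_self_nonneg _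
  obtain ⟨p, hp⟩ := mem_range_of_exists_le_of_exists_ge hc ⟨(x, y), not_lt.mp hneg⟩ ⟨(0, 0), h0⟩
  apply M.muDen_ne p.1 p.2
  rw [← hre, ofReal_eq_zero]
  exact hp

/-- The density of the Sklyanin form. -/
noncomputable def density (x y : ℝ) : ℝ := ‖M.den (x + y * I)‖ ^ 2 / (M.muDen x (y * I)).re

theorem density_eq (x y : ℝ) : M.μ (x + y * I) (conj (x + y * I : ℂ)) = (M.density x y : ℂ) := by
  have h1 : conj (x + y * I : ℂ) = x - y * I := by simp [sub_eq_add_neg]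
  have h2 : M.den (x - y * I) = conj (M.den (x + y * I)) := by
    have := M.conj_br (2 * (x + y * I))
    rw [map_mul, h1, map_ofNat] at this
    exact this.symm
  have h3 : ((M.muDen x (y * I)).re : ℂ) = M.muDen x (y * I) :=
    Complex.conj_eq_iff_re.mp (M.conj_muDen x y)
  rw [μ_eq, h2, Complex.mul_conj', density, ofReal_div, h3, ofReal_pow]

theorem sklyaninForm_eq (f g : M.V) : M.sklyaninForm f g =
    M.cellInt fun x y => conj (f.1 (x + y * I)) * g.1 (x + y * I) * M.density x y := by
  simp only [← density_eq]
  rfl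

theorem sklyaninForm_conj (f g : M.V) : conj (M.sklyaninForm g f) = M.sklyaninForm f g := by
  have hc : ∀ (k : ℝ → ℂ) (a b : ℝ), conj (∫ x in a..b, k x) = ∫ x in a..b, conj (k x) :=
    fun k a b => intervalIntegral.intervalIntegral_conj.symm
  rw [sklyaninForm_eq, sklyaninForm_eq, cellInt, cellInt, hc]
  refine intervalIntegral.integral_congr fun x _ => ?_
  rw [hc]
  refine intervalIntegral.integral_congr fun y _ => ?_
  simp only [map_mul, conj_conj, conj_ofReal]
  ring

theorem sklyaninForm_self (f : M.V) : M.sklyaninForm f f =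
    ((∫ x : ℝ in 0..1, ∫ y : ℝ in 0..M.t, ‖f.1 (x + y * I)‖ ^ 2 * M.density x y : ℝ) : ℂ) := by
  rw [sklyaninForm_eq, cellInt, ← intervalIntegral.integral_ofReal]
  refine intervalIntegral.integral_congr fun x _ => ?_
  rw [← intervalIntegral.integral_ofReal]
  refine intervalIntegral.integral_congr fun y _ => ?_
  rw [Complex.conj_mul', ofReal_mul, ofReal_pow]

theorem density_nonneg (x y : ℝ) : 0 ≤ M.density x y :=
  div_nonneg (by positivity) (M.muDen_re_pos x y).le

theorem sklyaninForm_nonneg (f : M.V) : 0 ≤ (M.sklyaninForm f f).re := by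
  rw [sklyaninForm_self, ofReal_re]
  refine intervalIntegral.integral_nonneg zero_le_one fun x _ =>
    intervalIntegral.integral_nonneg M.t_pos.le fun y _ => ?_
  exact mul_nonneg (by positivity) (M.density_nonneg x y)

/-- The integrand of `⟨f, f⟩` is continuous and nonnegative, so if the integral is zero then
`f(z) θ₁₁(2z)` vanishes on a period cell, and hence everywhere. -/
theorem eq_zero_of_sklyaninForm_self (f : M.V) (hf : M.sklyaninForm f f = 0) : f = 0 := by
  rw [sklyaninForm_self, ofReal_eq_zero] at hf
  have hnn : ∀ x y : ℝ, 0 ≤ ‖f.1 (x + y * I)‖ ^ 2 * M.density x y := fun x y =>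
    mul_nonneg (by positivity) (M.density_nonneg x y)
  have hcont : Continuous fun p : ℝ × ℝ => ‖f.1 (p.1 + p.2 * I)‖ ^ 2 * M.density p.1 p.2 := by
    refine Continuous.mul (((f.2.1.continuous.comp (by fun_prop)).norm).pow 2) ?_
    exact (((M.differentiable_den.continuous.comp (by fun_prop)).norm).pow 2).div
      (Complex.continuous_re.comp M.continuous_muDen) fun p => (M.muDen_re_pos _ _).ne'
  have hcy : ∀ x : ℝ, Continuous fun y : ℝ => ‖f.1 (x + y * I)‖ ^ 2 * M.density x y := fun x =>
    hcont.comp (Continuous.prodMk continuous_const continuous_id)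
  have hz : ∀ x ∈ Set.Icc (0 : ℝ) 1, ∀ y ∈ Set.Icc (0 : ℝ) M.t,
      ‖f.1 (x + y * I)‖ ^ 2 * M.density x y = 0 := by
    intro x hx y hy
    by_contra hne
    have hlt := lt_of_le_of_ne (hnn x y) (Ne.symm hne)
    have hi := intervalIntegral.integral_pos M.t_pos (hcy x).continuousOn (fun y _ => hnn x y)
      ⟨y, hy, hlt⟩
    have ho := intervalIntegral.integral_pos zero_lt_one
      (intervalIntegral.continuous_parametric_intervalIntegral_of_continuous'
        hcont 0 M.t).continuousOn
      (fun x _ => intervalIntegral.integral_nonneg M.t_pos.le fun y _ => hnn x y) ⟨x, hx, hi⟩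
    exact ho.ne' hf
  have hfd : ∀ z : ℂ, z.re ∈ Set.Icc (0 : ℝ) 1 → z.im ∈ Set.Icc (0 : ℝ) M.t →
      f.1 z * M.den z = 0 := by
    intro z h1 h2
    have := hz _ h1 _ h2
    rw [Complex.re_add_im, density] at this
    have hne := (M.muDen_re_pos z.re z.im).ne'
    rcases mul_eq_zero.mp this with h | h
    · rw [norm_eq_zero.mp (pow_eq_zero_iff two_ne_zero |>.mp h), zero_mul]
    · rw [div_eq_zero_iff, or_iff_left hne, Complex.re_add_im] at h
      rw [norm_eq_zero.mp (pow_eq_zero_iff two_ne_zero |>.mp h), mul_zero]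
  have han : AnalyticOnNhd ℂ (fun z => f.1 z * M.den z) Set.univ := fun z _ =>
    (f.2.1.mul M.differentiable_den).analyticAt z
  have hev : (fun z => f.1 z * M.den z) =ᶠ[nhds (1 / 2 + (M.t / 2 : ℝ) * I)] 0 := by
    have ht := M.t_pos
    have h1 : ∀ᶠ z : ℂ in nhds (1 / 2 + (M.t / 2 : ℝ) * I), z.re ∈ Set.Icc (0 : ℝ) 1 :=
      Complex.continuous_re.continuousAt.eventually_mem (Icc_mem_nhds (by simp) (by simp; norm_num))
    have h2 : ∀ᶠ z : ℂ in nhds (1 / 2 + (M.t / 2 : ℝ) * I), z.im ∈ Set.Icc (0 : ℝ) M.t :=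
      Complex.continuous_im.continuousAt.eventually_mem
        (Icc_mem_nhds (by simpa using ht) (by simpa using ht))
    filter_upwards [h1, h2] with z hz1 hz2 using hfd z hz1 hz2
  have hall := han.eqOn_zero_of_preconnected_of_eventuallyEq_zero isPreconnected_univ
    (Set.mem_univ _) hev
  refine Subtype.ext (eq_of_mul_eq f.2.1.continuous continuous_const M.deriv_den_ne fun z => ?_)
  exact (hall (Set.mem_univ z)).trans (zero_mul (M.den z)).symm

theorem form_separating (y : M.H) (hy : ∀ x, M.form x y = 0) : y = 0 :=
  tensorForm_separating M.sklyaninForm M.sklyaninForm_conj M.sklyaninForm_nonneg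
    M.eq_zero_of_sklyaninForm_self y hy

end SpinModel

/-! ### Expansion of the transfer matrix -/

/-- The entries of `X_{N-1} ⋯ X_0` as sums over the paths `j = m_0, m_1, …, m_N = i` of indices; the
path is `Fin.cons j k`. -/
theorem matrix_prod_reverse_ofFn {R ι : Type*} [Semiring R] [Fintype ι] [DecidableEq ι] {N : ℕ}
    (X : Fin N → Matrix ι ι R) (i j : ι) :
    (List.ofFn X).reverse.prod i j = ∑ k : Fin N → ι,
      if (Fin.cons j k : Fin (N + 1) → ι) (Fin.last N) = i then
        (List.ofFn fun n => X n ((Fin.cons j k : Fin (N + 1) → ι) n.succ)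
          ((Fin.cons j k : Fin (N + 1) → ι) n.castSucc)).reverse.prod else 0 := by
  induction N generalizing i with
  | zero => simp [Matrix.one_apply, eq_comm]
  | succ N ih =>
    rw [List.ofFn_succ', List.concat_eq_append, List.reverse_append, List.reverse_singleton,
      List.singleton_append, List.prod_cons, Matrix.mul_apply]
    rw [← (Fin.snocEquiv fun _ : Fin (N + 1) => ι).sum_comp, Fintype.sum_prod_type]
    have hs : ∀ (m : ι) (k : Fin N → ι), (Fin.snocEquiv fun _ : Fin (N + 1) => ι) (m, k) =
      (Fin.snoc k m : Fin (N + 1) → ι) := fun m k => rfl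
    have hc : ∀ (m : ι) (k : Fin N → ι), (Fin.cons j (Fin.snoc k m : Fin (N + 1) → ι) :
        Fin (N + 2) → ι) = (Fin.snoc (Fin.cons j k : Fin (N + 1) → ι) m : Fin (N + 2) → ι) :=
      fun m k => Fin.cons_snoc_eq_snoc_cons _ _ _
    simp only [ih, Finset.mul_sum, hs, hc, Fin.snoc_last, ← Fin.castSucc_succ,
      List.ofFn_succ', List.concat_eq_append, List.reverse_append, List.reverse_singleton,
      List.singleton_append, List.prod_cons, Fin.succ_last, Fin.snoc_castSucc]
    rw [Finset.sum_comm, Finset.sum_comm (γ := ι)]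
    refine Finset.sum_congr rfl fun k _ => ?_
    simp

/-- The trace of `X_{N-1} ⋯ X_0` as a sum over closed paths; `(finRotate N).symm n` is the cyclic
predecessor of the site `n`. -/
theorem trace_prod_reverse_ofFn {R ι : Type*} [Semiring R] [Fintype ι] [DecidableEq ι] {N : ℕ}
    (hN : 0 < N) (X : Fin N → Matrix ι ι R) :
    Matrix.trace (List.ofFn X).reverse.prod = ∑ k : Fin N → ι,
      (List.ofFn fun n => X n (k n) (k ((finRotate N).symm n))).reverse.prod := by
  obtain ⟨N, rfl⟩ := Nat.exists_eq_succ_of_ne_zero hN.ne'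
  simp only [Matrix.trace, Matrix.diag_apply, matrix_prod_reverse_ofFn]
  rw [Finset.sum_comm]
  refine Finset.sum_congr rfl fun k _ => ?_
  have hlast : ∀ i : ι, (Fin.cons i k : Fin (N + 2) → ι) (Fin.last (N + 1)) = k (Fin.last N) :=
    fun i => by rw [← Fin.succ_last, Fin.cons_succ]
  simp only [Nat.succ_eq_add_one, hlast, Finset.sum_ite_eq, Finset.mem_univ, if_true, Fin.cons_succ]
  congr 3
  funext n
  congr 1
  refine Fin.cases ?_ (fun m => ?_) n
  · have : (finRotate (N + 1)).symm 0 = Fin.last N := by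
      rw [Equiv.symm_apply_eq, finRotate_last]
    rw [this]
    rfl
  · have : (finRotate (N + 1)).symm m.succ = m.castSucc := by
      rw [Equiv.symm_apply_eq, finRotate_apply, Fin.coeSucc_eq_succ]
    rw [this, ← Fin.succ_castSucc, Fin.cons_succ]

namespace SpinModel

variable (M : SpinModel)

theorem prod_site (A : Fin M.N → Module.End ℂ M.V) (l : List (Fin M.N)) (hl : l.Nodup) :
    (l.map fun n => M.site n (A n)).prod =
      PiTensorProduct.map fun n => if n ∈ l then A n else LinearMap.id := by
  induction l with
  | nil =>
    simp only [List.map_nil, List.prod_nil, List.not_mem_nil, if_false]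
    exact PiTensorProduct.map_id.symm
  | cons m l ih =>
    rw [List.nodup_cons] at hl
    rw [List.map_cons, List.prod_cons, ih hl.2, site, ← PiTensorProduct.map_mul]
    congr 1
    funext n
    by_cases h : n = m
    · subst h
      simp [hl.1]
      rfl
    · simp [h]
      rfl

/-- The entries of the local `L`-operator, as operators on the local space. -/
noncomputable def ell (u : ℂ) (i j : Fin 2) : Module.End ℂ M.V :=
  ∑ a, (M.W a u * pauli a i j) • M.rho a

theorem L_apply (n : Fin M.N) (u : ℂ) (i j : Fin 2) : M.L n u i j = M.site n (M.ell u i j) := by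
  have h : ∀ A, M.site n A = (PiTensorProduct.mapMultilinear ℂ (fun _ : Fin M.N => M.V)
      (fun _ => M.V)).toLinearMap (fun _ => LinearMap.id) n A := fun A => rfl
  rw [L, Matrix.of_apply, h, ell, map_sum]
  refine Finset.sum_congr rfl fun a _ => ?_
  rw [map_smul, h]

/-- The transfer matrix as a sum over the states of the auxiliary spaces between the sites. -/
theorem T_eq_sum (u : ℂ) : M.T u = ∑ k : Fin M.N → Fin 2,
    PiTensorProduct.map fun n => M.ell u (k n) (k ((finRotate M.N).symm n)) := by
  rw [T, trace_prod_reverse_ofFn M.N_pos]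
  refine Finset.sum_congr rfl fun k _ => ?_
  simp only [L_apply]
  rw [List.ofFn_eq_map, ← List.map_reverse,
    M.prod_site (fun n => M.ell u (k n) (k ((finRotate M.N).symm n))) _
      (List.nodup_reverse.mpr (List.nodup_finRange _))]
  simp

end SpinModel

/-! ### The adjoint of the transfer matrix -/

section Adjoint

variable {V W : Type*} [AddCommMonoid V] [Module ℂ V] [AddCommMonoid W] [Module ℂ W]
  {B : V →ₗ⋆[ℂ] V →ₗ[ℂ] ℂ} {C : W →ₗ⋆[ℂ] W →ₗ[ℂ] ℂ}

theorem IsAdjoint.smul {f : V →ₗ[ℂ] W} {g : W →ₗ[ℂ] V} (h : IsAdjoint B C f g) (c : ℂ) :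
    IsAdjoint B C (c • f) (conj c • g) := fun x y => by
  simp [h x y]

theorem IsAdjoint.add {f f' : V →ₗ[ℂ] W} {g g' : W →ₗ[ℂ] V} (h : IsAdjoint B C f g)
    (h' : IsAdjoint B C f' g') : IsAdjoint B C (f + f') (g + g') := fun x y => by
  simp [h x y, h' x y]

theorem IsAdjoint.sum {α : Type*} (s : Finset α) {f : α → V →ₗ[ℂ] W} {g : α → W →ₗ[ℂ] V}
    (h : ∀ a ∈ s, IsAdjoint B C (f a) (g a)) : IsAdjoint B C (∑ a ∈ s, f a) (∑ a ∈ s, g a) :=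
  fun x y => by
    simp only [LinearMap.sum_apply, map_sum]
    exact Finset.sum_congr rfl fun a ha => h a ha x y

theorem IsAdjoint.comp {U : Type*} [AddCommMonoid U] [Module ℂ U] {D : U →ₗ⋆[ℂ] U →ₗ[ℂ] ℂ}
    {f : V →ₗ[ℂ] W} {g : W →ₗ[ℂ] V} {f' : W →ₗ[ℂ] U} {g' : U →ₗ[ℂ] W} (h : IsAdjoint B C f g)
    (h' : IsAdjoint C D f' g') : IsAdjoint B D (f' ∘ₗ f) (g ∘ₗ g') := fun x y => by
  rw [LinearMap.comp_apply, LinearMap.comp_apply, h', h]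

theorem IsAdjoint.tensorMap {ι : Type*} [Fintype ι] {f g : ι → Module.End ℂ V}
    (h : ∀ i, IsAdjoint B B (f i) (g i)) :
    IsAdjoint (tensorForm B) (tensorForm B) (PiTensorProduct.map f) (PiTensorProduct.map g) := by
  intro x y
  induction x using PiTensorProduct.induction_on with
  | add x x' hx hx' => simp only [map_add, LinearMap.add_apply, hx, hx']
  | smul_tprod c x =>
    induction y using PiTensorProduct.induction_on with
    | add y y' hy hy' => simp only [map_add, hy, hy']
    | smul_tprod d y =>
      simp only [map_smul, LinearMap.map_smulₛₗ, LinearMap.smul_apply, PiTensorProduct.map_tprod,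
        tensorForm_tprod, h _ _ _]

end Adjoint

namespace SpinModel

variable (M : SpinModel)

/-- The adjoint of an entry of the local `L`-operator. The matrices `σ^a` with conjugated entries
are conjugate by `σ²` to `-σ^a`, except for `a = 0`, which is the index of the one odd theta
function. -/
theorem isAdjoint_ell (u : ℂ) (i j : Fin 2) :
    IsAdjoint M.sklyaninForm M.sklyaninForm (M.ell u i j)
      ((-((![1, -1] : Fin 2 → ℂ) i * (![1, -1] : Fin 2 → ℂ) j)) •
        M.ell (-conj u) i.rev j.rev) := by
  have h : IsAdjoint M.sklyaninForm M.sklyaninForm (M.ell u i j)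
      (∑ a, conj (M.W a u * pauli a i j) • M.rho a) :=
    IsAdjoint.sum _ fun a _ => (M.isAdjoint_rho a).smul _
  convert h using 1
  rw [ell, Finset.smul_sum]
  refine Finset.sum_congr rfl fun a _ => ?_
  rw [smul_smul]
  congr 1
  have hp : conj (pauli a i j) = -((![1, -1] : Fin 2 → ℂ) i * (![1, -1] : Fin 2 → ℂ) j) *
      (![-1, 1, 1, 1] : Fin 4 → ℂ) a * pauli a i.rev j.rev := by
    fin_cases a <;> fin_cases i <;> fin_cases j <;> simp [pauli]
  rw [map_mul, hp, W, W, th_neg, map_div₀, conj_th, conj_th, conj_ofReal]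
  ring

/-- The operator `T(u)` has the adjoint `(-1)^N T(-conj u)`. Transposition of the Pauli matrices is
undone by conjugation with `σ²`, which exchanges the two states of the auxiliary space. -/
theorem isAdjoint_T (u : ℂ) :
    IsAdjoint M.form M.form (M.T u) ((-1 : ℂ) ^ M.N • M.T (-conj u)) := by
  have h : IsAdjoint M.form M.form _ _ :=
    IsAdjoint.sum (Finset.univ : Finset (Fin M.N → Fin 2)) fun k _ =>
      IsAdjoint.tensorMap fun n => M.isAdjoint_ell u (k n) (k ((finRotate M.N).symm n))
  rw [← T_eq_sum] at h
  convert h using 1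
  rw [T_eq_sum, Finset.smul_sum,
    ← (Equiv.arrowCongr (Equiv.refl (Fin M.N)) (Fin.revPerm (n := 2))).sum_comp]
  refine Finset.sum_congr rfl fun k _ => ?_
  -- each site contributes `-ε_k ε_{k-1}`, where `k - 1` is the preceding site; the signs `ε`
  -- cancel in pairs around the cycle
  have hs := (PiTensorProduct.mapMultilinear ℂ (fun _ : Fin M.N => M.V)
    (fun _ => M.V)).map_smul_univ
    (fun n => -((![1, -1] : Fin 2 → ℂ) (k n) *
      (![1, -1] : Fin 2 → ℂ) (k ((finRotate M.N).symm n))))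
    (fun n => M.ell (-conj u) (k n).rev (k ((finRotate M.N).symm n)).rev)
  simp only [PiTensorProduct.mapMultilinear_apply] at hs
  rw [hs]
  congr 1
  have hsq : ∀ i : Fin 2, (![1, -1] : Fin 2 → ℂ) i * (![1, -1] : Fin 2 → ℂ) i = 1 := by
    intro i; fin_cases i <;> simp
  rw [Finset.prod_neg, Finset.card_univ, Fintype.card_fin, Finset.prod_mul_distrib,
    (finRotate M.N).symm.prod_comp (fun n => (![1, -1] : Fin 2 → ℂ) (k n)),
    ← Finset.prod_mul_distrib]
  simp [hsq]

/-- The adjoint of `T(u)` is unique because the form is separating. -/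
theorem isAdjoint_T_iff (u : ℂ) (A : Module.End ℂ M.H) :
    IsAdjoint M.form M.form (M.T u) A ↔ A = (-1 : ℂ) ^ M.N • M.T (-conj u) := by
  constructor
  · intro h
    refine LinearMap.ext fun y => sub_eq_zero.mp (M.form_separating _ fun x => ?_)
    rw [map_sub, ← h, ← M.isAdjoint_T, sub_self]
  · rintro rfl
    exact M.isAdjoint_T u

end SpinModel

/-! ### Gauge invariance of cyclic tensor sums -/

/-- A cyclic sum of a multilinear map over matrix entries does not change when the matrices
undergo a gauge transformation `x_n ↦ G_n⁻¹ x_n G_{σ n}`. -/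
theorem sum_gauge {α ι X Y : Type*} [Fintype α] [DecidableEq α] [Fintype ι] [DecidableEq ι]
    [AddCommMonoid X] [Module ℂ X] [AddCommMonoid Y] [Module ℂ Y]
    (f : MultilinearMap ℂ (fun _ : α => X) Y) (σ : Equiv.Perm α) (G G' : α → Matrix ι ι ℂ)
    (hG : ∀ n, G n * G' n = 1) (x : α → ι → ι → X) :
    ∑ k : α → ι, f (fun n => ∑ p : ι × ι,
      (G' n (k n) p.1 * G (σ n) p.2 (k (σ n))) • x n p.1 p.2) =
      ∑ k : α → ι, f fun n => x n (k n) (k (σ n)) := by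
  -- expand, and collect at each `n` the factors which contain `k n`
  have h1 : ∀ k : α → ι, f (fun n => ∑ p : ι × ι,
      (G' n (k n) p.1 * G (σ n) p.2 (k (σ n))) • x n p.1 p.2) =
      ∑ r : α → ι × ι, (∏ n, G n (r (σ.symm n)).2 (k n) * G' n (k n) (r n).1) •
        f (fun n => x n (r n).1 (r n).2) := by
    intro k
    rw [f.map_sum]
    refine Finset.sum_congr rfl fun r _ => ?_
    rw [f.map_smul_univ]
    congr 1
    rw [Finset.prod_mul_distrib, Finset.prod_mul_distrib, mul_comm]
    congr 1
    rw [← Equiv.prod_comp σ fun n => G n (r (σ.symm n)).2 (k n)]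
    simp
  -- the sum over `k` contracts adjacent factors, `G n * G' n = 1`
  have h2 : ∀ r : α → ι × ι, ∑ k : α → ι, ∏ n, G n (r (σ.symm n)).2 (k n) * G' n (k n) (r n).1 =
      if ∀ n, (r (σ.symm n)).2 = (r n).1 then 1 else 0 := by
    intro r
    rw [← Fintype.prod_sum fun n m => G n (r (σ.symm n)).2 m * G' n m (r n).1]
    simp_rw [← Matrix.mul_apply, hG, Matrix.one_apply, Fintype.prod_ite_zero,
      Finset.prod_const_one]
  simp_rw [h1]
  rw [Finset.sum_comm]
  simp_rw [← Finset.sum_smul, h2, ite_smul, one_smul, zero_smul]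
  rw [← Finset.sum_filter]
  refine Finset.sum_bij' (fun r _ n => (r n).1) (fun k _ n => (k n, k (σ n))) (by simp)
    (by simp) ?_ (by simp) ?_
  · intro r hr
    funext n
    have := (Finset.mem_filter.mp hr).2 (σ n)
    rw [Equiv.symm_apply_apply] at this
    exact Prod.ext rfl this.symm
  · intro r hr
    congr 1
    funext n
    have := (Finset.mem_filter.mp hr).2 (σ n)
    rw [Equiv.symm_apply_apply] at this
    rw [this]

open scoped Fin.NatCast in
/-- For upper triangular matrices a cyclic tensor sum reduces to the two diagonal terms. -/
theorem sum_triangular {N : ℕ} (hN : 0 < N) {X Y : Type*} [AddCommMonoid X] [Module ℂ X]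
    [AddCommMonoid Y] [Module ℂ Y] (f : MultilinearMap ℂ (fun _ : Fin N => X) Y)
    (x : Fin N → Fin 2 → Fin 2 → X) (hx : ∀ n, x n 1 0 = 0) :
    ∑ k : Fin N → Fin 2, f (fun n => x n (k n) (k ((finRotate N).symm n))) =
      f (fun n => x n 0 0) + f (fun n => x n 1 1) := by
  obtain ⟨N, rfl⟩ := Nat.exists_eq_succ_of_ne_zero hN.ne'
  rw [Finset.sum_eq_add_of_mem (fun _ => 0) (fun _ => 1) (Finset.mem_univ _) (Finset.mem_univ _)]
  · intro h
    exact zero_ne_one (congrFun h 0)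
  · rintro k - ⟨h0, h1⟩
    by_contra hne
    -- in a nonzero term a zero propagates around the whole cycle
    have hstep : ∀ n, k n = 0 → k (n + 1) = 0 := by
      intro n hn
      by_contra h
      refine hne (f.map_coord_zero (n + 1) ?_)
      rw [← finRotate_apply, Equiv.symm_apply_apply, hn, finRotate_apply]
      rw [show k (n + 1) = 1 by omega, hx]
    obtain ⟨n₀, hn₀⟩ := Function.ne_iff.mp h1
    have hz : ∀ m : ℕ, k (n₀ + (m : Fin (N + 1))) = 0 := by
      intro m
      induction m with
      | zero => rw [Nat.cast_zero, add_zero]; omega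
      | succ m ih => rw [Nat.cast_succ, ← add_assoc]; exact hstep _ ih
    refine h0 (funext fun n => ?_)
    have := hz (n - n₀).val
    rwa [Fin.cast_val_eq_self, add_sub_cancel] at this

namespace SpinModel

variable (M : SpinModel)

/-! ### The local relations -/

/-- The vector `(θ₀₀(x, τ/2), -θ₀₁(x, τ/2))`. -/
noncomputable def colVec (x : ℂ) : Fin 2 → ℂ := ![M.thB x, -M.thA x]

/-- The vector `(θ₀₁(x, τ/2), θ₀₀(x, τ/2))`. -/
noncomputable def rowVec (x : ℂ) : Fin 2 → ℂ := ![M.thA x, M.thB x]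

theorem rowVec_colVec (x y : ℂ) :
    ∑ b, M.rowVec x b * M.colVec y b = 2 * (M.br (x + y) * M.br (x - y)) := by
  rw [br_add_mul_br_sub, Fin.sum_univ_two]
  simp [rowVec, colVec]
  ring

theorem colVec_plucker (x y z : ℂ) (a : Fin 2) :
    M.colVec x a * (M.br (y + z) * M.br (y - z)) - M.colVec y a * (M.br (x + z) * M.br (x - z)) =
      M.colVec z a * (M.br (y + x) * M.br (y - x)) := by
  simp only [br_add_mul_br_sub]
  fin_cases a <;> simp [colVec] <;> ring

theorem rowVec_plucker (x y z : ℂ) (a : Fin 2) :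
    M.rowVec x a * (M.br (y + z) * M.br (y - z)) - M.rowVec y a * (M.br (x + z) * M.br (x - z)) =
      M.rowVec z a * (M.br (y + x) * M.br (y - x)) := by
  simp only [br_add_mul_br_sub]
  fin_cases a <;> simp [rowVec] <;> ring

/-- The matrix of theta functions in the `L`-operator has rank one. -/
theorem sum_th_pauli (u y : ℂ) (i j : Fin 2) :
    ∑ a, (![1, 1, I, 1] : Fin 4 → ℂ) a * M.th a u * M.th a y * pauli a i j =
      M.colVec ((u - y) / 2) i * M.rowVec ((u + y) / 2) j := by
  have h1 := M.th_two_add_th_one u y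
  have h2 := M.th_two_sub_th_one u y
  have h3 := M.th_three_add_th_zero u y
  have h4 := M.th_three_sub_th_zero u y
  rw [Fin.sum_univ_four]
  fin_cases i <;> fin_cases j <;> simp [pauli, colVec, rowVec]
  · linear_combination h3
  · linear_combination h1 - M.th 2 u * M.th 2 y * I_mul_I
  · linear_combination -h2 + M.th 2 u * M.th 2 y * I_mul_I
  · linear_combination -h4

theorem V_ext {f g : M.V} (h : ∀ z, f.1 z * M.den z = g.1 z * M.den z) : f = g :=
  Subtype.ext (eq_of_mul_eq f.2.1.continuous g.2.1.continuous M.deriv_den_ne h)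

/-- The zeros of the theta functions with real part in `(-1/2, 1/2)` are the `nτ` for `a = 0` and
the `(n + 1/2)τ` for `a = 3`, and none of them is the real number `η ≠ 0`. -/
theorem th_η_ne (a : Fin 4) : M.th a M.η ≠ 0 := by
  intro h
  obtain ⟨m, n, h⟩ := M.th_eq_zero a h
  have h1 := abs_lt.mp (M.abs_η_lt.trans_le (b := 1 / (2 * (2 * M.l + 1))) (c := 1 / 2) (by
    rw [M.two_l]
    refine one_div_le_one_div_of_le (by norm_num) ?_
    have : (0 : ℝ) ≤ M.twoL := Nat.cast_nonneg _
    linarith))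
  have key : ∀ p q : ℝ, (M.η : ℂ) = p + q * M.τ → q = 0 ∧ M.η = p := by
    intro p q hpq
    have hre := congrArg Complex.re hpq
    have him := congrArg Complex.im hpq
    simp only [τ, ofReal_re, ofReal_im, add_re, add_im, mul_re, mul_im, I_re, I_im] at hre him
    have hq : q * M.t = 0 := by linarith
    exact ⟨(mul_eq_zero.mp hq).resolve_right M.t_pos.ne', by linarith⟩
  have h2 := key ((1 - ((char a).2 : ℝ)) / 2 + m) ((1 - ((char a).1 : ℝ)) / 2 + n) (by
    rw [h]; push_cast; ring)
  have hhalf : ∀ n : ℤ, (1 : ℝ) / 2 + n ≠ 0 := fun n hn => by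
    have : (1 + 2 * n : ℝ) = 0 := by linarith
    have : (1 + 2 * n : ℤ) = 0 := by exact_mod_cast this
    omega
  have hint : ∀ x : ℝ, |x| < 1 / 2 → ∀ m : ℤ, x ≠ 1 / 2 + m := fun x hx m hm => by
    rw [hm, abs_lt] at hx
    have h4 : (-1 : ℤ) < m := by exact_mod_cast (by linarith [hx.1] : (-1 : ℝ) < m)
    have h5 : m < 0 := by exact_mod_cast (by linarith [hx.2] : (m : ℝ) < 0)
    omega
  have hzero : ∀ m : ℤ, M.η = m → False := fun m hm => by
    rw [hm] at h1
    have h4 : (-1 : ℤ) < m := by exact_mod_cast (by linarith [h1.1] : (-1 : ℝ) < m)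
    have h5 : m < 1 := by exact_mod_cast (by linarith [h1.2] : (m : ℝ) < 1)
    obtain rfl : m = 0 := by omega
    exact M.η_ne_zero (by simpa using hm)
  fin_cases a
  · exact hzero m (by simpa [char] using h2.2)
  · exact hint M.η (abs_lt.mpr h1) m (by simpa [char] using h2.2)
  · exact hhalf n (by simpa [char] using h2.1)
  · exact hhalf n (by simpa [char] using h2.1)

theorem ell_apply_mul_den (u : ℂ) (i j : Fin 2) (f : M.V) (z : ℂ) :
    (M.ell u i j f).1 z * M.den z =
      M.colVec (u / 2 - z + M.l * M.η) i * M.rowVec (u / 2 + z - M.l * M.η) j * f.1 (z + M.η) -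
      M.colVec (u / 2 + z + M.l * M.η) i * M.rowVec (u / 2 - z - M.l * M.η) j * f.1 (z - M.η) := by
  have h : (M.ell u i j f).1 z = ∑ a, M.W a u * pauli a i j * M.rhoFun a f z := by
    rw [ell, LinearMap.sum_apply, Submodule.coe_sum, Finset.sum_apply]
    rfl
  have h1 := M.sum_th_pauli u (2 * (z - M.l * M.η)) i j
  have h2 := M.sum_th_pauli u (2 * (-z - M.l * M.η)) i j
  rw [show (u - 2 * (z - M.l * M.η)) / 2 = u / 2 - z + M.l * M.η by ring,
    show (u + 2 * (z - M.l * M.η)) / 2 = u / 2 + z - M.l * M.η by ring] at h1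
  rw [show (u - 2 * (-z - M.l * M.η)) / 2 = u / 2 + z + M.l * M.η by ring,
    show (u + 2 * (-z - M.l * M.η)) / 2 = u / 2 - z - M.l * M.η by ring] at h2
  rw [h, ← h1, ← h2, Finset.sum_mul, Finset.sum_mul, Finset.sum_mul, ← Finset.sum_sub_distrib]
  refine Finset.sum_congr rfl fun a _ => ?_
  have hn := M.rhoFun_mul_den a f z
  rw [num, s, s] at hn
  have hη : M.W a u * M.th a M.η = M.th a u := div_mul_cancel₀ _ (M.th_η_ne a)
  rw [mul_assoc, hn, ← hη]
  ring

/-- The factors common to the values at `z ± η` of a product vector. -/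
noncomputable def fvecCore (c z : ℂ) : ℂ :=
  ∏ j ∈ Finset.range (M.twoL - 1), (M.br (z + c + (2 - M.l + 2 * j) * M.η) *
    M.br (-z + c + (2 - M.l + 2 * j) * M.η))

theorem prod_br_shift_add (c z : ℂ) :
    ∏ j ∈ Finset.range M.twoL, M.br (z + (c + (-M.l + 1) * M.η + 2 * j * M.η) + M.η) =
      (∏ j ∈ Finset.range (M.twoL - 1), M.br (z + c + (2 - M.l + 2 * j) * M.η)) *
        M.br (z + c + 3 * M.l * M.η) := by
  obtain ⟨n, hn⟩ := Nat.exists_eq_succ_of_ne_zero M.twoL_pos.ne'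
  have h2 : 2 * (M.l : ℂ) = n + 1 := by rw [two_l_complex, hn]; push_cast; ring
  rw [hn, Finset.prod_range_succ]
  congr 1
  · refine Finset.prod_congr rfl fun j _ => ?_
    congr 1; ring
  · congr 1
    linear_combination (-2 * M.η) * h2

theorem prod_br_shift_sub (c z : ℂ) :
    ∏ j ∈ Finset.range M.twoL, M.br (z + (c + (-M.l + 1) * M.η + 2 * j * M.η) - M.η) =
      (∏ j ∈ Finset.range (M.twoL - 1), M.br (z + c + (2 - M.l + 2 * j) * M.η)) *
        M.br (z + c - M.l * M.η) := by
  obtain ⟨n, hn⟩ := Nat.exists_eq_succ_of_ne_zero M.twoL_pos.ne'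
  rw [hn, Finset.prod_range_succ']
  congr 1
  · refine Finset.prod_congr rfl fun j _ => ?_
    congr 1; push_cast; ring
  · congr 1
    push_cast; ring

section fvec

variable (ε : ℤ) (lam u z : ℂ)

theorem fvecFun_add : M.fvecFun ε lam u (z + M.η) = M.fvecCore ((ε * lam + u) / 2) z *
    (M.br (z + (ε * lam + u) / 2 + 3 * M.l * M.η) *
      M.br (-z + (ε * lam + u) / 2 - M.l * M.η)) := by
  rw [fvecFun_eq, Finset.prod_mul_distrib, fvecCore, Finset.prod_mul_distrib, mul_mul_mul_comm,
    ← prod_br_shift_add, ← prod_br_shift_sub]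
  congr 1 <;> refine Finset.prod_congr rfl fun j _ => ?_ <;> congr 1 <;> ring

theorem fvecFun_sub : M.fvecFun ε lam u (z - M.η) = M.fvecCore ((ε * lam + u) / 2) z *
    (M.br (z + (ε * lam + u) / 2 - M.l * M.η) *
      M.br (-z + (ε * lam + u) / 2 + 3 * M.l * M.η)) := by
  rw [fvecFun_eq, Finset.prod_mul_distrib, fvecCore, Finset.prod_mul_distrib, mul_mul_mul_comm,
    ← prod_br_shift_add, ← prod_br_shift_sub]
  congr 1 <;> refine Finset.prod_congr rfl fun j _ => ?_ <;> congr 1 <;> ring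

theorem fvecFun_sub_two : M.fvecFun ε lam (u - 2 * M.η) z = M.fvecCore ((ε * lam + u) / 2) z *
    (M.br (z + (ε * lam + u) / 2 - M.l * M.η) *
      M.br (-z + (ε * lam + u) / 2 - M.l * M.η)) := by
  rw [fvecFun_eq, Finset.prod_mul_distrib, fvecCore, Finset.prod_mul_distrib, mul_mul_mul_comm,
    ← prod_br_shift_sub, ← prod_br_shift_sub]
  congr 1 <;> refine Finset.prod_congr rfl fun j _ => ?_ <;> congr 1 <;> ring

theorem fvecFun_add_two : M.fvecFun ε lam (u + 2 * M.η) z = M.fvecCore ((ε * lam + u) / 2) z *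
    (M.br (z + (ε * lam + u) / 2 + 3 * M.l * M.η) *
      M.br (-z + (ε * lam + u) / 2 + 3 * M.l * M.η)) := by
  rw [fvecFun_eq, Finset.prod_mul_distrib, fvecCore, Finset.prod_mul_distrib, mul_mul_mul_comm,
    ← prod_br_shift_add, ← prod_br_shift_add]
  congr 1 <;> refine Finset.prod_congr rfl fun j _ => ?_ <;> congr 1 <;> ring

/-- The local `L`-operator on the product vectors maps the column vector at `ελ/2` to the one at
`ελ/2 + 2lη`. The pairings of the rows of the rank-one matrices with the column vector complete the
products `f_ε` to common ones, and the Plücker relation adds the two terms. -/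
theorem ell_fvec_col (i : Fin 2) :
    ∑ b, M.colVec (ε * lam / 2) b • M.ell u i b (M.fvec ε lam u) =
      (2 * M.br (u + 2 * M.l * M.η) * M.colVec (ε * lam / 2 + 2 * M.l * M.η) i) •
        M.fvec ε lam (u - 2 * M.η) := by
  refine M.V_ext fun z => ?_
  have h1 : (∑ b, M.colVec (ε * lam / 2) b • M.ell u i b (M.fvec ε lam u)).1 z * M.den z =
      ∑ b, M.colVec (ε * lam / 2) b * ((M.ell u i b (M.fvec ε lam u)).1 z * M.den z) := by
    rw [Submodule.coe_sum, Finset.sum_apply, Finset.sum_mul]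
    exact Finset.sum_congr rfl fun b _ => mul_assoc _ _ _
  change _ = (2 * M.br (u + 2 * M.l * M.η) * M.colVec (ε * lam / 2 + 2 * M.l * M.η) i) *
    M.fvecFun ε lam (u - 2 * M.η) z * M.den z
  have e1 : (M.fvec ε lam u).1 (z + M.η) = M.fvecFun ε lam u (z + M.η) := rfl
  have e2 : (M.fvec ε lam u).1 (z - M.η) = M.fvecFun ε lam u (z - M.η) := rfl
  have r1 := M.rowVec_colVec (u / 2 + z - M.l * M.η) (ε * lam / 2)
  have r2 := M.rowVec_colVec (u / 2 - z - M.l * M.η) (ε * lam / 2)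
  have p := M.colVec_plucker (u / 2 - z + M.l * M.η) (u / 2 + z + M.l * M.η)
    (ε * lam / 2 + 2 * M.l * M.η) i
  rw [h1]
  simp only [ell_apply_mul_den, e1, e2]
  rw [fvecFun_add, fvecFun_sub, fvecFun_sub_two, den, ← br]
  rw [Fin.sum_univ_two] at r1 r2 ⊢
  rw [show u / 2 + z - M.l * M.η + ε * lam / 2 = z + (ε * lam + u) / 2 - M.l * M.η by ring,
    show u / 2 + z - M.l * M.η - ε * lam / 2 =
      u / 2 + z + M.l * M.η - (ε * lam / 2 + 2 * M.l * M.η) by ring] at r1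
  rw [show u / 2 - z - M.l * M.η + ε * lam / 2 = -z + (ε * lam + u) / 2 - M.l * M.η by ring,
    show u / 2 - z - M.l * M.η - ε * lam / 2 =
      u / 2 - z + M.l * M.η - (ε * lam / 2 + 2 * M.l * M.η) by ring] at r2
  rw [show u / 2 + z + M.l * M.η + (ε * lam / 2 + 2 * M.l * M.η) =
      z + (ε * lam + u) / 2 + 3 * M.l * M.η by ring,
    show u / 2 - z + M.l * M.η + (ε * lam / 2 + 2 * M.l * M.η) =
      -z + (ε * lam + u) / 2 + 3 * M.l * M.η by ring,
    show u / 2 + z + M.l * M.η + (u / 2 - z + M.l * M.η) = u + 2 * M.l * M.η by ring,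
    show u / 2 + z + M.l * M.η - (u / 2 - z + M.l * M.η) = 2 * z by ring] at p
  generalize M.br (z + (ε * lam + u) / 2 + 3 * M.l * M.η) = q1 at *
  generalize M.br (-z + (ε * lam + u) / 2 + 3 * M.l * M.η) = q2 at *
  generalize M.br (z + (ε * lam + u) / 2 - M.l * M.η) = q3 at *
  generalize M.br (-z + (ε * lam + u) / 2 - M.l * M.η) = q4 at *
  generalize M.fvecCore ((ε * lam + u) / 2) z = q5 at *
  generalize M.colVec (u / 2 - z + M.l * M.η) i = q6 at *
  generalize M.colVec (u / 2 + z + M.l * M.η) i = q7 at *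
  linear_combination q5 * q1 * q4 * q6 * r1 - q5 * q3 * q2 * q7 * r2 + 2 * q5 * q3 * q4 * p

/-- The dual of `ell_fvec_col`: from the left, the row vector at `ελ/2 + 2lη` is mapped to the one
at `ελ/2`. -/
theorem ell_fvec_row (j : Fin 2) :
    ∑ a, M.rowVec (ε * lam / 2 + 2 * M.l * M.η) a • M.ell u a j (M.fvec ε lam u) =
      (2 * M.br (u - 2 * M.l * M.η) * M.rowVec (ε * lam / 2) j) •
        M.fvec ε lam (u + 2 * M.η) := by
  refine M.V_ext fun z => ?_
  have h1 : (∑ a, M.rowVec (ε * lam / 2 + 2 * M.l * M.η) a •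
      M.ell u a j (M.fvec ε lam u)).1 z * M.den z =
      ∑ a, M.rowVec (ε * lam / 2 + 2 * M.l * M.η) a *
        ((M.ell u a j (M.fvec ε lam u)).1 z * M.den z) := by
    rw [Submodule.coe_sum, Finset.sum_apply, Finset.sum_mul]
    exact Finset.sum_congr rfl fun b _ => mul_assoc _ _ _
  change _ = (2 * M.br (u - 2 * M.l * M.η) * M.rowVec (ε * lam / 2) j) *
    M.fvecFun ε lam (u + 2 * M.η) z * M.den z
  have e1 : (M.fvec ε lam u).1 (z + M.η) = M.fvecFun ε lam u (z + M.η) := rfl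
  have e2 : (M.fvec ε lam u).1 (z - M.η) = M.fvecFun ε lam u (z - M.η) := rfl
  have r1 := M.rowVec_colVec (ε * lam / 2 + 2 * M.l * M.η) (u / 2 - z + M.l * M.η)
  have r2 := M.rowVec_colVec (ε * lam / 2 + 2 * M.l * M.η) (u / 2 + z + M.l * M.η)
  have p := M.rowVec_plucker (u / 2 - z - M.l * M.η) (u / 2 + z - M.l * M.η) (ε * lam / 2) j
  rw [h1]
  simp only [ell_apply_mul_den, e1, e2]
  rw [fvecFun_add, fvecFun_sub, fvecFun_add_two, den, ← br]
  rw [Fin.sum_univ_two] at r1 r2 ⊢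
  rw [show ε * lam / 2 + 2 * M.l * M.η + (u / 2 - z + M.l * M.η) =
      -z + (ε * lam + u) / 2 + 3 * M.l * M.η by ring,
    show ε * lam / 2 + 2 * M.l * M.η - (u / 2 - z + M.l * M.η) =
      -(u / 2 - z - M.l * M.η - ε * lam / 2) by ring, br_neg] at r1
  rw [show ε * lam / 2 + 2 * M.l * M.η + (u / 2 + z + M.l * M.η) =
      z + (ε * lam + u) / 2 + 3 * M.l * M.η by ring,
    show ε * lam / 2 + 2 * M.l * M.η - (u / 2 + z + M.l * M.η) =
      -(u / 2 + z - M.l * M.η - ε * lam / 2) by ring, br_neg] at r2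
  rw [show u / 2 + z - M.l * M.η + ε * lam / 2 = z + (ε * lam + u) / 2 - M.l * M.η by ring,
    show u / 2 - z - M.l * M.η + ε * lam / 2 = -z + (ε * lam + u) / 2 - M.l * M.η by ring,
    show u / 2 + z - M.l * M.η + (u / 2 - z - M.l * M.η) = u - 2 * M.l * M.η by ring,
    show u / 2 + z - M.l * M.η - (u / 2 - z - M.l * M.η) = 2 * z by ring] at p
  generalize M.br (z + (ε * lam + u) / 2 + 3 * M.l * M.η) = q1 at *
  generalize M.br (-z + (ε * lam + u) / 2 + 3 * M.l * M.η) = q2 at *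
  generalize M.br (z + (ε * lam + u) / 2 - M.l * M.η) = q3 at *
  generalize M.br (-z + (ε * lam + u) / 2 - M.l * M.η) = q4 at *
  generalize M.fvecCore ((ε * lam + u) / 2) z = q5 at *
  generalize M.rowVec (u / 2 + z - M.l * M.η) j = q6 at *
  generalize M.rowVec (u / 2 - z - M.l * M.η) j = q7 at *
  linear_combination q5 * q1 * q4 * q6 * r1 - q5 * q3 * q2 * q7 * r2 + 2 * q5 * q1 * q2 * p

end fvec

/-! ### The relation between `T` and `Q_R` -/

/-- The gauge parameters `(2j+1)lη`, for `j = 0, 1, …`. -/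
noncomputable def gaugePoint (j : ℕ) : ℂ := (2 * j + 1) * M.l * M.η

theorem two_r_l_η : 2 * (M.r : ℂ) * M.l * M.η = M.rnum := by
  have h1 : (M.r : ℝ) ≠ 0 := by exact_mod_cast M.r_pos.ne'
  have h2 : (M.l : ℝ) ≠ 0 := by
    have : (M.twoL : ℝ) ≠ 0 := by exact_mod_cast M.twoL_pos.ne'
    rw [l]; positivity
  have : 2 * (M.r : ℝ) * M.l * M.η = M.rnum := by
    rw [η]; field_simp
  exact_mod_cast congrArg (fun x : ℝ => (x : ℂ)) this

/-- Unless it vanishes, `Svec i j u` is a vector `f_ε(λ, u)` for which `ελ/2` and `ελ/2 + 2lη` are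
the gauge points with the numbers `j` and `i`, up to the symmetries `x ↦ -x` and `x ↦ x + 1`. At the
two ends of the range of the indices this uses these symmetries and the rationality `2rlη = r'` of
the anisotropy. -/
theorem Svec_cases (i j : Fin M.r) : (∀ u, M.Svec i j u = 0) ∨ ∃ (ε : ℤ) (lam : ℂ),
    (∀ u, M.Svec i j u = M.fvec ε lam u) ∧ ∀ g : ℂ → Fin 2 → ℂ, (∀ x, g (-x) = g x) →
      (∀ x, g (x + 1) = g x) → g (ε * lam / 2) = g (M.gaugePoint j) ∧
        g (ε * lam / 2 + 2 * M.l * M.η) = g (M.gaugePoint i) := by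
  by_cases h1 : i.val = j.val + 1 ∨ (i = j ∧ j.val + 1 = M.r)
  · refine Or.inr ⟨1, 2 * (2 * j.val + 1) * M.l * M.η, fun u => by rw [Svec, if_pos h1],
      fun g hneg hper => ⟨?_, ?_⟩⟩
    · congr 1
      rw [gaugePoint]; push_cast; ring
    · rcases h1 with h | ⟨rfl, h⟩
      · congr 1
        rw [gaugePoint, h]; push_cast; ring
      · have hp : Function.Periodic g 1 := hper
        have hr := M.two_r_l_η
        rw [← h] at hr
        push_cast at hr
        rw [← hneg (M.gaugePoint i), ← hp.sub_int_mul_eq (2 * M.rnum)]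
        congr 1
        rw [gaugePoint]
        push_cast
        linear_combination 2 * hr
  · by_cases h2 : i.val + 1 = j.val ∨ (i = j ∧ j.val = 0)
    · refine Or.inr ⟨-1, 2 * (2 * j.val + 1) * M.l * M.η, fun u => by
        rw [Svec, if_neg h1, if_pos h2], fun g hneg hper => ⟨?_, ?_⟩⟩
      · rw [← hneg (M.gaugePoint j)]
        congr 1
        rw [gaugePoint]; push_cast; ring
      · rcases h2 with h | ⟨rfl, h⟩
        · rw [← hneg (M.gaugePoint i)]
          congr 1
          rw [gaugePoint, ← h]; push_cast; ring
        · congr 1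
          rw [gaugePoint, h]; push_cast; ring
    · exact Or.inl fun u => by rw [Svec, if_neg h1, if_neg h2]

theorem colVec_neg (x : ℂ) : M.colVec (-x) = M.colVec x := by
  rw [colVec, colVec, thA_neg, thB_neg]

theorem colVec_add_one (x : ℂ) : M.colVec (x + 1) = M.colVec x := by
  rw [colVec, colVec, thA_add_one, thB_add_one]

theorem rowVec_neg (x : ℂ) : M.rowVec (-x) = M.rowVec x := by
  rw [rowVec, rowVec, thA_neg, thB_neg]

theorem rowVec_add_one (x : ℂ) : M.rowVec (x + 1) = M.rowVec x := by
  rw [rowVec, rowVec, thA_add_one, thB_add_one]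

theorem ell_Svec_col (i j : Fin M.r) (u : ℂ) (a : Fin 2) :
    ∑ b, M.colVec (M.gaugePoint j) b • M.ell u a b (M.Svec i j u) =
      (2 * M.br (u + 2 * M.l * M.η) * M.colVec (M.gaugePoint i) a) •
        M.Svec i j (u - 2 * M.η) := by
  rcases M.Svec_cases i j with h | ⟨ε, lam, h, hg⟩
  · simp [h]
  · obtain ⟨h1, h2⟩ := hg M.colVec M.colVec_neg M.colVec_add_one
    rw [h, h, ← h1, ← h2]
    exact M.ell_fvec_col ε lam u a

theorem ell_Svec_row (i j : Fin M.r) (u : ℂ) (b : Fin 2) :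
    ∑ a, M.rowVec (M.gaugePoint i) a • M.ell u a b (M.Svec i j u) =
      (2 * M.br (u - 2 * M.l * M.η) * M.rowVec (M.gaugePoint j) b) •
        M.Svec i j (u + 2 * M.η) := by
  rcases M.Svec_cases i j with h | ⟨ε, lam, h, hg⟩
  · simp [h]
  · obtain ⟨h1, h2⟩ := hg M.rowVec M.rowVec_neg M.rowVec_add_one
    rw [h, h, ← h1, ← h2]
    exact M.ell_fvec_row ε lam u b

/-- The gauge points are real, and `θ₀₀` has no real zeros. -/
theorem thB_gaugePoint_ne (j : ℕ) : M.thB (M.gaugePoint j) ≠ 0 := by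
  intro h
  have ht : 0 < M.t / 2 := half_pos M.t_pos
  rw [thB, τ, show I * (M.t : ℂ) / 2 = I * ((M.t / 2 : ℝ) : ℂ) by push_cast; ring] at h
  obtain ⟨m, n, h⟩ := theta_zero_zero ht h
  have him := congrArg Complex.im h
  have e1 : M.gaugePoint j = (((2 * j + 1) * M.l * M.η : ℝ) : ℂ) := by
    rw [gaugePoint]; push_cast; ring
  have e2 : (1 / 2 + I * ((M.t / 2 : ℝ) : ℂ) / 2 + m + n * (I * ((M.t / 2 : ℝ) : ℂ))) =
      ((1 / 2 + m : ℝ) : ℂ) + ((M.t / 2 * (1 / 2 + n) : ℝ) : ℂ) * I := by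
    push_cast; ring
  rw [e1, e2, ofReal_im, add_im, ofReal_im, zero_add, mul_I_im, ofReal_re] at him
  have h3 := (mul_eq_zero.mp him.symm).resolve_left ht.ne'
  have h4 : (1 + 2 * n : ℝ) = 0 := by linarith
  have h5 : (1 + 2 * n : ℤ) = 0 := by exact_mod_cast h4
  omega

/-- The gauge transformation, with first column `colVec x`. -/
noncomputable def gauge (x : ℂ) : Matrix (Fin 2) (Fin 2) ℂ :=
  !![M.thB x, 0; -M.thA x, (M.thB x)⁻¹]

/-- The inverse of `gauge x`, with second row `rowVec x`. -/
noncomputable def gaugeInv (x : ℂ) : Matrix (Fin 2) (Fin 2) ℂ :=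
  !![(M.thB x)⁻¹, 0; M.thA x, M.thB x]

theorem gauge_mul_gaugeInv {x : ℂ} (hx : M.thB x ≠ 0) : M.gauge x * M.gaugeInv x = 1 := by
  rw [gauge, gaugeInv, Matrix.mul_fin_two, Matrix.one_fin_two]
  congr 3 <;> field_simp <;> simp

theorem gauge_zero (x : ℂ) (b : Fin 2) : M.gauge x b 0 = M.colVec x b := by
  fin_cases b <;> simp [gauge, colVec]

theorem gaugeInv_one (x : ℂ) (a : Fin 2) : M.gaugeInv x 1 a = M.rowVec x a := by
  fin_cases a <;> simp [gaugeInv, rowVec]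

/-- The local `L`-operator applied to `Svec i j u`, after the gauge transformation. -/
noncomputable def gaugedEntry (u : ℂ) (i j : Fin M.r) (a b : Fin 2) : M.V :=
  ∑ p : Fin 2 × Fin 2, (M.gaugeInv (M.gaugePoint i) a p.1 * M.gauge (M.gaugePoint j) p.2 b) •
    M.ell u p.1 p.2 (M.Svec i j u)

theorem gaugedEntry_zero (u : ℂ) (i j : Fin M.r) (a : Fin 2) : M.gaugedEntry u i j a 0 =
    (∑ a', M.gaugeInv (M.gaugePoint i) a a' *
      (2 * M.br (u + 2 * M.l * M.η) * M.colVec (M.gaugePoint i) a')) •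
        M.Svec i j (u - 2 * M.η) := by
  rw [gaugedEntry, Fintype.sum_prod_type, Finset.sum_smul]
  refine Finset.sum_congr rfl fun a' _ => ?_
  rw [mul_smul, ← ell_Svec_col, Finset.smul_sum]
  refine Finset.sum_congr rfl fun b _ => ?_
  rw [gauge_zero, mul_smul]

theorem gaugedEntry_one (u : ℂ) (i j : Fin M.r) (b : Fin 2) : M.gaugedEntry u i j 1 b =
    (∑ b', M.gauge (M.gaugePoint j) b' b *
      (2 * M.br (u - 2 * M.l * M.η) * M.rowVec (M.gaugePoint j) b')) •
        M.Svec i j (u + 2 * M.η) := by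
  rw [gaugedEntry, Fintype.sum_prod_type, Finset.sum_comm, Finset.sum_smul]
  refine Finset.sum_congr rfl fun b' _ => ?_
  rw [mul_smul, ← ell_Svec_row, Finset.smul_sum]
  refine Finset.sum_congr rfl fun a _ => ?_
  rw [gaugeInv_one, mul_comm, mul_smul]

/-- The lower left entry vanishes: `colVec` is orthogonal to `rowVec` at the same point. -/
theorem gaugedEntry_one_zero (u : ℂ) (i j : Fin M.r) : M.gaugedEntry u i j 1 0 = 0 := by
  rw [gaugedEntry_zero, Fin.sum_univ_two]
  simp only [gaugeInv, colVec]
  simp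
  left
  ring

theorem gaugedEntry_zero_zero (u : ℂ) (i j : Fin M.r) : M.gaugedEntry u i j 0 0 =
    (2 * M.br (u + 2 * M.l * M.η)) • M.Svec i j (u - 2 * M.η) := by
  rw [gaugedEntry_zero, Fin.sum_univ_two]
  have := M.thB_gaugePoint_ne i
  simp only [gaugeInv, colVec]
  congr 1
  simp
  field_simp

theorem gaugedEntry_one_one (u : ℂ) (i j : Fin M.r) : M.gaugedEntry u i j 1 1 =
    (2 * M.br (u - 2 * M.l * M.η)) • M.Svec i j (u + 2 * M.η) := by
  rw [gaugedEntry_one, Fin.sum_univ_two]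
  have := M.thB_gaugePoint_ne j
  simp only [gauge, rowVec]
  congr 1
  simp
  field_simp

/-- On each of the product vectors in the image of `Q_R(u)` the transfer matrix acts by its two
triangular diagonal terms. -/
theorem T_tprod_Svec (u : ℂ) (i : Fin M.N → Fin M.r) :
    M.T u (PiTensorProduct.tprod ℂ fun n => M.Svec (i n) (i ((finRotate M.N).symm n)) u) =
      M.hMinus u • PiTensorProduct.tprod ℂ
        (fun n => M.Svec (i n) (i ((finRotate M.N).symm n)) (u - 2 * M.η)) +
      M.hPlus u • PiTensorProduct.tprod ℂ
        (fun n => M.Svec (i n) (i ((finRotate M.N).symm n)) (u + 2 * M.η)) := by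
  have h1 := sum_gauge (PiTensorProduct.tprod ℂ (s := fun _ : Fin M.N => M.V)) (finRotate M.N).symm
    (fun n => M.gauge (M.gaugePoint (i n))) (fun n => M.gaugeInv (M.gaugePoint (i n)))
    (fun n => M.gauge_mul_gaugeInv (M.thB_gaugePoint_ne _))
    (fun n a b => M.ell u a b (M.Svec (i n) (i ((finRotate M.N).symm n)) u))
  have h2 := sum_triangular M.N_pos (PiTensorProduct.tprod ℂ (s := fun _ : Fin M.N => M.V))
    (fun n => M.gaugedEntry u (i n) (i ((finRotate M.N).symm n)))
    (fun n => M.gaugedEntry_one_zero _ _ _)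
  simp only [gaugedEntry_zero_zero, gaugedEntry_one_one, MultilinearMap.map_smul_univ,
    Finset.prod_const, Finset.card_univ, Fintype.card_fin] at h2
  rw [T_eq_sum, LinearMap.sum_apply]
  simp only [PiTensorProduct.map_tprod]
  rw [← h1]
  exact h2

theorem S_apply (c : M.Coeffs) (i j : Fin M.r) (u : ℂ) (x : Fin (M.twoL + 1) → ℂ) :
    M.S c i j u x = (∑ k, x k * c k j) • M.Svec i j u := by
  rw [S, Fintype.linearCombination_apply, Finset.sum_smul]
  exact Finset.sum_congr rfl fun k _ => (mul_smul _ _ _).symm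

theorem QR_tprod (c : M.Coeffs) (u : ℂ) (x : Fin M.N → Fin (M.twoL + 1) → ℂ) :
    M.QR c u (PiTensorProduct.tprod ℂ x) = ∑ i : Fin M.N → Fin M.r,
      (∏ n, ∑ k, x n k * c k (i ((finRotate M.N).symm n))) •
        PiTensorProduct.tprod ℂ fun n => M.Svec (i n) (i ((finRotate M.N).symm n)) u := by
  rw [QR, LinearMap.sum_apply]
  refine Finset.sum_congr rfl fun i _ => ?_
  simp only [PiTensorProduct.map_tprod, S_apply, MultilinearMap.map_smul_univ]

theorem T_comp_QR (c : M.Coeffs) (u : ℂ) : M.T u ∘ₗ M.QR c u =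
    M.hMinus u • M.QR c (u - 2 * M.η) + M.hPlus u • M.QR c (u + 2 * M.η) := by
  refine PiTensorProduct.ext (MultilinearMap.ext fun x => ?_)
  simp only [LinearMap.compMultilinearMap_apply, LinearMap.comp_apply, LinearMap.add_apply,
    LinearMap.smul_apply, QR_tprod, map_sum, map_smul, T_tprod_Svec, Finset.smul_sum,
    ← Finset.sum_add_distrib]
  refine Finset.sum_congr rfl fun i _ => ?_
  rw [smul_add, smul_comm, smul_comm (M.hPlus u)]

/-! ### The relation between `Q_L` and `T` -/

theorem isAdjoint_QR (c : M.Coeffs) (u : ℂ) :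
    IsAdjoint (tensorForm (stdForm (Fin (M.twoL + 1)))) M.form (M.QR c u) (M.QL c (-conj u)) := by
  have h := (isAdjoint_iff M.form (M.QR c u) (M.QL c (-conj u))).mpr (by
    rw [QL, map_neg, conj_conj, neg_neg])
  exact h

theorem conj_hMinus (u : ℂ) : conj (M.hMinus u) = (-1) ^ M.N * M.hPlus (-conj u) := by
  rw [hMinus, hPlus, map_pow, map_mul, conj_br, ← mul_pow,
    show -conj u - 2 * M.l * M.η = -(conj u + 2 * M.l * M.η) by ring, br_neg]
  simp only [map_add, map_mul, map_ofNat, conj_ofReal]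
  congr 1
  ring

theorem conj_hPlus (u : ℂ) : conj (M.hPlus u) = (-1) ^ M.N * M.hMinus (-conj u) := by
  rw [hMinus, hPlus, map_pow, map_mul, conj_br, ← mul_pow,
    show -conj u + 2 * M.l * M.η = -(conj u - 2 * M.l * M.η) by ring, br_neg]
  simp only [map_sub, map_mul, map_ofNat, conj_ofReal]
  congr 1
  ring

/-- The adjoint of `T_comp_QR` at `-conj u`. The two terms change places, and the signs `(-1)^N`
from `T` and from the odd function `[·]` cancel. -/
theorem QL_comp_T (c : M.Coeffs) (u : ℂ) : M.QL c u ∘ₗ M.T u =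
    M.hMinus u • M.QL c (u - 2 * M.η) + M.hPlus u • M.QL c (u + 2 * M.η) := by
  have hu : -conj (-conj u) = u := by simp
  have h1 := (M.isAdjoint_QR c (-conj u)).comp (M.isAdjoint_T (-conj u))
  have h2 := ((M.isAdjoint_QR c (-conj u - 2 * M.η)).smul (M.hMinus (-conj u))).add
    ((M.isAdjoint_QR c (-conj u + 2 * M.η)).smul (M.hPlus (-conj u)))
  rw [← T_comp_QR, conj_hMinus, conj_hPlus, hu,
    show -conj (-conj u - 2 * (M.η : ℂ)) = u + 2 * M.η by
      simp only [map_sub, map_neg, map_mul, map_ofNat, conj_ofReal, conj_conj]; ring,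
    show -conj (-conj u + 2 * (M.η : ℂ)) = u - 2 * M.η by
      simp only [map_add, map_neg, map_mul, map_ofNat, conj_ofReal, conj_conj]; ring] at h2
  rw [hu] at h1
  have h3 := ((isAdjoint_iff _ _ _).mp h1).trans ((isAdjoint_iff _ _ _).mp h2).symm
  have hs : ((-1 : ℂ) ^ M.N) * (-1) ^ M.N = 1 := by rw [← mul_pow]; norm_num
  have h4 := congrArg (fun A => ((-1 : ℂ) ^ M.N) • A) h3
  simp only [LinearMap.comp_smul, smul_add, smul_smul, ← mul_assoc, hs, one_mul, one_smul] at h4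
  exact h4.trans (add_comm _ _)

end SpinModel

end Sklyanin

theorem mainTheorem2 (M : Sklyanin.SpinModel) (c : M.Coeffs) :
    (∀ (u : ℂ) (A : Module.End ℂ M.H),
      Sklyanin.IsAdjoint M.form M.form (M.T u) A ↔ A = (-1 : ℂ) ^ M.N • M.T (-conj u)) ∧
    (∀ u : ℂ, M.QL c u ∘ₗ M.T u =
      M.hMinus u • M.QL c (u - 2 * M.η) + M.hPlus u • M.QL c (u + 2 * M.η)) :=
  ⟨M.isAdjoint_T_iff, M.QL_comp_T c⟩
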